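/- **Setting.** Let $V$ be a finite-dimensional $\mathbf Q$-vector space with a rational Hodge structure of weight two, given by $h:\mathbf C^*\to GL(V_{\mathbf R})$, so that $V_{\mathbf C}=V^{2,0}\oplus V^{1,1}\oplus V^{0,2}$ and $h(z)$ acts on $V^{p,q}$ as $z^p\bar z^q$. Let $Q:V\times V\to\mathbf Q$ be a polarization: $Q(h(z)v,h(z)w)=(z\bar z)^2Q(v,w)$, and $Q(v,h(i)w)$ is symmetric and positive definite on $V_{\mathbf R}$. Assume $\dim V^{2,0}=1$. Let $C(Q)$ be the Clifford algebra with $v^2=Q(v,v)$ for $v\in V$, and $C^+(Q)$ its even subalgebra. Choose $f_1,f_2\in V_{\mathbf R}$ such that $f_1+if_2$ spans $V^{2,0}$ and $Q(f_1,f_1)=-1$. Then $J:=f_1f_2\in C^+(Q)_{\mathbf R}$ is independent of this choice and $J^2=-1$. Let $h_s:\mathbf C^*\to GL(C^+(Q)_{\mathbf R})$, $h_s(a+bi)=[x\mapsto (a-bJ)x]$; this is a rational Hodge structure of weight one on $C^+(Q)$. An algebraic subgroup $G$ of $GL(W)$ defined over $\mathbf Q$ is given by polynomial equations with rational coefficients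 in the matrix entries and $\det^{-1}$, whose solutions in every commutative $\mathbf Q$-algebra $A$ form a subgroup $G(A)$ of $GL(W_A)$. Inclusions and equalities of such groups are meant for all $A$. The Mumford–Tate group $MT(W)$ of a Hodge structure $(W,h_W)$ is the smallest algebraic subgroup of $GL(W)$ defined over $\mathbf Q$ with $h_W(\mathbf C^*)\subseteq MT(W)(\mathbf R)$. Let $GO(Q)$ be the group of similitudes of $Q$, $SO(Q)$ the special orthogonal group, and $$CSpin(Q)=\{g\in C^+(Q)^*: gVg^{-1}= V\},\qquad \rho(g)=[v\mapsto gvg^{-1}]\in GL(V),$$ with $CSpin(Q)$ identified with its image in $GL(C^+(Q))$ under left multiplication. **Proposition 6.3.** 1. $h_s(\mathbf C^*)\subseteq CSpin(Q)(\mathbf R)$ and $MT(C^+(Q))\subseteq CSpin(Q)$. Moreover $MT(C^+(Q))=CSpin(Q)$ if $MT(V)=GO(Q)$, and more generally if $MT(V)\supseteq SO(Q)$. 2. For all $t,\phi\in\mathbf R$ with $t\neq0$: $h(te^{i\phi})=t^2\rho(h_s(e^{i\phi}))$. 3. $(V,h)$ is a sub-Hodge structure of $(C^+(Q)\otimes C^+(Q),h_s\otimes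 h_s)$: there is an injective $\mathbf Q$-linear map $f:V\to C^+(Q)\otimes C^+(Q)$ with $f(h(z)v)=(h_s(z)\otimes h_s(z))f(v)$ for all $z\in\mathbf C^*$, $v\in V_{\mathbf R}$. -/

import Mathlib

open scoped TensorProduct ComplexConjugate

namespace KugaSatake

noncomputable section

/-! # Rational Hodge structures -/

section Hodge

variable {V : Type*} [AddCommGroup V] [Module ℚ V] {W : Type*} [AddCommGroup W] [Module ℚ W]

/-- For `h : ℂˣ → GL(V_ℝ)`, the space `V^{p,q}` of all `x ∈ V_ℂ = ℂ ⊗ V_ℝ` on which every `h z` acts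
as `z ^ p * conj z ^ q`. -/
def hodgePiece (h : ℂˣ →* LinearMap.GeneralLinearGroup ℝ (ℝ ⊗[ℚ] V)) (p q : ℤ) :
    Submodule ℂ (ℂ ⊗[ℝ] (ℝ ⊗[ℚ] V)) where
  carrier := {x | ∀ z : ℂˣ, ((h z : (ℝ ⊗[ℚ] V) →ₗ[ℝ] (ℝ ⊗[ℚ] V)).baseChange ℂ) x =
    ((z : ℂ) ^ p * (conj (z : ℂ)) ^ q) • x}
  add_mem' {x y} hx hy z := by rw [map_add, hx z, hy z, smul_add]
  zero_mem' z := by simp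
  smul_mem' c x hx z := by rw [map_smul, hx z, smul_comm]

/-- A rational Hodge structure of weight `k` on `V`, given by the representation `h` of `ℂˣ` on
`V_ℝ` for which `V_ℂ` is the sum of the spaces `V^{p,q}` with `p + q = k`, where `h z` acts on
`V^{p,q}` as `z ^ p * conj z ^ q`.  (Such a sum is automatically direct, and `V^{q,p}` is
automatically the conjugate of `V^{p,q}`, because `h` is real.) -/
structure HodgeStructure (V : Type*) [AddCommGroup V] [Module ℚ V] (k : ℤ) where
  /-- the representation of `ℂˣ` -/
  h : ℂˣ →* LinearMap.GeneralLinearGroup ℝ (ℝ ⊗[ℚ] V)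
  iSup_piece : ⨆ p : ℤ, hodgePiece h p (k - p) = ⊤

/-- The complex space `V^{p,q}` of a Hodge structure. -/
abbrev HodgeStructure.piece {k : ℤ} (H : HodgeStructure V k) (p q : ℤ) :
    Submodule ℂ (ℂ ⊗[ℝ] (ℝ ⊗[ℚ] V)) := hodgePiece H.h p q

/-- Only the `V^{p,q}` with `p, q ≥ 0` may be nonzero. -/
def HodgeStructure.IsEffective {k : ℤ} (H : HodgeStructure V k) : Prop :=
  ∀ p q : ℤ, H.piece p q ≠ ⊥ → 0 ≤ p ∧ 0 ≤ q

/-- The imaginary unit as an element of `ℂˣ`. -/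
def unitI : ℂˣ := Units.mk0 Complex.I Complex.I_ne_zero

/-- The bilinear form `Ψ` is a polarization of the Hodge structure `H` of weight `k`. -/
structure HodgeStructure.IsPolarization {k : ℤ} (H : HodgeStructure V k)
    (Ψ : LinearMap.BilinForm ℚ V) : Prop where
  equivariant : ∀ (z : ℂˣ) (v w : ℝ ⊗[ℚ] V),
    Ψ.baseChange ℝ ((H.h z).val v) ((H.h z).val w) =
      (Complex.normSq z) ^ k * Ψ.baseChange ℝ v w
  symm : ∀ v w : ℝ ⊗[ℚ] V,
    Ψ.baseChange ℝ v ((H.h unitI).val w) = Ψ.baseChange ℝ w ((H.h unitI).val v)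
  pos : ∀ v : ℝ ⊗[ℚ] V, v ≠ 0 → 0 < Ψ.baseChange ℝ v ((H.h unitI).val v)

/-- A (strict) morphism of Hodge structures: a `ℚ`-linear map whose real extension intertwines the
two representations of `ℂˣ`. -/
def IsHodgeMorphism {k l : ℤ} (H : HodgeStructure V k) (H' : HodgeStructure W l)
    (f : V →ₗ[ℚ] W) : Prop :=
  ∀ (z : ℂˣ) (x : ℝ ⊗[ℚ] V), f.baseChange ℝ ((H.h z).val x) = (H'.h z).val (f.baseChange ℝ x)

/-- The tensor product representation `z ↦ h z ⊗ h' z` on `(V ⊗ W)_ℝ = V_ℝ ⊗ W_ℝ`. -/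
def tensorRep (h : ℂˣ →* LinearMap.GeneralLinearGroup ℝ (ℝ ⊗[ℚ] V))
    (h' : ℂˣ →* LinearMap.GeneralLinearGroup ℝ (ℝ ⊗[ℚ] W)) :
    ℂˣ →* LinearMap.GeneralLinearGroup ℝ (ℝ ⊗[ℚ] (V ⊗[ℚ] W)) :=
  MonoidHom.toHomUnits
    { toFun := fun z =>
        (TensorProduct.AlgebraTensorModule.distribBaseChange ℚ ℝ V W).symm.toLinearMap ∘ₗ
          TensorProduct.map (h z).val (h' z).val ∘ₗ
          (TensorProduct.AlgebraTensorModule.distribBaseChange ℚ ℝ V W).toLinearMap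
      map_one' := by
        ext; simp
      map_mul' := fun z w => by
        apply LinearMap.ext
        intro x
        simp [TensorProduct.map_mul] }

theorem tensorRep_equivariant (h : ℂˣ →* LinearMap.GeneralLinearGroup ℝ (ℝ ⊗[ℚ] V))
    (h' : ℂˣ →* LinearMap.GeneralLinearGroup ℝ (ℝ ⊗[ℚ] W)) (z : ℂˣ)
    (x : ℂ ⊗[ℝ] (ℝ ⊗[ℚ] V)) (y : ℂ ⊗[ℝ] (ℝ ⊗[ℚ] W)) :
    ((tensorRep h h' z).val.baseChange ℂ)
      ((TensorProduct.AlgebraTensorModule.distribBaseChange ℚ ℝ V W).symm.toLinearMap.baseChange ℂ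
        ((TensorProduct.AlgebraTensorModule.distribBaseChange ℝ ℂ _ _).symm (x ⊗ₜ[ℂ] y))) =
    (TensorProduct.AlgebraTensorModule.distribBaseChange ℚ ℝ V W).symm.toLinearMap.baseChange ℂ
        ((TensorProduct.AlgebraTensorModule.distribBaseChange ℝ ℂ _ _).symm
          (((h z).val.baseChange ℂ x) ⊗ₜ[ℂ] ((h' z).val.baseChange ℂ y))) := by
  induction x using TensorProduct.induction_on with
  | zero => simp
  | add x₁ x₂ h₁ h₂ => simp only [TensorProduct.add_tmul, map_add, h₁, h₂]
  | tmul c v =>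
    induction y using TensorProduct.induction_on with
    | zero => simp
    | add y₁ y₂ h₁ h₂ => simp only [TensorProduct.tmul_add, map_add, h₁, h₂]
    | tmul d w =>
      simp [tensorRep]

theorem iSup_piece_tensorRep {k l : ℤ} (H : HodgeStructure V k) (H' : HodgeStructure W l) :
    ⨆ p : ℤ, hodgePiece (tensorRep H.h H'.h) p (k + l - p) = ⊤ := by
  set T := ⨆ p : ℤ, hodgePiece (tensorRep H.h H'.h) p (k + l - p) with hT
  set d := (TensorProduct.AlgebraTensorModule.distribBaseChange ℚ ℝ V W) with hd
  have key : ∀ (x : ℂ ⊗[ℝ] (ℝ ⊗[ℚ] V)) (y : ℂ ⊗[ℝ] (ℝ ⊗[ℚ] W)),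
      d.symm.toLinearMap.baseChange ℂ
        ((TensorProduct.AlgebraTensorModule.distribBaseChange ℝ ℂ _ _).symm (x ⊗ₜ[ℂ] y)) ∈ T := by
    intro x y
    have hx : x ∈ ⨆ p : ℤ, hodgePiece H.h p (k - p) := by rw [H.iSup_piece]; trivial
    have hy : y ∈ ⨆ p : ℤ, hodgePiece H'.h p (l - p) := by rw [H'.iSup_piece]; trivial
    induction hx using Submodule.iSup_induction' with
    | zero => simp
    | add x₁ x₂ _ _ h₁ h₂ =>
      simp only [TensorProduct.add_tmul, map_add]
      exact T.add_mem h₁ h₂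
    | mem p x hx =>
      induction hy using Submodule.iSup_induction' with
      | zero => simp
      | add x₁ x₂ _ _ h₁ h₂ =>
        simp only [TensorProduct.tmul_add, map_add]
        exact T.add_mem h₁ h₂
      | mem q y hy =>
        refine Submodule.mem_iSup_of_mem (p + q) ?_
        intro z
        have hz : (z : ℂ) ≠ 0 := z.ne_zero
        have hz' : conj (z : ℂ) ≠ 0 := by simp
        rw [tensorRep_equivariant, hx z, hy z, TensorProduct.smul_tmul_smul, map_smul, map_smul]
        congr 1
        rw [zpow_add₀ hz, show k + l - (p + q) = (k - p) + (l - q) by ring, zpow_add₀ hz']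
        ring
  refine Submodule.eq_top_iff'.2 fun t => ?_
  obtain ⟨u, rfl⟩ : ∃ u, d.symm.toLinearMap.baseChange ℂ
      ((TensorProduct.AlgebraTensorModule.distribBaseChange ℝ ℂ _ _).symm u) = t := by
    refine ⟨TensorProduct.AlgebraTensorModule.distribBaseChange ℝ ℂ _ _
      (d.toLinearMap.baseChange ℂ t), ?_⟩
    rw [LinearEquiv.symm_apply_apply, ← LinearMap.comp_apply, ← LinearMap.baseChange_comp]
    simp
  induction u using TensorProduct.induction_on with
  | zero => simp
  | add x y hx hy => rw [map_add, map_add]; exact T.add_mem hx hy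
  | tmul x y => exact key x y

/-- The tensor product of Hodge structures of weights `k` and `l`, of weight `k + l`. -/
def HodgeStructure.tensor {k l : ℤ} (H : HodgeStructure V k) (H' : HodgeStructure W l) :
    HodgeStructure (V ⊗[ℚ] W) (k + l) where
  h := tensorRep H.h H'.h
  iSup_piece := iSup_piece_tensorRep H H'

end Hodge

/-! # Algebraic groups and the Mumford-Tate group -/

section AlgebraicGroups

variable {V : Type*} [AddCommGroup V] [Module ℚ V]

/-- A family of subgroups of `GL(V)(A) = GL(A ⊗ V)`, one for every commutative `ℚ`-algebra `A`. -/
abbrev GroupFamily (V : Type*) [AddCommGroup V] [Module ℚ V] :=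
  ∀ (A : Type) [CommRing A] [Algebra ℚ A], Subgroup (LinearMap.GeneralLinearGroup A (A ⊗[ℚ] V))

/-- The entries `g i j` of the matrix of `g ∈ GL(V)(A)` in a fixed `ℚ`-basis of `V`, together with
`(det g)⁻¹` (at the index `none`). -/
def glCoord {A : Type} [CommRing A] [Algebra ℚ A]
    (g : LinearMap.GeneralLinearGroup A (A ⊗[ℚ] V)) :
    Option (Module.Free.ChooseBasisIndex ℚ V × Module.Free.ChooseBasisIndex ℚ V) → A
  | none => LinearMap.det (g⁻¹).val
  | some (i, j) =>
      ((Module.Free.chooseBasis ℚ V).baseChange A).repr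
        (g.val ((Module.Free.chooseBasis ℚ V).baseChange A j)) i

/-- The family `G` is an algebraic subgroup of `GL(V)` defined over `ℚ`: for every commutative
`ℚ`-algebra `A`, `G A` is the set of solutions in `GL(V)(A)` of a fixed set of polynomial equations
with rational coefficients in the matrix entries and the inverse of the determinant. -/
def GroupFamily.IsAlgebraic (G : GroupFamily V) : Prop :=
  ∃ S : Set (MvPolynomial
      (Option (Module.Free.ChooseBasisIndex ℚ V × Module.Free.ChooseBasisIndex ℚ V)) ℚ),
    ∀ (A : Type) [CommRing A] [Algebra ℚ A] (g : LinearMap.GeneralLinearGroup A (A ⊗[ℚ] V)),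
      g ∈ G A ↔ ∀ P ∈ S, MvPolynomial.aeval (glCoord g) P = 0

/-- The Mumford-Tate group of a Hodge structure `H` on `V`: the smallest algebraic subgroup of
`GL(V)` defined over `ℚ` whose group of real points contains `H.h z` for all `z`, that is, the
intersection of all of them. -/
def mumfordTate {k : ℤ} (H : HodgeStructure V k) : GroupFamily V := fun A _ _ =>
  ⨅ (G : GroupFamily V) (_ : G.IsAlgebraic) (_ : ∀ z : ℂˣ, H.h z ∈ G ℝ), G A

/-- The Mumford-Tate group is itself algebraic. -/
theorem mumfordTate_isAlgebraic {k : ℤ} (H : HodgeStructure V k) :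
    (mumfordTate H).IsAlgebraic := by
  refine ⟨⋃ (G : {G : GroupFamily V // G.IsAlgebraic ∧ ∀ z : ℂˣ, H.h z ∈ G ℝ}),
    G.2.1.choose, ?_⟩
  intro A _ _ g
  simp only [mumfordTate, Subgroup.mem_iInf, Set.mem_iUnion]
  constructor
  · rintro hg P ⟨G, hP⟩
    exact (G.2.1.choose_spec A g).1 (hg G.1 G.2.1 G.2.2) P hP
  · intro hg G hG hh
    exact (hG.choose_spec A g).2 fun P hP => hg P ⟨⟨G, hG, hh⟩, hP⟩

/-- The group `GO(Q)` of similitudes. -/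
def groupGO (Q : LinearMap.BilinForm ℚ V) : GroupFamily V := fun A _ _ =>
  { carrier := {g | ∃ ν : Aˣ, ∀ v w : A ⊗[ℚ] V,
      Q.baseChange A (g.val v) (g.val w) = ν * Q.baseChange A v w}
    mul_mem' := by
      rintro g g' ⟨ν, hν⟩ ⟨ν', hν'⟩
      refine ⟨ν * ν', fun v w => ?_⟩
      simp only [Units.val_mul, Module.End.mul_apply, hν, hν', mul_assoc]
    one_mem' := ⟨1, fun v w => by simp⟩
    inv_mem' := by
      rintro g ⟨ν, hν⟩
      refine ⟨ν⁻¹, fun v w => ?_⟩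
      rw [Units.eq_inv_mul_iff_mul_eq, ← hν]
      simp only [← Module.End.mul_apply, Units.mul_inv, Module.End.one_apply] }

/-- The special orthogonal group `SO(Q)`. -/
def groupSO (Q : LinearMap.BilinForm ℚ V) : GroupFamily V := fun A _ _ =>
  { carrier := {g | (∀ v w : A ⊗[ℚ] V,
      Q.baseChange A (g.val v) (g.val w) = Q.baseChange A v w) ∧ LinearMap.det g.val = 1}
    mul_mem' := by
      rintro g g' ⟨h, hd⟩ ⟨h', hd'⟩
      refine ⟨fun v w => ?_, by rw [Units.val_mul, map_mul, hd, hd', one_mul]⟩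
      simp only [Units.val_mul, Module.End.mul_apply, h, h']
    one_mem' := ⟨fun v w => by simp, by simp⟩
    inv_mem' := by
      rintro g ⟨h, hd⟩
      refine ⟨fun v w => ?_, ?_⟩
      · rw [← h]
        simp only [← Module.End.mul_apply, Units.mul_inv, Module.End.one_apply]
      · have := congrArg LinearMap.det g.mul_inv
        rwa [map_mul, hd, one_mul, map_one] at this }

end AlgebraicGroups

/-! # Clifford algebras and the group `CSpin` -/

section Clifford

variable {V : Type*} [AddCommGroup V] [Module ℚ V]

/-- The Clifford algebra `C(Q)` of the quadratic form `v ↦ Q(v, v)`. -/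
abbrev Cliff (Q : LinearMap.BilinForm ℚ V) :=
  CliffordAlgebra (LinearMap.BilinMap.toQuadraticMap Q)

/-- The even Clifford algebra `C⁺(Q)`. -/
abbrev EvenCliff (Q : LinearMap.BilinForm ℚ V) :=
  CliffordAlgebra.even (LinearMap.BilinMap.toQuadraticMap Q)

variable (Q : LinearMap.BilinForm ℚ V) (A : Type) [CommRing A] [Algebra ℚ A]

/-- The inclusion `V_A → C(Q)_A`. -/
def vecIncl : A ⊗[ℚ] V →ₗ[A] A ⊗[ℚ] Cliff Q :=
  (CliffordAlgebra.ι (LinearMap.BilinMap.toQuadraticMap Q)).baseChange A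

/-- The inclusion `C⁺(Q)_A → C(Q)_A`. -/
def evenIncl : A ⊗[ℚ] EvenCliff Q →ₐ[A] A ⊗[ℚ] Cliff Q :=
  Algebra.TensorProduct.map (AlgHom.id A A) (EvenCliff Q).val

theorem ι_injective :
    Function.Injective (CliffordAlgebra.ι (LinearMap.BilinMap.toQuadraticMap Q)) := by
  have h : LinearMap.BilinMap.toQuadraticMap (-Q) =
      (0 : QuadraticForm ℚ V) - LinearMap.BilinMap.toQuadraticMap Q := by
    ext; simp
  intro x y hxy
  have := congrArg (CliffordAlgebra.changeForm h) hxy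
  rw [CliffordAlgebra.changeForm_ι, CliffordAlgebra.changeForm_ι] at this
  exact (ExteriorAlgebra.ι_leftInverse (R := ℚ) (M := V)).injective this

theorem vecIncl_injective : Function.Injective (vecIncl Q A) :=
  Module.Flat.lTensor_preserves_injective_linearMap _
    (ι_injective Q)

theorem evenIncl_injective : Function.Injective (evenIncl Q A) :=
  Module.Flat.lTensor_preserves_injective_linearMap (EvenCliff Q).val.toLinearMap
    Subtype.val_injective

/-- The group of all units `g` of `C⁺(Q)_A` with `g V_A g⁻¹ = V_A` inside `C(Q)_A`. -/
def cspinUnits : Subgroup (A ⊗[ℚ] EvenCliff Q)ˣ where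
  carrier := {g |
    (∀ v, ∃ w, evenIncl Q A g.val * vecIncl Q A v * evenIncl Q A (g⁻¹).val = vecIncl Q A w) ∧
    (∀ v, ∃ w, evenIncl Q A (g⁻¹).val * vecIncl Q A v * evenIncl Q A g.val = vecIncl Q A w)}
  mul_mem' := by
    rintro a b ⟨ha, ha'⟩ ⟨hb, hb'⟩
    refine ⟨fun v => ?_, fun v => ?_⟩
    · obtain ⟨w, hw⟩ := hb v
      obtain ⟨u, hu⟩ := ha w
      refine ⟨u, ?_⟩
      rw [← hu, ← hw, mul_inv_rev, Units.val_mul, Units.val_mul, map_mul, map_mul]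
      simp only [mul_assoc]
    · obtain ⟨w, hw⟩ := ha' v
      obtain ⟨u, hu⟩ := hb' w
      refine ⟨u, ?_⟩
      rw [← hu, ← hw, mul_inv_rev, Units.val_mul, Units.val_mul, map_mul, map_mul]
      simp only [mul_assoc]
  one_mem' := ⟨fun v => ⟨v, by simp⟩, fun v => ⟨v, by simp⟩⟩
  inv_mem' := by
    rintro a ⟨ha, ha'⟩
    exact ⟨by simpa using ha', by simpa using ha⟩

variable {A} in
/-- `v ↦ g v g⁻¹` on `V_A`, for `g` in `cspinUnits Q A`. -/
def conjVec (g : cspinUnits Q A) : A ⊗[ℚ] V →ₗ[A] A ⊗[ℚ] V :=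
  (LinearEquiv.ofInjective (vecIncl Q A) (vecIncl_injective Q A)).symm.toLinearMap ∘ₗ
    LinearMap.codRestrict (LinearMap.range (vecIncl Q A))
      (LinearMap.mulLeft A (evenIncl Q A g.1.val) ∘ₗ
        LinearMap.mulRight A (evenIncl Q A (g.1⁻¹).val) ∘ₗ vecIncl Q A)
      (fun v => by
        obtain ⟨w, hw⟩ := g.2.1 v
        exact ⟨w, by simp [← hw, mul_assoc]⟩)

variable {A} in
theorem vecIncl_conjVec (g : cspinUnits Q A) (v : A ⊗[ℚ] V) :
    vecIncl Q A (conjVec Q g v) =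
      evenIncl Q A g.1.val * vecIncl Q A v * evenIncl Q A (g.1⁻¹).val := by
  have h := LinearEquiv.apply_symm_apply
    (LinearEquiv.ofInjective (vecIncl Q A) (vecIncl_injective Q A))
  have := congrArg Subtype.val (h (LinearMap.codRestrict (LinearMap.range (vecIncl Q A))
      (LinearMap.mulLeft A (evenIncl Q A g.1.val) ∘ₗ
        LinearMap.mulRight A (evenIncl Q A (g.1⁻¹).val) ∘ₗ vecIncl Q A)
      (fun v => by
        obtain ⟨w, hw⟩ := g.2.1 v
        exact ⟨w, by simp [← hw, mul_assoc]⟩) v))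
  rw [LinearEquiv.ofInjective_apply] at this
  refine Eq.trans this ?_
  simp [mul_assoc]

/-- The representation `ρ : CSpin(Q)(A) → GL(V)(A)`, `g ↦ [v ↦ g v g⁻¹]`. -/
def rho : cspinUnits Q A →* LinearMap.GeneralLinearGroup A (A ⊗[ℚ] V) :=
  MonoidHom.toHomUnits
    { toFun := conjVec Q
      map_one' := by
        apply LinearMap.ext
        intro v
        apply vecIncl_injective Q A
        rw [vecIncl_conjVec]
        simp
      map_mul' := fun a b => by
        apply LinearMap.ext
        intro v
        apply vecIncl_injective Q A
        rw [vecIncl_conjVec, Module.End.mul_apply, vecIncl_conjVec, vecIncl_conjVec]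
        simp only [Subgroup.coe_mul, mul_inv_rev, Units.val_mul, map_mul, mul_assoc] }

/-- The action `σ` of the units of `C⁺(Q)_A` on `C⁺(Q)_A` by multiplication on the left,
`g ↦ [x ↦ g x]`. -/
def sigma : (A ⊗[ℚ] EvenCliff Q)ˣ →* LinearMap.GeneralLinearGroup A (A ⊗[ℚ] EvenCliff Q) :=
  Units.map (Algebra.lmul A (A ⊗[ℚ] EvenCliff Q) : _ →* _)

/-- The group `CSpin(Q)`, identified with its image in `GL(C⁺(Q))` under `σ`. -/
def groupCSpin : GroupFamily (EvenCliff Q) := fun A _ _ => (cspinUnits Q A).map (sigma Q A)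

end Clifford

/-! # The Kuga-Satake Hodge structure -/

section KS

variable {V : Type*} [AddCommGroup V] [Module ℚ V]

/-- `(V, h, Q)` is a polarized Hodge structure of weight two (with `p, q ≥ 0`) such that `V^{2,0}`
has dimension one. -/
structure IsK3Type (H : HodgeStructure V 2) (Q : LinearMap.BilinForm ℚ V) : Prop where
  effective : H.IsEffective
  polarization : H.IsPolarization Q
  finrank_piece : Module.finrank ℂ (H.piece 2 0) = 1

/-- `f₁, f₂ ∈ V_ℝ` are such that `f₁ + i f₂` spans `V^{2,0}` and `Q(f₁) = -1`. -/
structure IsFrame (H : HodgeStructure V 2) (Q : LinearMap.BilinForm ℚ V)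
    (f₁ f₂ : ℝ ⊗[ℚ] V) : Prop where
  span : H.piece 2 0 = Submodule.span ℂ {(1 : ℂ) ⊗ₜ[ℝ] f₁ + Complex.I ⊗ₜ[ℝ] f₂}
  norm : Q.baseChange ℝ f₁ f₁ = -1

/-- The product `V_ℝ × V_ℝ → C⁺(Q)_ℝ` of the Clifford algebra. -/
def evenProd (Q : LinearMap.BilinForm ℚ V) :
    (ℝ ⊗[ℚ] V) →ₗ[ℝ] (ℝ ⊗[ℚ] V) →ₗ[ℝ] ℝ ⊗[ℚ] EvenCliff Q :=
  LinearMap.BilinMap.baseChange ℝ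
    (CliffordAlgebra.even.ι (LinearMap.BilinMap.toQuadraticMap Q)).bilin

theorem evenIncl_evenProd (Q : LinearMap.BilinForm ℚ V) (v w : ℝ ⊗[ℚ] V) :
    evenIncl Q ℝ (evenProd Q v w) = vecIncl Q ℝ v * vecIncl Q ℝ w := by
  induction v using TensorProduct.induction_on with
  | zero => simp
  | add v₁ v₂ h₁ h₂ => simp only [map_add, LinearMap.add_apply, add_mul, h₁, h₂]
  | tmul a v =>
    induction w using TensorProduct.induction_on with
    | zero => simp
    | add v₁ v₂ h₁ h₂ => simp only [map_add, mul_add, h₁, h₂]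
    | tmul b w =>
      simp only [evenProd, LinearMap.BilinMap.baseChange_tmul, evenIncl, vecIncl,
        LinearMap.baseChange_tmul, Algebra.TensorProduct.map_tmul,
        Algebra.TensorProduct.tmul_mul_tmul]
      rfl

theorem vecIncl_mul_add_swap (Q : LinearMap.BilinForm ℚ V) (v w : ℝ ⊗[ℚ] V) :
    vecIncl Q ℝ v * vecIncl Q ℝ w + vecIncl Q ℝ w * vecIncl Q ℝ v =
      algebraMap ℝ _ (Q.baseChange ℝ v w + Q.baseChange ℝ w v) := by
  induction v using TensorProduct.induction_on with
  | zero => simp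
  | add v₁ v₂ h₁ h₂ =>
    simp only [map_add, LinearMap.add_apply, add_mul, mul_add] at h₁ h₂ ⊢
    linear_combination (norm := module) h₁ + h₂
  | tmul a v =>
    induction w using TensorProduct.induction_on with
    | zero => simp
    | add v₁ v₂ h₁ h₂ =>
      simp only [map_add, LinearMap.add_apply, add_mul, mul_add] at h₁ h₂ ⊢
      linear_combination (norm := module) h₁ + h₂
    | tmul b w =>
      have h := CliffordAlgebra.ι_mul_ι_add_swap (Q := LinearMap.BilinMap.toQuadraticMap Q) v w
      simp only [vecIncl, LinearMap.baseChange_tmul, Algebra.TensorProduct.tmul_mul_tmul,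
        LinearMap.BilinForm.baseChange_tmul]
      rw [mul_comm b a, ← TensorProduct.tmul_add, h, LinearMap.BilinMap.polar_toQuadraticMap,
        ← add_smul, Algebra.TensorProduct.algebraMap_apply, Algebra.algebraMap_eq_smul_one,
        ← TensorProduct.smul_tmul]
      rfl

theorem evenProd_self (Q : LinearMap.BilinForm ℚ V) (v : ℝ ⊗[ℚ] V) :
    evenProd Q v v = algebraMap ℝ _ (Q.baseChange ℝ v v) := by
  apply evenIncl_injective Q ℝ
  rw [evenIncl_evenProd, AlgHom.commutes]
  have h := vecIncl_mul_add_swap Q v v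
  rw [map_add, ← two_smul ℝ, ← two_smul ℝ] at h
  exact smul_right_injective _ (two_ne_zero' ℝ) h

theorem evenProd_add_swap (Q : LinearMap.BilinForm ℚ V) (v w : ℝ ⊗[ℚ] V) :
    evenProd Q v w + evenProd Q w v =
      algebraMap ℝ _ (Q.baseChange ℝ v w + Q.baseChange ℝ w v) := by
  apply evenIncl_injective Q ℝ
  rw [map_add, evenIncl_evenProd, evenIncl_evenProd, AlgHom.commutes, vecIncl_mul_add_swap]

/-- The coefficients of an element of `ℂ ⊗ M` on `1` and `i`. -/
def rePart (M : Type*) [AddCommGroup M] [Module ℝ M] : ℂ ⊗[ℝ] M →ₗ[ℝ] M :=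
  (TensorProduct.lid ℝ M).toLinearMap ∘ₗ Complex.reLm.rTensor M

/-- See `rePart`. -/
def imPart (M : Type*) [AddCommGroup M] [Module ℝ M] : ℂ ⊗[ℝ] M →ₗ[ℝ] M :=
  (TensorProduct.lid ℝ M).toLinearMap ∘ₗ Complex.imLm.rTensor M

theorem eq_re_add_im {M : Type*} [AddCommGroup M] [Module ℝ M] (x : ℂ ⊗[ℝ] M) :
    x = (1 : ℂ) ⊗ₜ[ℝ] rePart M x + Complex.I ⊗ₜ[ℝ] imPart M x := by
  induction x using TensorProduct.induction_on with
  | zero => simp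
  | add x y hx hy =>
    nth_rewrite 1 [hx, hy]
    simp only [map_add, TensorProduct.tmul_add]
    abel
  | tmul c m =>
    simp only [rePart, imPart, LinearMap.comp_apply, LinearMap.rTensor_tmul, Complex.reLm_coe,
      Complex.imLm_coe, LinearEquiv.coe_coe, TensorProduct.lid_tmul]
    rw [← TensorProduct.smul_tmul, ← TensorProduct.smul_tmul, ← TensorProduct.add_tmul]
    congr 1
    apply Complex.ext <;> simp

theorem ext_re_im {M : Type*} [AddCommGroup M] [Module ℝ M] {v w v' w' : M}
    (h : (1 : ℂ) ⊗ₜ[ℝ] v + Complex.I ⊗ₜ[ℝ] w = (1 : ℂ) ⊗ₜ[ℝ] v' + Complex.I ⊗ₜ[ℝ] w') :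
    v = v' ∧ w = w' := by
  constructor
  · simpa [rePart] using congrArg (rePart M) h
  · simpa [imPart] using congrArg (imPart M) h

theorem smul_re_im {M : Type*} [AddCommGroup M] [Module ℝ M] (c : ℂ) (v w : M) :
    c • ((1 : ℂ) ⊗ₜ[ℝ] v + Complex.I ⊗ₜ[ℝ] w) =
      (1 : ℂ) ⊗ₜ[ℝ] (c.re • v - c.im • w) + Complex.I ⊗ₜ[ℝ] (c.im • v + c.re • w) := by
  rw [smul_add, TensorProduct.smul_tmul', TensorProduct.smul_tmul', TensorProduct.tmul_sub,
    TensorProduct.tmul_add]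
  simp only [← TensorProduct.smul_tmul]
  have h1 : c • (1 : ℂ) = c.re • (1 : ℂ) + c.im • Complex.I := by
    apply Complex.ext <;> simp
  have h2 : c • Complex.I = c.re • Complex.I - c.im • (1 : ℂ) := by
    apply Complex.ext <;> simp
  rw [h1, h2, TensorProduct.add_tmul, TensorProduct.sub_tmul]
  abel

theorem h_apply_of_mem {H : HodgeStructure V 2} {v w : ℝ ⊗[ℚ] V}
    (hx : (1 : ℂ) ⊗ₜ[ℝ] v + Complex.I ⊗ₜ[ℝ] w ∈ H.piece 2 0) (z : ℂˣ) :
    (H.h z).val v = ((z : ℂ) ^ 2).re • v - ((z : ℂ) ^ 2).im • w ∧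
    (H.h z).val w = ((z : ℂ) ^ 2).im • v + ((z : ℂ) ^ 2).re • w := by
  have h := hx z
  rw [map_add, LinearMap.baseChange_tmul, LinearMap.baseChange_tmul, zpow_zero, mul_one,
    smul_re_im] at h
  exact ext_re_im h

/-- The real and imaginary part of an element of `V^{2,0}` are orthogonal, of equal length, and
`Q` is negative on them. -/
theorem form_of_mem {H : HodgeStructure V 2} {Q : LinearMap.BilinForm ℚ V}
    (hQ : H.IsPolarization Q) {v w : ℝ ⊗[ℚ] V}
    (hx : (1 : ℂ) ⊗ₜ[ℝ] v + Complex.I ⊗ₜ[ℝ] w ∈ H.piece 2 0) :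
    Q.baseChange ℝ w w = Q.baseChange ℝ v v ∧ Q.baseChange ℝ v w = 0 ∧
      Q.baseChange ℝ w v = 0 ∧ (v ≠ 0 → Q.baseChange ℝ v v < 0) ∧
      (w ≠ 0 → Q.baseChange ℝ w w < 0) := by
  have hI := h_apply_of_mem hx unitI
  have e : ((unitI : ℂˣ) : ℂ) = Complex.I := rfl
  rw [e, Complex.I_sq] at hI
  simp only [Complex.neg_re, Complex.one_re, Complex.neg_im, Complex.one_im, neg_zero, zero_smul,
    sub_zero, zero_add, neg_smul, one_smul] at hI
  have hs : Q.baseChange ℝ v w = Q.baseChange ℝ w v := by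
    have := hQ.symm v w
    rw [hI.1, hI.2, map_neg, map_neg] at this
    exact neg_injective this
  obtain ⟨ζ, hζ⟩ := IsAlgClosed.exists_pow_nat_eq Complex.I (n := 2) (by norm_num)
  have hζ0 : ζ ≠ 0 := by
    rintro rfl
    exact Complex.I_ne_zero (by rw [← hζ]; simp)
  have hn : (Complex.normSq ζ) ^ (2 : ℤ) = 1 := by
    have := congrArg Complex.normSq hζ
    rw [map_pow, Complex.normSq_I] at this
    exact_mod_cast this
  have hz := h_apply_of_mem hx (Units.mk0 ζ hζ0)
  rw [Units.val_mk0, hζ] at hz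
  simp only [Complex.I_re, Complex.I_im, zero_smul, one_smul, zero_sub, add_zero] at hz
  have h1 := hQ.equivariant (Units.mk0 ζ hζ0) v v
  have h2 := hQ.equivariant (Units.mk0 ζ hζ0) v w
  rw [Units.val_mk0, hn, hz.1] at h1
  rw [Units.val_mk0, hn, hz.1, hz.2] at h2
  simp only [map_neg, LinearMap.neg_apply, neg_neg, one_mul] at h1 h2
  have hvw : Q.baseChange ℝ v w = 0 := by linarith
  refine ⟨h1, hvw, hs ▸ hvw, fun hv => ?_, fun hw => ?_⟩
  · have := hQ.pos v hv
    rw [hI.1, map_neg] at this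
    linarith
  · have := hQ.pos w hw
    rw [hI.2, map_neg] at this
    linarith

theorem exists_frame {H : HodgeStructure V 2} {Q : LinearMap.BilinForm ℚ V}
    (hQ : IsK3Type H Q) : ∃ f₁ f₂, IsFrame H Q f₁ f₂ := by
  obtain ⟨⟨x, hx⟩, hx0, hspan⟩ := finrank_eq_one_iff'.1 hQ.finrank_piece
  have hx0' : x ≠ 0 := fun h => hx0 (Subtype.ext h)
  have hsp : H.piece 2 0 = Submodule.span ℂ {x} := by
    apply le_antisymm
    · intro y hy
      obtain ⟨c, hc⟩ := hspan ⟨y, hy⟩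
      exact Submodule.mem_span_singleton.2 ⟨c, congrArg Subtype.val hc⟩
    · rw [Submodule.span_le, Set.singleton_subset_iff]
      exact hx
  set v := rePart _ x with hv
  set w := imPart _ x with hw
  have hxe : x = (1 : ℂ) ⊗ₜ[ℝ] v + Complex.I ⊗ₜ[ℝ] w := eq_re_add_im x
  obtain ⟨h1, -, -, h4, h5⟩ := form_of_mem hQ.polarization (hxe ▸ hx)
  have hneg : Q.baseChange ℝ v v < 0 := by
    by_cases h : v = 0
    · by_cases h' : w = 0
      · exact absurd (by rw [hxe, h, h']; simp) hx0'
      · rw [← h1]; exact h5 h'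
    · exact h4 h
  set r : ℝ := (Real.sqrt (-(Q.baseChange ℝ v v)))⁻¹ with hr
  have hspos : 0 < Real.sqrt (-(Q.baseChange ℝ v v)) := Real.sqrt_pos.2 (by linarith)
  have hr0 : r ≠ 0 := (inv_pos.2 hspos).ne'
  refine ⟨r • v, r • w, ?_, ?_⟩
  · have : (1 : ℂ) ⊗ₜ[ℝ] (r • v) + Complex.I ⊗ₜ[ℝ] (r • w) = (r : ℂ) • x := by
      rw [hxe, smul_re_im]; simp
    rw [this, hsp]
    refine (Submodule.span_singleton_smul_eq (IsUnit.mk0 _ ?_) x).symm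
    exact_mod_cast hr0
  · simp only [map_smul, LinearMap.smul_apply, smul_eq_mul]
    have := Real.mul_self_sqrt (show 0 ≤ -(Q.baseChange ℝ v v) by linarith)
    rw [hr]
    field_simp
    nlinarith

theorem IsFrame.form {H : HodgeStructure V 2} {Q : LinearMap.BilinForm ℚ V}
    (hQ : H.IsPolarization Q) {f₁ f₂ : ℝ ⊗[ℚ] V} (hf : IsFrame H Q f₁ f₂) :
    Q.baseChange ℝ f₂ f₂ = -1 ∧ Q.baseChange ℝ f₁ f₂ = 0 ∧ Q.baseChange ℝ f₂ f₁ = 0 := by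
  have h := form_of_mem hQ (v := f₁) (w := f₂)
    (by rw [hf.span]; exact Submodule.mem_span_singleton_self _)
  exact ⟨h.1.trans hf.norm, h.2.1, h.2.2.1⟩

/-- The element `J = f₁ f₂` of `C⁺(Q)_ℝ`. -/
def ksJ {H : HodgeStructure V 2} {Q : LinearMap.BilinForm ℚ V} (hQ : IsK3Type H Q) :
    ℝ ⊗[ℚ] EvenCliff Q :=
  evenProd Q (exists_frame hQ).choose (exists_frame hQ).choose_spec.choose

/-- `J` does not depend on the choice of `f₁, f₂`. -/
theorem ksJ_eq {H : HodgeStructure V 2} {Q : LinearMap.BilinForm ℚ V} (hQ : IsK3Type H Q)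
    {f₁ f₂ : ℝ ⊗[ℚ] V} (hf : IsFrame H Q f₁ f₂) : ksJ hQ = evenProd Q f₁ f₂ := by
  have hg : IsFrame H Q (exists_frame hQ).choose (exists_frame hQ).choose_spec.choose :=
    (exists_frame hQ).choose_spec.choose_spec
  unfold ksJ
  generalize (exists_frame hQ).choose_spec.choose = g₂ at hg ⊢
  generalize (exists_frame hQ).choose = g₁ at hg ⊢
  have hmem : (1 : ℂ) ⊗ₜ[ℝ] g₁ + Complex.I ⊗ₜ[ℝ] g₂ ∈ H.piece 2 0 := by
    rw [hg.span]; exact Submodule.mem_span_singleton_self _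
  rw [hf.span, Submodule.mem_span_singleton] at hmem
  obtain ⟨c, hc⟩ := hmem
  rw [smul_re_im] at hc
  obtain ⟨h1, h2⟩ := ext_re_im hc
  obtain ⟨q22, q12, q21⟩ := hf.form hQ.polarization
  have hn := hg.norm
  rw [← h1] at hn
  simp only [map_sub, map_smul, LinearMap.sub_apply, LinearMap.smul_apply, smul_eq_mul, q22, q12,
    q21, hf.norm] at hn
  have hsw := evenProd_add_swap Q f₁ f₂
  rw [q12, q21, add_zero, map_zero] at hsw
  have hsw' : evenProd Q f₂ f₁ = -evenProd Q f₁ f₂ := by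
    rw [eq_neg_iff_add_eq_zero, add_comm, hsw]
  rw [← h1, ← h2]
  simp only [map_sub, map_add, map_smul, LinearMap.sub_apply, LinearMap.smul_apply,
    evenProd_self, hsw', hf.norm, q22]
  have hc1 : c.re * c.re + c.im * c.im = 1 := by linarith
  calc _ = (c.re * c.re + c.im * c.im) • evenProd Q f₁ f₂ := by module
    _ = _ := by rw [hc1, one_smul]

theorem ksJ_mul_self {H : HodgeStructure V 2} {Q : LinearMap.BilinForm ℚ V} (hQ : IsK3Type H Q) :
    ksJ hQ * ksJ hQ = -1 := by
  obtain ⟨f₁, f₂, hf⟩ := exists_frame hQ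
  rw [ksJ_eq hQ hf]
  obtain ⟨q22, q12, q21⟩ := hf.form hQ.polarization
  apply evenIncl_injective Q ℝ
  have s1 := congrArg (evenIncl Q ℝ) (evenProd_self Q f₁)
  have s2 := congrArg (evenIncl Q ℝ) (evenProd_self Q f₂)
  have s12 := vecIncl_mul_add_swap Q f₁ f₂
  rw [evenIncl_evenProd, hf.norm, map_neg, map_neg, map_one, map_one] at s1
  rw [evenIncl_evenProd, q22, map_neg, map_neg, map_one, map_one] at s2
  rw [q12, q21, add_zero, map_zero] at s12
  have s21 : vecIncl Q ℝ f₂ * vecIncl Q ℝ f₁ = -(vecIncl Q ℝ f₁ * vecIncl Q ℝ f₂) := by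
    rw [eq_neg_iff_add_eq_zero, add_comm, s12]
  rw [map_mul, map_neg, map_one, evenIncl_evenProd]
  calc _ = vecIncl Q ℝ f₁ * (vecIncl Q ℝ f₂ * vecIncl Q ℝ f₁) * vecIncl Q ℝ f₂ := by
        simp only [mul_assoc]
    _ = -((vecIncl Q ℝ f₁ * vecIncl Q ℝ f₁) * (vecIncl Q ℝ f₂ * vecIncl Q ℝ f₂)) := by
        rw [s21]; simp only [mul_neg, neg_mul, mul_assoc]
    _ = _ := by rw [s1, s2]; simp

/-- The homomorphism `ℂˣ → (C⁺(Q)_ℝ)ˣ`, `a + b i ↦ a - b J`. -/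
def ksUnit {H : HodgeStructure V 2} {Q : LinearMap.BilinForm ℚ V} (hQ : IsK3Type H Q) :
    ℂˣ →* (ℝ ⊗[ℚ] EvenCliff Q)ˣ :=
  Units.map (Complex.lift ⟨-ksJ hQ, by rw [neg_mul_neg, ksJ_mul_self]⟩ : ℂ →ₐ[ℝ] _)

theorem ksUnit_apply {H : HodgeStructure V 2} {Q : LinearMap.BilinForm ℚ V} (hQ : IsK3Type H Q)
    (z : ℂˣ) : (ksUnit hQ z).val =
      algebraMap ℝ _ (z : ℂ).re - (z : ℂ).im • ksJ hQ := by
  change Complex.lift _ (z : ℂ) = _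
  rw [Complex.lift_apply, Complex.liftAux_apply, smul_neg, sub_eq_add_neg]

theorem iSup_piece_ks {H : HodgeStructure V 2} {Q : LinearMap.BilinForm ℚ V}
    (hQ : IsK3Type H Q) :
    ⨆ p : ℤ, hodgePiece ((sigma Q ℝ).comp (ksUnit hQ)) p (1 - p) = ⊤ := by
  refine Submodule.eq_top_iff'.2 fun x => ?_
  set L : Module.End ℂ (ℂ ⊗[ℝ] (ℝ ⊗[ℚ] EvenCliff Q)) :=
    (Algebra.lmul ℝ (ℝ ⊗[ℚ] EvenCliff Q) (ksJ hQ)).baseChange ℂ with hL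
  have hLL : ∀ y, L (L y) = -y := by
    intro y
    rw [hL, ← LinearMap.comp_apply, ← LinearMap.baseChange_comp, ← Module.End.mul_eq_comp,
      ← map_mul, ksJ_mul_self, map_neg, map_one, LinearMap.baseChange_neg]
    simp
  have hz : ∀ (z : ℂˣ) y, (((sigma Q ℝ).comp (ksUnit hQ)) z).val.baseChange ℂ y =
      ((z : ℂ).re : ℂ) • y - ((z : ℂ).im : ℂ) • L y := by
    intro z y
    have : (((sigma Q ℝ).comp (ksUnit hQ)) z).val =
        (z : ℂ).re • LinearMap.id - (z : ℂ).im • Algebra.lmul ℝ (ℝ ⊗[ℚ] EvenCliff Q) (ksJ hQ) := by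
      change Algebra.lmul ℝ (ℝ ⊗[ℚ] EvenCliff Q) (ksUnit hQ z).val = _
      rw [ksUnit_apply, map_sub, map_smul, Algebra.algebraMap_eq_smul_one, map_smul, map_one]
      rfl
    rw [this, LinearMap.baseChange_sub, LinearMap.baseChange_smul, LinearMap.baseChange_smul,
      LinearMap.baseChange_id]
    simp only [LinearMap.sub_apply, LinearMap.smul_apply, LinearMap.id_apply, Complex.coe_smul]
    rfl
  have hx : x = (2⁻¹ : ℂ) • (x + Complex.I • L x) + (2⁻¹ : ℂ) • (x - Complex.I • L x) := by
    module
  rw [hx]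
  refine Submodule.add_mem _ (Submodule.smul_mem _ _ (Submodule.mem_iSup_of_mem 1 ?_))
    (Submodule.smul_mem _ _ (Submodule.mem_iSup_of_mem 0 ?_))
  · intro z
    have e : (z : ℂ) ^ (1 : ℤ) * conj (z : ℂ) ^ (1 - 1 : ℤ) =
        (z : ℂ).re + (z : ℂ).im * Complex.I := by simp
    rw [hz, e, map_add, map_smul, hLL]
    match_scalars
    · ring
    · linear_combination (-(z : ℂ).im) * Complex.I_sq
  · intro z
    have e : (z : ℂ) ^ (0 : ℤ) * conj (z : ℂ) ^ (1 - 0 : ℤ) =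
        (z : ℂ).re - (z : ℂ).im * Complex.I := by
      simp; apply Complex.ext <;> simp
    rw [hz, e, map_sub, map_smul, hLL]
    match_scalars
    · ring
    · linear_combination (-(z : ℂ).im) * Complex.I_sq

/-- The Hodge structure of weight one on `C⁺(Q)`, given by the representation
`h_s : a + b i ↦ [x ↦ (a - b J) x]`. -/
def kugaSatake {H : HodgeStructure V 2} {Q : LinearMap.BilinForm ℚ V} (hQ : IsK3Type H Q) :
    HodgeStructure (EvenCliff Q) 1 where
  h := (sigma Q ℝ).comp (ksUnit hQ)
  iSup_piece := iSup_piece_ks hQ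

end KS

end

end KugaSatake

/-! Everything about `h_s` follows from one identity. If x = a - bJ and x' = a + bJ is its reversal,
then x x' = a² + b² and x v x' = h(a + bi) v for all v in V_ℝ (`ksUnit_mul_reverse`, `ksUnit_conj`).
Indeed J anticommutes with f₁ and f₂ and commutes with their complement, on which h(z) is
multiplication by |z|² (`IsFrame.exists_decomp`). Hence h(z) = |z|² ρ(h_s(z)), which puts h_s(ℂ*)
into CSpin(Q)(ℝ) and gives the formula for h(te^{iφ}). The group CSpin(Q) is cut out by polynomial
equations (`groupCSpin_isAlgebraic`), so it contains the Mumford-Tate group.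

For the embedding, take an orthogonal basis and Ω = ∏(1 + eᵢ ⊗ eᵢ⁻¹). Then (c ⊗ 1)Ω = (1 ⊗ reverse
c)Ω (`IsOrthBasis.mul_casimir`). So the map x ↦ (x ⊗ 1)Ω(w ⊗ 1), projected to the even parts,
carries c x reverse(d), for even c and d, to c ⊗ d times the image of x. With c = d = h_s(z) the
identity above makes it a morphism of Hodge structures on V.

For the lower bound, let SO(Q) ⊆ MT(V) and let G be any algebraic group containing h_s(ℂ*); the
claim is CSpin(Q) ⊆ G. The similitudes λρ(g) with g in G and CSpin(Q) form a functorial family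
`simGroup G` containing h(ℂ*). Its Zariski closure is an algebraic group, so it contains MT(V) and
with it SO(Q). To return from V to the Clifford algebra, g² is recovered up to a scalar from n =
λρ(g) by a polynomial formula in n. This formula is an average over the basis, twisted by n, and it
works because the average of an even element is a scalar (`twistedAverage_of_sim`,
`AnticommGen.average_mem_bot`). Scalars lie in G (`scalarUnit_mem`), so the equations of G,
evaluated at this formula, vanish on `simGroup G` and therefore on SO(Q). Over a local ring this
yields g² ∈ G whenever ρ(g) ∈ SO(Q) (`sq_mem_of_local`).

Squares are enough. If v₁ and v₂ have the same length, the square of v₁(v₁ ± v₂) is a multiple of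
v₁v₂, and lengths are made equal by adjoining a square root (`pair_mem`). Over a local ring scalars
and products of two anisotropic vectors generate CSpin(Q), by the argument of Cartan and Dieudonné
(`cspinUnits_le_of_local`). Membership in an algebraic group can be tested at the localizations at
all maximal ideals (`mem_of_extensions`), which settles arbitrary coefficient rings. -/

namespace KugaSatake

noncomputable section

/-! ### Algebras generated by anticommuting elements -/

section Anticommuting

/-- Anticommuting elements `e i` with invertible scalar squares which generate the algebra `B`,
together with the endomorphism `α` of `B` that changes their signs. -/
structure AnticommGen {A B : Type*} [CommRing A] [Ring B] [Algebra A B] {r : ℕ} (e : Fin r → B)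
    (q : Fin r → A) (α : B →ₐ[A] B) : Prop where
  two : IsUnit (2 : A)
  unit : ∀ i, IsUnit (q i)
  sq : ∀ i, e i * e i = algebraMap A B (q i)
  anti : ∀ i j, i ≠ j → e i * e j = -(e j * e i)
  map : ∀ i, α (e i) = -e i
  gen : Algebra.adjoin A (Set.range e) = ⊤

variable {A B : Type*} [CommRing A] [Ring B] [Algebra A B] {r : ℕ} {e : Fin r → B}
  {q : Fin r → A} {α : B →ₐ[A] B}

/-- The subalgebra generated by the first `k` elements. -/
def initialSubalgebra (A : Type*) {B : Type*} [CommRing A] [Ring B] [Algebra A B] {r : ℕ}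
    (e : Fin r → B) (k : ℕ) : Subalgebra A B :=
  Algebra.adjoin A {b | ∃ i : Fin r, i.val < k ∧ e i = b}

theorem initialSubalgebra_mono {k l : ℕ} (h : k ≤ l) :
    initialSubalgebra A e k ≤ initialSubalgebra A e l :=
  Algebra.adjoin_mono fun _ ⟨i, hi, hb⟩ => ⟨i, hi.trans_le h, hb⟩

theorem initialSubalgebra_zero : initialSubalgebra A e 0 = ⊥ := by
  simp [initialSubalgebra]

namespace AnticommGen

/-- Moving `e i` across a word in earlier generators produces one sign per letter, and `α` records
exactly this sign. -/
theorem mul_of_mem_initial (h : AnticommGen e q α) {k : ℕ} {i : Fin r} (hi : k ≤ i.val) {a : B}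
    (ha : a ∈ initialSubalgebra A e k) : e i * a = α a * e i := by
  induction ha using Algebra.adjoin_induction with
  | mem x hx =>
    obtain ⟨j, hj, rfl⟩ := hx
    rw [h.map, h.anti i j (fun hij => by subst hij; omega), neg_mul]
  | algebraMap c => rw [AlgHom.commutes, Algebra.commutes]
  | add x y _ _ hx hy => rw [mul_add, hx, hy, map_add, add_mul]
  | mul x y _ _ hx hy => rw [← mul_assoc, hx, mul_assoc, hy, map_mul, mul_assoc]

theorem map_mem_initial (h : AnticommGen e q α) {k : ℕ} {a : B}
    (ha : a ∈ initialSubalgebra A e k) : α a ∈ initialSubalgebra A e k := by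
  induction ha using Algebra.adjoin_induction with
  | mem x hx =>
    obtain ⟨j, hj, rfl⟩ := hx
    rw [h.map]
    exact neg_mem (Algebra.subset_adjoin ⟨j, hj, rfl⟩)
  | algebraMap c => rw [AlgHom.commutes]; exact Subalgebra.algebraMap_mem _ c
  | add x y _ _ hx hy => rw [map_add]; exact add_mem hx hy
  | mul x y _ _ hx hy => rw [map_mul]; exact mul_mem hx hy

theorem map_map (h : AnticommGen e q α) (a : B) : α (α a) = a := by
  have ha : a ∈ Algebra.adjoin A (Set.range e) := by rw [h.gen]; trivial
  induction ha using Algebra.adjoin_induction with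
  | mem x hx => obtain ⟨j, rfl⟩ := hx; rw [h.map, map_neg, h.map, neg_neg]
  | algebraMap c => rw [AlgHom.commutes, AlgHom.commutes]
  | add x y _ _ hx hy => rw [map_add, map_add, hx, hy]
  | mul x y _ _ hx hy => rw [map_mul, map_mul, hx, hy]

/-- The new generator passes the old subalgebra up to `α` and has scalar square, so the sums `a + e
k * b` are already closed under multiplication. The sum is not claimed to be direct. -/
theorem exists_of_mem_initial_succ (h : AnticommGen e q α) {k : ℕ} (hk : k < r) {y : B}
    (hy : y ∈ initialSubalgebra A e (k + 1)) :
    ∃ a ∈ initialSubalgebra A e k, ∃ b ∈ initialSubalgebra A e k, y = a + e ⟨k, hk⟩ * b := by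
  have hc : ∀ a ∈ initialSubalgebra A e k, a * e ⟨k, hk⟩ = e ⟨k, hk⟩ * α a := fun a ha => by
    rw [h.mul_of_mem_initial (i := ⟨k, hk⟩) le_rfl (h.map_mem_initial ha), h.map_map]
  induction hy using Algebra.adjoin_induction with
  | mem x hx =>
    obtain ⟨j, hj, rfl⟩ := hx
    by_cases hjk : j.val < k
    · exact ⟨e j, Algebra.subset_adjoin ⟨j, hjk, rfl⟩, 0, zero_mem _, by simp⟩
    · have : j = ⟨k, hk⟩ := Fin.ext (by simp; omega)
      exact ⟨0, zero_mem _, 1, one_mem _, by simp [this]⟩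
  | algebraMap c => exact ⟨_, Subalgebra.algebraMap_mem _ c, 0, zero_mem _, by simp⟩
  | add x y _ _ hx hy =>
    obtain ⟨a, ha, b, hb, rfl⟩ := hx
    obtain ⟨a', ha', b', hb', rfl⟩ := hy
    exact ⟨a + a', add_mem ha ha', b + b', add_mem hb hb', by rw [mul_add]; abel⟩
  | mul x y _ _ hx hy =>
    obtain ⟨a, ha, b, hb, rfl⟩ := hx
    obtain ⟨a', ha', b', hb', rfl⟩ := hy
    refine ⟨a * a' + q ⟨k, hk⟩ • (α b * b'), add_mem (mul_mem ha ha')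
      (Subalgebra.smul_mem _ (mul_mem (h.map_mem_initial hb) hb') _), α a * b' + b * a',
      add_mem (mul_mem (h.map_mem_initial ha) hb') (mul_mem hb ha'), ?_⟩
    have e1 : a * (e ⟨k, hk⟩ * b') = e ⟨k, hk⟩ * (α a * b') := by
      rw [← mul_assoc, hc a ha, mul_assoc]
    have e2 : e ⟨k, hk⟩ * b * (e ⟨k, hk⟩ * b') = q ⟨k, hk⟩ • (α b * b') := by
      rw [mul_assoc, ← mul_assoc b, hc b hb, mul_assoc, ← mul_assoc, h.sq, Algebra.smul_def]
    rw [add_mul, mul_add, mul_add, e1, e2, mul_add, mul_assoc]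
    abel

theorem initial_top (h : AnticommGen e q α) : initialSubalgebra A e r = ⊤ := by
  rw [eq_top_iff, ← h.gen]
  apply Algebra.adjoin_mono
  rintro _ ⟨i, rfl⟩
  exact ⟨i, i.2, rfl⟩

/-- The graded centre consists of the scalars. -/
theorem mem_bot_of_comm (h : AnticommGen e q α) {y : B} (hy : ∀ i, e i * y = α y * e i) :
    y ∈ (⊥ : Subalgebra A B) := by
  have key : ∀ k ≤ r, y ∈ initialSubalgebra A e (r - k) := by
    intro k
    induction k with
    | zero => intro _; rw [Nat.sub_zero, h.initial_top]; trivial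
    | succ k ih =>
      intro hk
      have h1 := ih (by omega)
      obtain ⟨m, hm⟩ : ∃ m, m = r - (k + 1) := ⟨_, rfl⟩
      have hm' : r - k = m + 1 := by omega
      have hmr : m < r := by omega
      rw [← hm]
      rw [hm'] at h1
      obtain ⟨a, ha, b, hb, rfl⟩ := h.exists_of_mem_initial_succ hmr h1
      have h2 := hy ⟨m, hmr⟩
      set ε := e ⟨m, hmr⟩ with hε
      have ea : ε * a = α a * ε := h.mul_of_mem_initial (i := ⟨m, hmr⟩) le_rfl ha
      have eb : ε * b = α b * ε := h.mul_of_mem_initial (i := ⟨m, hmr⟩) le_rfl hb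
      -- The term `a` satisfies the graded commutation with `ε` by itself. On `ε * b` the involution
      -- adds a sign from `ε`, so the condition there makes `ε * (ε * b)` its own negative, and `2 *
      -- q * b` vanishes.
      have h3 : ε * (ε * b) = -(ε * (ε * b)) := by
        rw [mul_add, map_add, add_mul, ea, map_mul, h.map, ← hε] at h2
        have h2' := add_left_cancel h2
        rw [neg_mul, neg_mul, mul_assoc, ← eb] at h2'
        exact h2'
      have h4 : (2 : A) • (q ⟨m, hmr⟩ • b) = 0 := by
        rw [← mul_assoc, h.sq, ← Algebra.smul_def] at h3
        rw [two_smul]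
        nth_rewrite 1 [h3]
        simp
      rw [h.two.smul_eq_zero, (h.unit _).smul_eq_zero] at h4
      rw [h4, mul_zero, add_zero]
      exact ha
  have := key r le_rfl
  rwa [Nat.sub_self, initialSubalgebra_zero] at this

theorem fg (h : AnticommGen e q α) : Module.Finite A B := by
  have key : ∀ k ≤ r, (Subalgebra.toSubmodule (initialSubalgebra A e k)).FG := by
    intro k
    induction k with
    | zero =>
      intro _
      rw [initialSubalgebra_zero, Algebra.toSubmodule_bot]
      exact ⟨{1}, by simp [Submodule.one_eq_span]⟩
    | succ k ih =>
      intro hk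
      have hle : Subalgebra.toSubmodule (initialSubalgebra A e (k + 1)) =
          Subalgebra.toSubmodule (initialSubalgebra A e k) ⊔
          (Subalgebra.toSubmodule (initialSubalgebra A e k)).map
            (LinearMap.mulLeft A (e ⟨k, hk⟩)) := by
        apply le_antisymm
        · intro y hy
          obtain ⟨a, ha, b, hb, rfl⟩ := h.exists_of_mem_initial_succ hk hy
          exact Submodule.add_mem_sup ha ⟨b, hb, rfl⟩
        · rw [sup_le_iff]
          refine ⟨fun x hx => initialSubalgebra_mono (Nat.le_succ k) hx, ?_⟩
          rintro _ ⟨b, hb, rfl⟩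
          exact mul_mem (S := Subalgebra A B)
            (Algebra.subset_adjoin ⟨⟨k, hk⟩, Nat.lt_succ_self k, rfl⟩)
            (initialSubalgebra_mono (Nat.le_succ k) hb)
      rw [hle]
      exact (ih (by omega)).sup ((ih (by omega)).map _)
  have := key r le_rfl
  rw [h.initial_top, Algebra.top_toSubmodule] at this
  exact ⟨this⟩

/-- The operator `y ↦ y + e i * y * (e i)⁻¹`. -/
def averageStep (e : Fin r → B) (q : Fin r → A) (i : Fin r) : B →ₗ[A] B :=
  LinearMap.id + Ring.inverse (q i) • (LinearMap.mulLeft A (e i) ∘ₗ LinearMap.mulRight A (e i))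

theorem averageStep_apply (i : Fin r) (y : B) :
    averageStep e q i y = y + Ring.inverse (q i) • (e i * (y * e i)) := rfl

/-- The composition of the operators `y ↦ y + e i * y * (e i)⁻¹`. -/
def average (e : Fin r → B) (q : Fin r → A) (l : List (Fin r)) : B →ₗ[A] B :=
  l.foldr (fun i f => averageStep e q i ∘ₗ f) LinearMap.id

theorem average_cons (i : Fin r) (l : List (Fin r)) (y : B) :
    average e q (i :: l) y = averageStep e q i (average e q l y) := rfl

theorem inv_smul_sq (h : AnticommGen e q α) (i : Fin r) (x : B) :
    Ring.inverse (q i) • (e i * (e i * x)) = x := by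
  rw [← mul_assoc, h.sq, ← Algebra.smul_def, smul_smul, Ring.inverse_mul_cancel _ (h.unit i),
    one_smul]

/-- Averaging over `e j` makes an element commute with `e j`. A later average over another `e i`
preserves this, because the signs from the two copies of `e i` cancel. -/
theorem average_comm (h : AnticommGen e q α) (l : List (Fin r)) (y : B) :
    ∀ j ∈ l, e j * average e q l y = average e q l y * e j := by
  induction l with
  | nil => simp
  | cons i l ih =>
    intro j hj
    rw [average_cons, averageStep_apply]
    generalize average e q l y = z at ih
    by_cases hji : j = i
    · subst hji
      have h1 : Ring.inverse (q j) • (e j * (e j * (z * e j))) = z * e j := h.inv_smul_sq _ _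
      have h2 : Ring.inverse (q j) • (e j * (z * (e j * e j))) = e j * z := by
        rw [h.sq, ← Algebra.commutes, ← Algebra.smul_def, mul_smul_comm, smul_smul,
          Ring.inverse_mul_cancel _ (h.unit j), one_smul]
      rw [mul_add, add_mul, mul_smul_comm, smul_mul_assoc, h1, mul_assoc, mul_assoc, h2]
      abel
    · have hjl : j ∈ l := by simpa [hji] using hj
      have hz := ih j hjl
      have h1 : e j * (e i * (z * e i)) = e i * (z * e i) * e j := by
        rw [← mul_assoc, h.anti j i hji, neg_mul, mul_assoc, ← mul_assoc (e j) z, hz,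
          mul_assoc z, h.anti j i hji]
        simp only [mul_neg, neg_neg, mul_assoc]
      rw [mul_add, add_mul, mul_smul_comm, smul_mul_assoc, h1, hz]

theorem map_average (h : AnticommGen e q α) (l : List (Fin r)) {y : B} (hy : α y = y) :
    α (average e q l y) = average e q l y := by
  induction l with
  | nil => exact hy
  | cons i l ih =>
    rw [average_cons, averageStep_apply, map_add, map_smul, map_mul, map_mul, ih, h.map]
    simp

/-- Since 2 is invertible, this provides an element whose average is a unit; see
`IsOrthBasis.exists_isUnit_average`. -/
theorem average_one (h : AnticommGen e q α) (l : List (Fin r)) :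
    average e q l 1 = algebraMap A B (2 ^ l.length) := by
  induction l with
  | nil => simp [average]
  | cons i l ih =>
    have h1 := h.inv_smul_sq i (algebraMap A B (2 ^ l.length))
    rw [average_cons, averageStep_apply, ih, Algebra.commutes, h1, ← map_add, List.length_cons,
      pow_succ, mul_two]

/-- For an `α`-invariant element, commuting with the generators is the same as graded commuting, and
the graded centre is scalar. The invariance matters: in odd rank the product of all generators is
also central. -/
theorem average_mem_bot (h : AnticommGen e q α) {y : B} (hy : α y = y) :
    average e q (List.finRange r) y ∈ (⊥ : Subalgebra A B) := by
  apply h.mem_bot_of_comm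
  intro i
  rw [h.map_average _ hy]
  exact h.average_comm _ _ i (List.mem_finRange i)

end AnticommGen

end Anticommuting

end

end KugaSatake


namespace KugaSatake

noncomputable section

/-! ### The Clifford algebra over an arbitrary base -/

section BaseRing

variable {V : Type*} [AddCommGroup V] [Module ℚ V] (Q : LinearMap.BilinForm ℚ V)
  (A : Type) [CommRing A] [Algebra ℚ A]

theorem vecIncl_tmul (a : A) (v : V) :
    vecIncl Q A (a ⊗ₜ v) = a ⊗ₜ CliffordAlgebra.ι (LinearMap.BilinMap.toQuadraticMap Q) v := rfl

theorem evenIncl_tmul (a : A) (x : EvenCliff Q) : evenIncl Q A (a ⊗ₜ x) = a ⊗ₜ x.val := rfl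

/-- The extension of scalars of the grade involution. -/
def involuteA : A ⊗[ℚ] Cliff Q →ₐ[A] A ⊗[ℚ] Cliff Q :=
  Algebra.TensorProduct.map (AlgHom.id A A) CliffordAlgebra.involute

/-- The extension of scalars of the reversal of products. -/
def reverseA : A ⊗[ℚ] Cliff Q →ₗ[A] A ⊗[ℚ] Cliff Q :=
  (CliffordAlgebra.reverse (Q := LinearMap.BilinMap.toQuadraticMap Q)).baseChange A

/-- The product `V_A × V_A → C⁺(Q)_A` of the Clifford algebra. -/
def vecMul : (A ⊗[ℚ] V) →ₗ[A] (A ⊗[ℚ] V) →ₗ[A] A ⊗[ℚ] EvenCliff Q :=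
  LinearMap.BilinMap.baseChange A
    (CliffordAlgebra.even.ι (LinearMap.BilinMap.toQuadraticMap Q)).bilin

variable {A}

theorem involuteA_vecIncl (v : A ⊗[ℚ] V) : involuteA Q A (vecIncl Q A v) = -vecIncl Q A v := by
  induction v using TensorProduct.induction_on with
  | zero => simp
  | add v₁ v₂ h₁ h₂ => simp only [map_add, h₁, h₂, neg_add]
  | tmul a v =>
    rw [vecIncl_tmul, involuteA, Algebra.TensorProduct.map_tmul, CliffordAlgebra.involute_ι,
      TensorProduct.tmul_neg]
    rfl

theorem involuteA_evenIncl (x : A ⊗[ℚ] EvenCliff Q) :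
    involuteA Q A (evenIncl Q A x) = evenIncl Q A x := by
  induction x using TensorProduct.induction_on with
  | zero => simp
  | add v₁ v₂ h₁ h₂ => simp only [map_add, h₁, h₂]
  | tmul a v =>
    rw [evenIncl_tmul, involuteA, Algebra.TensorProduct.map_tmul]
    congr 1
    exact CliffordAlgebra.involute_eq_of_mem_even v.2

theorem reverseA_vecIncl (v : A ⊗[ℚ] V) : reverseA Q A (vecIncl Q A v) = vecIncl Q A v := by
  induction v using TensorProduct.induction_on with
  | zero => simp
  | add v₁ v₂ h₁ h₂ => simp only [map_add, h₁, h₂]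
  | tmul a v =>
    rw [vecIncl_tmul, reverseA, LinearMap.baseChange_tmul, CliffordAlgebra.reverse_ι]

theorem reverseA_mul (x y : A ⊗[ℚ] Cliff Q) :
    reverseA Q A (x * y) = reverseA Q A y * reverseA Q A x := by
  induction x using TensorProduct.induction_on with
  | zero => simp
  | add v₁ v₂ h₁ h₂ => simp only [map_add, h₁, h₂, add_mul, mul_add]
  | tmul a x =>
    induction y using TensorProduct.induction_on with
    | zero => simp
    | add v₁ v₂ h₁ h₂ => simp only [map_add, h₁, h₂, add_mul, mul_add]
    | tmul b y =>
      simp only [reverseA, LinearMap.baseChange_tmul, Algebra.TensorProduct.tmul_mul_tmul,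
        CliffordAlgebra.reverse.map_mul, mul_comm]

theorem reverseA_algebraMap (a : A) :
    reverseA Q A (algebraMap A _ a) = algebraMap A _ a := by
  rw [Algebra.TensorProduct.algebraMap_apply, reverseA, LinearMap.baseChange_tmul,
    CliffordAlgebra.reverse.map_one]

theorem evenIncl_vecMul (v w : A ⊗[ℚ] V) :
    evenIncl Q A (vecMul Q A v w) = vecIncl Q A v * vecIncl Q A w := by
  induction v using TensorProduct.induction_on with
  | zero => simp
  | add v₁ v₂ h₁ h₂ => simp only [map_add, LinearMap.add_apply, add_mul, h₁, h₂]
  | tmul a v =>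
    induction w using TensorProduct.induction_on with
    | zero => simp
    | add v₁ v₂ h₁ h₂ => simp only [map_add, mul_add, h₁, h₂]
    | tmul b w =>
      simp only [vecMul, LinearMap.BilinMap.baseChange_tmul, evenIncl_tmul, vecIncl_tmul,
        Algebra.TensorProduct.tmul_mul_tmul, mul_comm a b]
      rfl

theorem vecIncl_mul_add_swapA (v w : A ⊗[ℚ] V) :
    vecIncl Q A v * vecIncl Q A w + vecIncl Q A w * vecIncl Q A v =
      algebraMap A _ (Q.baseChange A v w + Q.baseChange A w v) := by
  induction v using TensorProduct.induction_on with
  | zero => simp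
  | add v₁ v₂ h₁ h₂ =>
    simp only [map_add, LinearMap.add_apply, add_mul, mul_add] at h₁ h₂ ⊢
    linear_combination (norm := module) h₁ + h₂
  | tmul a v =>
    induction w using TensorProduct.induction_on with
    | zero => simp
    | add v₁ v₂ h₁ h₂ =>
      simp only [map_add, LinearMap.add_apply, add_mul, mul_add] at h₁ h₂ ⊢
      linear_combination (norm := module) h₁ + h₂
    | tmul b w =>
      have h := CliffordAlgebra.ι_mul_ι_add_swap (Q := LinearMap.BilinMap.toQuadraticMap Q) v w
      simp only [vecIncl, LinearMap.baseChange_tmul, Algebra.TensorProduct.tmul_mul_tmul,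
        LinearMap.BilinForm.baseChange_tmul]
      rw [mul_comm b a, ← TensorProduct.tmul_add, h, LinearMap.BilinMap.polar_toQuadraticMap,
        ← add_smul, Algebra.TensorProduct.algebraMap_apply, Algebra.algebraMap_eq_smul_one,
        ← TensorProduct.smul_tmul]
      rfl

theorem algebraMap_cliff_injective :
    Function.Injective (algebraMap A (A ⊗[ℚ] Cliff Q)) := by
  have : Function.Injective (algebraMap ℚ (Cliff Q)) :=
    FaithfulSMul.algebraMap_injective ℚ (Cliff Q)
  exact Algebra.TensorProduct.includeLeft_injective (S := A) this

theorem isUnit_two : IsUnit (2 : A) := by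
  have : IsUnit (algebraMap ℚ A 2) := (IsUnit.mk0 (2 : ℚ) two_ne_zero).map _
  rwa [map_ofNat] at this

theorem baseChange_symm (hs : ∀ v w, Q v w = Q w v) (v w : A ⊗[ℚ] V) :
    Q.baseChange A v w = Q.baseChange A w v := by
  induction v using TensorProduct.induction_on with
  | zero => simp
  | add v₁ v₂ h₁ h₂ => simp only [map_add, LinearMap.add_apply, h₁, h₂]
  | tmul a v =>
    induction w using TensorProduct.induction_on with
    | zero => simp
    | add v₁ v₂ h₁ h₂ => simp only [map_add, LinearMap.add_apply, h₁, h₂]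
    | tmul b w =>
      rw [LinearMap.BilinForm.baseChange_tmul, LinearMap.BilinForm.baseChange_tmul, hs v w,
        mul_comm a b]

theorem vecIncl_sq (v : A ⊗[ℚ] V) :
    vecIncl Q A v * vecIncl Q A v = algebraMap A _ (Q.baseChange A v v) := by
  have h := vecIncl_mul_add_swapA Q v v
  rw [map_add, ← two_smul A, ← two_smul A] at h
  exact isUnit_two.smul_left_cancel.1 h

/-- `v ↦ -u v u⁻¹`. -/
def reflect (u : A ⊗[ℚ] V) : A ⊗[ℚ] V →ₗ[A] A ⊗[ℚ] V :=
  LinearMap.id - (LinearMap.toSpanSingleton A _ u) ∘ₗ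
    ((2 * Ring.inverse (Q.baseChange A u u)) • Q.baseChange A u)

theorem reflect_apply (u v : A ⊗[ℚ] V) :
    reflect Q u v = v - (2 * Ring.inverse (Q.baseChange A u u) * Q.baseChange A u v) • u := rfl

theorem det_reflect [FiniteDimensional ℚ V] {u : A ⊗[ℚ] V} (hu : IsUnit (Q.baseChange A u u)) :
    LinearMap.det (reflect Q u) = -1 := by
  -- The reflection has the shape v + f(v)u with f(u) = -2, and such a map has determinant 1 + f(u).
  have : reflect Q u = LinearMap.transvection
      ((-(2 * Ring.inverse (Q.baseChange A u u))) • Q.baseChange A u) u := by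
    apply LinearMap.ext
    intro w
    simp only [reflect_apply, LinearMap.transvection.apply,
      LinearMap.smul_apply, smul_eq_mul, neg_mul, neg_smul, sub_eq_add_neg]
  rw [this, LinearMap.transvection.det, LinearMap.smul_apply, smul_eq_mul]
  have := Ring.inverse_mul_cancel _ hu
  linear_combination (-2) * this

variable (hs : ∀ v w, Q v w = Q w v)
include hs

theorem vecIncl_mul_swap (v w : A ⊗[ℚ] V) :
    vecIncl Q A v * vecIncl Q A w =
      algebraMap A _ (2 * Q.baseChange A v w) - vecIncl Q A w * vecIncl Q A v := by
  rw [eq_sub_iff_add_eq, vecIncl_mul_add_swapA, baseChange_symm Q hs w v, two_mul]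

/-- This is the formula `v ↦ -u v u⁻¹` with the inverse cleared: a reflection is a graded
conjugation by a vector. -/
theorem vecIncl_reflect {u : A ⊗[ℚ] V} (hu : IsUnit (Q.baseChange A u u)) (v : A ⊗[ℚ] V) :
    vecIncl Q A (reflect Q u v) * vecIncl Q A u = -(vecIncl Q A u * vecIncl Q A v) := by
  rw [reflect_apply, map_sub, map_smul, sub_mul, smul_mul_assoc, vecIncl_sq,
    Algebra.algebraMap_eq_smul_one, smul_smul, vecIncl_mul_swap Q hs v u,
    baseChange_symm Q hs v u,
    show 2 * Ring.inverse (Q.baseChange A u u) * Q.baseChange A u v * Q.baseChange A u u =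
      2 * Q.baseChange A u v * (Ring.inverse (Q.baseChange A u u) * Q.baseChange A u u) by ring,
    Ring.inverse_mul_cancel _ hu, Algebra.algebraMap_eq_smul_one]
  rw [mul_one]
  abel

theorem reflect_isometry {u : A ⊗[ℚ] V} (hu : IsUnit (Q.baseChange A u u)) (v w : A ⊗[ℚ] V) :
    Q.baseChange A (reflect Q u v) (reflect Q u w) = Q.baseChange A v w := by
  simp only [reflect_apply, map_sub, map_smul, LinearMap.sub_apply, LinearMap.smul_apply,
    smul_eq_mul, baseChange_symm Q hs v u]
  have := Ring.inverse_mul_cancel _ hu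
  linear_combination (4 * Ring.inverse (Q.baseChange A u u) * Q.baseChange A u w *
    Q.baseChange A u v) * this

/-- Conjugation preserves the relation vw + wv = 2Q(v, w), because scalars are central; `Q` can be
read off since scalars embed into the Clifford algebra and 2 is invertible. -/
theorem isometry_of_conj {x y : A ⊗[ℚ] Cliff Q} (hxy : x * y = 1) (hyx : y * x = 1)
    {σ : A ⊗[ℚ] V →ₗ[A] A ⊗[ℚ] V} (h : ∀ v, vecIncl Q A (σ v) = x * vecIncl Q A v * y)
    (v w : A ⊗[ℚ] V) : Q.baseChange A (σ v) (σ w) = Q.baseChange A v w := by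
  have key : ∀ v w, vecIncl Q A (σ v) * vecIncl Q A (σ w) =
      x * (vecIncl Q A v * vecIncl Q A w) * y := fun v w => by
    rw [h, h]
    calc _ = x * vecIncl Q A v * (y * x) * vecIncl Q A w * y := by simp only [mul_assoc]
      _ = _ := by rw [hyx]; simp only [mul_assoc, mul_one]
  have h1 := vecIncl_mul_add_swapA Q (σ v) (σ w)
  rw [key, key, ← add_mul, ← mul_add, vecIncl_mul_add_swapA, ← Algebra.commutes, mul_assoc, hxy,
    mul_one] at h1
  have h2 := algebraMap_cliff_injective Q h1
  rw [baseChange_symm Q hs w, baseChange_symm Q hs (σ w), ← two_mul, ← two_mul] at h2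
  exact (isUnit_two.mul_left_cancel h2).symm

end BaseRing

/-! ### Orthogonal bases -/

/-- The symmetric bilinear form `Q` has the orthogonal basis `e` of anisotropic vectors. -/
structure IsOrthBasis {V : Type*} [AddCommGroup V] [Module ℚ V] (Q : LinearMap.BilinForm ℚ V)
    {r : ℕ} (e : Module.Basis (Fin r) ℚ V) : Prop where
  symm : ∀ v w, Q v w = Q w v
  ortho : ∀ i j, i ≠ j → Q (e i) (e j) = 0
  ne_zero : ∀ i, Q (e i) (e i) ≠ 0

section OrthBasis

variable {V : Type*} [AddCommGroup V] [Module ℚ V] {Q : LinearMap.BilinForm ℚ V}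
  {r : ℕ} {e : Module.Basis (Fin r) ℚ V} (he : IsOrthBasis Q e)
  (A : Type) [CommRing A] [Algebra ℚ A]

theorem adjoin_basis (e : Module.Basis (Fin r) ℚ V) :
    Algebra.adjoin A (Set.range fun i => vecIncl Q A (1 ⊗ₜ e i)) = ⊤ := by
  set S := Algebra.adjoin A (Set.range fun i => vecIncl Q A (1 ⊗ₜ e i))
  have h1 : ∀ v : V, vecIncl Q A (1 ⊗ₜ v) ∈ S := by
    intro v
    rw [← e.sum_repr v, TensorProduct.tmul_sum, map_sum]
    refine sum_mem fun i _ => ?_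
    rw [TensorProduct.tmul_smul, LinearMap.map_smul_of_tower, ← algebraMap_smul A]
    exact S.smul_mem (Algebra.subset_adjoin ⟨i, rfl⟩) _
  have h2 : ∀ x : Cliff Q, (1 : A) ⊗ₜ[ℚ] x ∈ S := by
    intro x
    induction x using CliffordAlgebra.induction with
    | algebraMap c =>
      rw [Algebra.algebraMap_eq_smul_one, ← TensorProduct.smul_tmul,
        ← Algebra.algebraMap_eq_smul_one]
      exact S.algebraMap_mem _
    | ι v => exact h1 v
    | mul x y hx hy =>
      have := mul_mem hx hy
      rwa [Algebra.TensorProduct.tmul_mul_tmul, one_mul] at this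
    | add x y hx hy => rw [TensorProduct.tmul_add]; exact add_mem hx hy
  refine eq_top_iff.2 fun x _ => ?_
  induction x using TensorProduct.induction_on with
  | zero => exact zero_mem _
  | add x y hx hy => exact add_mem (hx trivial) (hy trivial)
  | tmul a x =>
    have := S.smul_mem (h2 x) a
    rwa [TensorProduct.smul_tmul', smul_eq_mul, mul_one] at this

include he

theorem IsOrthBasis.anticommGen :
    AnticommGen (fun i => vecIncl Q A (1 ⊗ₜ e i)) (fun i => algebraMap ℚ A (Q (e i) (e i)))
      (involuteA Q A) where
  two := isUnit_two
  unit i := (IsUnit.mk0 _ (he.ne_zero i)).map _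
  sq i := by
    rw [vecIncl_sq, LinearMap.BilinForm.baseChange_tmul, mul_one, ← Algebra.algebraMap_eq_smul_one]
  anti i j hij := by
    rw [vecIncl_mul_swap Q he.symm, LinearMap.BilinForm.baseChange_tmul, he.ortho i j hij]
    simp
  map i := involuteA_vecIncl Q _
  gen := adjoin_basis A e

theorem IsOrthBasis.finite_cliff : Module.Finite ℚ (Cliff Q) := by
  have h1 := (he.anticommGen ℚ).fg
  exact Module.Finite.equiv (TensorProduct.lid ℚ (Cliff Q))

theorem IsOrthBasis.finite_evenCliff : Module.Finite ℚ (EvenCliff Q) := by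
  have := he.finite_cliff
  exact Module.Finite.of_injective (EvenCliff Q).val.toLinearMap Subtype.val_injective

end OrthBasis

end

end KugaSatake


namespace KugaSatake

noncomputable section

/-! ### The decomposition of `V_ℝ` and the action of `h` -/

section Decomposition

variable {V : Type*} [AddCommGroup V] [Module ℚ V] {H : HodgeStructure V 2}
  {Q : LinearMap.BilinForm ℚ V}

theorem rePart_mem_of_span {f₁ f₂ : ℝ ⊗[ℚ] V} {x : ℂ ⊗[ℝ] (ℝ ⊗[ℚ] V)}
    (hx : x ∈ Submodule.span ℂ {(1 : ℂ) ⊗ₜ[ℝ] f₁ + Complex.I ⊗ₜ[ℝ] f₂}) :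
    ∃ a b : ℝ, rePart _ x = a • f₁ + b • f₂ := by
  obtain ⟨c, rfl⟩ := Submodule.mem_span_singleton.1 hx
  refine ⟨c.re, -c.im, ?_⟩
  rw [smul_re_im]
  simp [rePart, sub_eq_add_neg]

theorem hodge_apply_re_im {M : Type*} [AddCommGroup M] [Module ℝ M] (g : M →ₗ[ℝ] M)
    {x : ℂ ⊗[ℝ] M} {c : ℂ} (hx : g.baseChange ℂ x = c • x) :
    g (rePart M x) = c.re • rePart M x - c.im • imPart M x ∧
      g (imPart M x) = c.im • rePart M x + c.re • imPart M x := by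
  rw [eq_re_add_im x, map_add, LinearMap.baseChange_tmul, LinearMap.baseChange_tmul,
    smul_re_im] at hx
  simpa only [← eq_re_add_im] using ext_re_im hx

/-- Every v in V_ℝ is the real part of 1 ⊗ v, so it suffices to treat real parts of elements of
V^{p,q}. Effectivity leaves p = 0, 1, 2. The outer pieces contribute to the plane of f₁, f₂, and on
V^{1,1} the action is the real scalar |z|². -/
theorem IsFrame.exists_decomp (hQ : IsK3Type H Q) {f₁ f₂ : ℝ ⊗[ℚ] V} (hf : IsFrame H Q f₁ f₂)
    (v : ℝ ⊗[ℚ] V) : ∃ (a b : ℝ) (v' : ℝ ⊗[ℚ] V), v = a • f₁ + b • f₂ + v' ∧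
      ∀ z : ℂˣ, (H.h z).val v' = Complex.normSq z • v' := by
  set P : ℝ ⊗[ℚ] V → Prop := fun v => ∃ (a b : ℝ) (v' : ℝ ⊗[ℚ] V), v = a • f₁ + b • f₂ + v' ∧
      ∀ z : ℂˣ, (H.h z).val v' = Complex.normSq z • v' with hP
  have hre : ∀ x : ℂ ⊗[ℝ] (ℝ ⊗[ℚ] V), P (rePart _ x) := by
    intro x
    have hx : x ∈ ⨆ p : ℤ, hodgePiece H.h p (2 - p) := by rw [H.iSup_piece]; trivial
    induction hx using Submodule.iSup_induction' with
    | zero => exact ⟨0, 0, 0, by simp, by simp⟩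
    | add x y _ _ hx hy =>
      obtain ⟨a, b, v, h1, h2⟩ := hx
      obtain ⟨a', b', v', h1', h2'⟩ := hy
      refine ⟨a + a', b + b', v + v', ?_, fun z => by rw [map_add, h2, h2', smul_add]⟩
      rw [map_add, h1, h1']
      module
    | mem p x hx =>
      by_cases hx0 : x = 0
      · subst hx0; exact ⟨0, 0, 0, by simp, by simp⟩
      have hp : 0 ≤ p ∧ 0 ≤ 2 - p :=
        hQ.effective p (2 - p) (fun h => hx0 ((Submodule.eq_bot_iff _).1 h x hx))
      obtain rfl | rfl | rfl : p = 0 ∨ p = 1 ∨ p = 2 := by omega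
      -- For p = 0 pass to the complex conjugate of `x`: it lies in V^{2,0} and has the same real
      -- part.
      · have hmem : (1 : ℂ) ⊗ₜ[ℝ] rePart _ x + Complex.I ⊗ₜ[ℝ] (-imPart _ x) ∈ H.piece 2 0 := by
          intro z
          obtain ⟨h1, h2⟩ := hodge_apply_re_im _ (hx z)
          rw [map_add, LinearMap.baseChange_tmul, LinearMap.baseChange_tmul, map_neg, h1, h2,
            smul_re_im]
          have hc : (z : ℂ) ^ (2 : ℤ) * conj (z : ℂ) ^ (0 : ℤ) =
              conj ((z : ℂ) ^ (0 : ℤ) * conj (z : ℂ) ^ (2 - 0 : ℤ)) := by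
            simp
          rw [hc, Complex.conj_re, Complex.conj_im]
          congr 2
          · module
          · module
        rw [hf.span] at hmem
        obtain ⟨a, b, hab⟩ := rePart_mem_of_span hmem
        refine ⟨a, b, 0, ?_, by simp⟩
        rw [add_zero, ← hab]
        simp [rePart]
      · refine ⟨0, 0, rePart _ x, by simp, fun z => ?_⟩
        obtain ⟨h1, -⟩ := hodge_apply_re_im _ (hx z)
        have hc : (z : ℂ) ^ (1 : ℤ) * conj (z : ℂ) ^ (2 - 1 : ℤ) = Complex.normSq z := by
          norm_num [Complex.mul_conj]
        rw [hc, Complex.ofReal_re, Complex.ofReal_im, zero_smul, sub_zero] at h1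
        exact h1
      · have hmem : x ∈ H.piece 2 0 := by simpa using hx
        rw [hf.span] at hmem
        obtain ⟨a, b, hab⟩ := rePart_mem_of_span hmem
        exact ⟨a, b, 0, by rw [hab, add_zero], by simp⟩
  have := hre ((1 : ℂ) ⊗ₜ v)
  simpa [rePart] using this

theorem IsFrame.apply {f₁ f₂ : ℝ ⊗[ℚ] V} (hf : IsFrame H Q f₁ f₂) (z : ℂˣ) :
    (H.h z).val f₁ = ((z : ℂ) ^ 2).re • f₁ - ((z : ℂ) ^ 2).im • f₂ ∧
    (H.h z).val f₂ = ((z : ℂ) ^ 2).im • f₁ + ((z : ℂ) ^ 2).re • f₂ :=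
  h_apply_of_mem (by rw [hf.span]; exact Submodule.mem_span_singleton_self _) z

theorem unitI_sq (hQ : IsK3Type H Q) (v : ℝ ⊗[ℚ] V) :
    (H.h unitI).val ((H.h unitI).val v) = v := by
  obtain ⟨f₁, f₂, hf⟩ := exists_frame hQ
  obtain ⟨a, b, v', rfl, hv'⟩ := hf.exists_decomp hQ v
  have e : ((unitI : ℂˣ) : ℂ) = Complex.I := rfl
  have hI := hf.apply unitI
  rw [e, Complex.I_sq] at hI
  simp only [Complex.neg_re, Complex.one_re, Complex.neg_im, Complex.one_im, neg_zero, zero_smul,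
    sub_zero, zero_add, neg_smul, one_smul] at hI
  have hI' := hv' unitI
  rw [e, Complex.normSq_I, one_smul] at hI'
  simp only [map_add, map_smul, hI.1, hI.2, hI', map_neg, neg_neg]

/-- A polarization only gives the symmetry of Q(v, h(i)w). The factor h(i) is removed because h(i)
preserves `Q` and squares to the identity. -/
theorem IsK3Type.symmR (hQ : IsK3Type H Q) (v w : ℝ ⊗[ℚ] V) :
    Q.baseChange ℝ v w = Q.baseChange ℝ w v := by
  have h1 := hQ.polarization.equivariant unitI v w
  have e : ((unitI : ℂˣ) : ℂ) = Complex.I := rfl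
  rw [e, Complex.normSq_I, one_zpow, one_mul] at h1
  rw [← h1, hQ.polarization.symm, unitI_sq hQ]

theorem IsK3Type.symm (hQ : IsK3Type H Q) (v w : V) : Q v w = Q w v := by
  have := hQ.symmR ((1 : ℝ) ⊗ₜ v) ((1 : ℝ) ⊗ₜ w)
  simpa [LinearMap.BilinForm.baseChange_tmul] using this

/-- A rational vector in the radical stays in the radical over ℝ, contrary to Q(v, h(i)v) > 0. -/
theorem IsK3Type.nondegenerate (hQ : IsK3Type H Q) : Q.Nondegenerate := by
  have key : ∀ v : V, (∀ w, Q v w = 0) → v = 0 := by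
    intro v hv
    by_contra hne
    have h0 : ∀ w : ℝ ⊗[ℚ] V, Q.baseChange ℝ (1 ⊗ₜ v) w = 0 := by
      intro w
      induction w using TensorProduct.induction_on with
      | zero => simp
      | add x y hx hy => rw [map_add, hx, hy, add_zero]
      | tmul a w => rw [LinearMap.BilinForm.baseChange_tmul, hv]; simp
    have hne' : (1 : ℝ) ⊗ₜ[ℚ] v ≠ 0 := by
      have := Module.FaithfullyFlat.tensorProduct_mk_injective (A := ℚ) (B := ℝ) V
      intro h
      exact hne (this (h.trans (by simp)))
    exact (hQ.polarization.pos _ hne').ne' (h0 _)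
  exact ⟨key, fun v hv => key v fun w => by rw [hQ.symm]; exact hv w⟩

theorem IsK3Type.exists_orthBasis [FiniteDimensional ℚ V] (hQ : IsK3Type H Q) :
    ∃ (r : ℕ) (e : Module.Basis (Fin r) ℚ V), IsOrthBasis Q e := by
  obtain ⟨e, he⟩ := LinearMap.BilinForm.exists_orthogonal_basis (B := Q) ⟨hQ.symm⟩
  refine ⟨_, e, hQ.symm, fun i j hij => he hij, fun i => ?_⟩
  exact he.not_isOrtho_basis_self_of_separatingLeft hQ.nondegenerate.1 i

/-- The isometry h(i) acts as -1 on `f₁`, `f₂` and as 1 on `v'`. -/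
theorem IsFrame.ortho_of_apply (hQ : IsK3Type H Q) {f₁ f₂ v' : ℝ ⊗[ℚ] V} (hf : IsFrame H Q f₁ f₂)
    (hv' : ∀ z : ℂˣ, (H.h z).val v' = Complex.normSq z • v') :
    Q.baseChange ℝ f₁ v' = 0 ∧ Q.baseChange ℝ f₂ v' = 0 := by
  have e : ((unitI : ℂˣ) : ℂ) = Complex.I := rfl
  have hI := hf.apply unitI
  rw [e, Complex.I_sq] at hI
  simp only [Complex.neg_re, Complex.one_re, Complex.neg_im, Complex.one_im, neg_zero, zero_smul,
    sub_zero, zero_add, neg_smul, one_smul] at hI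
  have hI' := hv' unitI
  rw [e, Complex.normSq_I, one_smul] at hI'
  have h1 := hQ.polarization.equivariant unitI f₁ v'
  have h2 := hQ.polarization.equivariant unitI f₂ v'
  rw [e, Complex.normSq_I, one_zpow, one_mul] at h1 h2
  rw [hI.1, hI', map_neg, LinearMap.neg_apply] at h1
  rw [hI.2, hI', map_neg, LinearMap.neg_apply] at h2
  constructor <;> linarith

/-- The element `a + b J`, the reverse of `a - b J`. -/
theorem reverseA_ksUnit (hQ : IsK3Type H Q) (z : ℂˣ) :
    reverseA Q ℝ (evenIncl Q ℝ (ksUnit hQ z).val) =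
      algebraMap ℝ _ (z : ℂ).re + (z : ℂ).im • evenIncl Q ℝ (ksJ hQ) := by
  obtain ⟨f₁, f₂, hf⟩ := exists_frame hQ
  obtain ⟨q22, q12, q21⟩ := hf.form hQ.polarization
  have h1 := vecIncl_mul_add_swap Q f₁ f₂
  rw [q12, q21, add_zero, map_zero] at h1
  rw [ksUnit_apply, map_sub, map_sub, map_smul, map_smul, AlgHom.commutes, reverseA_algebraMap,
    ksJ_eq hQ hf, evenIncl_evenProd, reverseA_mul, reverseA_vecIncl, reverseA_vecIncl,
    eq_neg_of_add_eq_zero_right h1, smul_neg, sub_neg_eq_add]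

theorem ksUnit_mul_reverse (hQ : IsK3Type H Q) (z : ℂˣ) :
    evenIncl Q ℝ (ksUnit hQ z).val * reverseA Q ℝ (evenIncl Q ℝ (ksUnit hQ z).val) =
      algebraMap ℝ _ (Complex.normSq z) := by
  have hJ := congrArg (evenIncl Q ℝ) (ksJ_mul_self hQ)
  rw [map_mul, map_neg, map_one] at hJ
  rw [reverseA_ksUnit, ksUnit_apply, map_sub, map_smul, AlgHom.commutes]
  simp only [Algebra.algebraMap_eq_smul_one, sub_mul, mul_add, smul_mul_smul_comm, one_mul, mul_one,
    hJ, Complex.normSq_apply]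
  module

/-- On the plane of f₁, f₂ the element J anticommutes with vectors, so (a - bJ)v(a + bJ) = (a -
bJ)²v, which is the rotation-dilation by z². On the complement J commutes with vectors, and the
product is (a² + b²)v. Using the reversal instead of the inverse gives h itself, with no factor
|z|⁻². -/
theorem ksUnit_conj (hQ : IsK3Type H Q) (z : ℂˣ) (v : ℝ ⊗[ℚ] V) :
    evenIncl Q ℝ (ksUnit hQ z).val * vecIncl Q ℝ v *
      reverseA Q ℝ (evenIncl Q ℝ (ksUnit hQ z).val) = vecIncl Q ℝ ((H.h z).val v) := by
  obtain ⟨f₁, f₂, hf⟩ := exists_frame hQ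
  obtain ⟨q22, q12, q21⟩ := hf.form hQ.polarization
  obtain ⟨a, b, v', rfl, hv'⟩ := hf.exists_decomp hQ v
  obtain ⟨o1, o2⟩ := hf.ortho_of_apply hQ hv'
  rw [reverseA_ksUnit, ksUnit_apply, map_sub, map_smul, AlgHom.commutes, ksJ_eq hQ hf,
    evenIncl_evenProd]
  have s := vecIncl_mul_swap Q (A := ℝ) hQ.symm
  have h12 := s f₂ f₁
  have h1v := s v' f₁
  have h2v := s v' f₂
  rw [q21] at h12
  rw [hQ.symmR, o1] at h1v
  rw [hQ.symmR, o2] at h2v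
  have h11 := vecIncl_sq Q f₁
  have h22 := vecIncl_sq Q f₂
  rw [hf.norm] at h11
  rw [q22] at h22
  simp only [map_add, map_sub, map_smul, (hf.apply z).1, (hf.apply z).2, hv']
  generalize vecIncl Q ℝ f₁ = F₁ at *
  generalize vecIncl Q ℝ f₂ = F₂ at *
  generalize vecIncl Q ℝ v' = X at *
  simp only [mul_zero, map_zero, zero_sub, map_neg, map_one] at h12 h1v h2v h11 h22
  have c1 : F₁ * F₂ * F₁ = F₂ := by
    rw [mul_assoc, h12, mul_neg, ← mul_assoc, h11]; simp
  have c2 : F₁ * F₂ * F₂ = -F₁ := by rw [mul_assoc, h22]; simp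
  have c3 : F₁ * (F₁ * F₂) = -F₂ := by rw [← mul_assoc, h11]; simp
  have c4 : F₂ * (F₁ * F₂) = F₁ := by rw [← mul_assoc, h12, neg_mul, c2, neg_neg]
  have c5 : X * (F₁ * F₂) = F₁ * F₂ * X := by
    rw [← mul_assoc, h1v, neg_mul, mul_assoc, h2v, mul_neg, neg_neg, mul_assoc]
  have c6 : F₁ * F₂ * (F₁ * F₂) = -1 := by rw [← mul_assoc, c1, h22]
  generalize F₁ * F₂ = J at *
  have e1 : ((z : ℂ) ^ 2).re = (z : ℂ).re * (z : ℂ).re - (z : ℂ).im * (z : ℂ).im := by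
    rw [sq, Complex.mul_re]
  have e2 : ((z : ℂ) ^ 2).im = 2 * ((z : ℂ).re * (z : ℂ).im) := by
    rw [sq, Complex.mul_im]; ring
  rw [e1, e2, Complex.normSq_apply]
  have c7 : J * (J * X) = -X := by rw [← mul_assoc, c6, neg_one_mul]
  simp only [Algebra.algebraMap_eq_smul_one, sub_mul, mul_add, add_mul, smul_mul_assoc,
    mul_smul_comm, one_mul, mul_one, mul_assoc, neg_mul, c1, c2, c3, c4, c5, c7]
  module

end Decomposition

end

end KugaSatake


namespace KugaSatake

noncomputable section

/-! ### `h_s` and `CSpin(Q)` -/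

section KSUnit

variable {V : Type*} [AddCommGroup V] [Module ℚ V] {H : HodgeStructure V 2}
  {Q : LinearMap.BilinForm ℚ V}

theorem normSq_unit_ne_zero (z : ℂˣ) : Complex.normSq z ≠ 0 := by simp

theorem evenIncl_ksUnit_inv (hQ : IsK3Type H Q) (z : ℂˣ) :
    evenIncl Q ℝ ((ksUnit hQ z)⁻¹).val =
      (Complex.normSq z)⁻¹ • reverseA Q ℝ (evenIncl Q ℝ (ksUnit hQ z).val) := by
  have h1 := ksUnit_mul_reverse hQ z
  have h2 : evenIncl Q ℝ ((ksUnit hQ z)⁻¹).val * evenIncl Q ℝ (ksUnit hQ z).val = 1 := by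
    rw [← map_mul, Units.inv_mul, map_one]
  have h3 := congrArg (evenIncl Q ℝ ((ksUnit hQ z)⁻¹).val * ·) h1
  simp only [← mul_assoc, h2, one_mul] at h3
  rw [h3, ← Algebra.commutes, ← Algebra.smul_def, smul_smul,
    inv_mul_cancel₀ (normSq_unit_ne_zero z), one_smul]

theorem ksUnit_conj_inv (hQ : IsK3Type H Q) (z : ℂˣ) (v : ℝ ⊗[ℚ] V) :
    evenIncl Q ℝ (ksUnit hQ z).val * vecIncl Q ℝ v * evenIncl Q ℝ ((ksUnit hQ z)⁻¹).val =
      vecIncl Q ℝ ((Complex.normSq z)⁻¹ • (H.h z).val v) := by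
  rw [evenIncl_ksUnit_inv, mul_smul_comm, ksUnit_conj, map_smul]

theorem ksUnit_mem_cspinUnits (hQ : IsK3Type H Q) (z : ℂˣ) : ksUnit hQ z ∈ cspinUnits Q ℝ := by
  refine ⟨fun v => ⟨_, ksUnit_conj_inv hQ z v⟩,
    fun v => ⟨(Complex.normSq (z⁻¹ : ℂˣ))⁻¹ • (H.h z⁻¹).val v, ?_⟩⟩
  have := ksUnit_conj_inv hQ z⁻¹ v
  rwa [map_inv, inv_inv] at this

theorem sigma_apply {A : Type} [CommRing A] [Algebra ℚ A] (g : (A ⊗[ℚ] EvenCliff Q)ˣ)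
    (x : A ⊗[ℚ] EvenCliff Q) : (sigma Q A g).val x = g.val * x := rfl

theorem sigma_injective {A : Type} [CommRing A] [Algebra ℚ A] :
    Function.Injective (sigma Q A) := by
  intro g g' h
  have := congrArg (fun f => f.val 1) h
  simp only [sigma_apply, mul_one] at this
  exact Units.ext this

theorem rho_apply {A : Type} [CommRing A] [Algebra ℚ A] (g : cspinUnits Q A) (v : A ⊗[ℚ] V) :
    vecIncl Q A ((rho Q A g).val v) =
      evenIncl Q A g.1.val * vecIncl Q A v * evenIncl Q A (g.1⁻¹).val :=
  vecIncl_conjVec Q g v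

theorem rho_ksUnit (hQ : IsK3Type H Q) (z : ℂˣ) (v : ℝ ⊗[ℚ] V) :
    (rho Q ℝ ⟨_, ksUnit_mem_cspinUnits hQ z⟩).val v =
      (Complex.normSq z)⁻¹ • (H.h z).val v := by
  apply vecIncl_injective Q ℝ
  rw [rho_apply, ksUnit_conj_inv]

theorem h_apply_of_real (hQ : IsK3Type H Q) {z : ℂˣ} {t : ℝ} (hz : (z : ℂ) = t) (v : ℝ ⊗[ℚ] V) :
    (H.h z).val v = t ^ 2 • v := by
  obtain ⟨f₁, f₂, hf⟩ := exists_frame hQ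
  obtain ⟨a, b, v', rfl, hv'⟩ := hf.exists_decomp hQ v
  have e1 : ((z : ℂ) ^ 2).re = t ^ 2 := by rw [hz]; norm_cast
  have e2 : ((z : ℂ) ^ 2).im = 0 := by rw [hz]; norm_cast
  have e3 : Complex.normSq z = t ^ 2 := by rw [hz, Complex.normSq_ofReal, sq]
  simp only [map_add, map_smul, (hf.apply z).1, (hf.apply z).2, hv', e1, e2, e3]
  module

theorem h_eq_smul_rho (hQ : IsK3Type H Q) (t φ : ℝ) (z u : ℂˣ)
    (hz : (z : ℂ) = t * Complex.exp (φ * Complex.I)) (hu : (u : ℂ) = Complex.exp (φ * Complex.I))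
    (g : cspinUnits Q ℝ) (hg : sigma Q ℝ g = (kugaSatake hQ).h u) :
    (H.h z).val = t ^ 2 • (rho Q ℝ g).val := by
  -- Left multiplication determines the unit, so `g` can only be h_s(u).
  obtain rfl : g = ⟨_, ksUnit_mem_cspinUnits hQ u⟩ := Subtype.ext (sigma_injective hg)
  have hn : Complex.normSq u = 1 := by
    rw [hu, Complex.normSq_eq_norm_sq, Complex.norm_exp_ofReal_mul_I, one_pow]
  have hs : ((z * u⁻¹ : ℂˣ) : ℂ) = t := by
    rw [Units.val_mul, hz, ← hu, mul_assoc, Units.mul_inv, mul_one]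
  apply LinearMap.ext
  intro v
  -- The modulus is split off: z u⁻¹ = t is real and acts as t², while |u| = 1 makes h(u) equal to
  -- ρ(h_s(u)).
  have hzz : z = z * u⁻¹ * u := by rw [inv_mul_cancel_right]
  rw [LinearMap.smul_apply, rho_ksUnit, hn, inv_one, one_smul]
  conv_lhs => rw [hzz, map_mul]
  exact h_apply_of_real hQ hs _

end KSUnit

/-! ### The embedding of `V` into `C⁺(Q) ⊗ C⁺(Q)` -/

section BaseChangeMul

open TensorProduct.AlgebraTensorModule

variable {E C : Type*} [Ring E] [Algebra ℚ E] [Ring C] [Algebra ℚ C]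

theorem distribBaseChange_mul_tmul (a b t : ℝ) (c d : E) (y : E ⊗[ℚ] E) :
    distribBaseChange ℚ ℝ E E ((a * t * b) ⊗ₜ ((c ⊗ₜ d) * y)) =
      TensorProduct.map (LinearMap.mulLeft ℝ (a ⊗ₜ[ℚ] c)) (LinearMap.mulLeft ℝ (b ⊗ₜ[ℚ] d))
        (distribBaseChange ℚ ℝ E E (t ⊗ₜ y)) := by
  induction y using TensorProduct.induction_on with
  | zero => simp
  | add y z hy hz => simp only [mul_add, TensorProduct.tmul_add, map_add, hy, hz]
  | tmul y z =>
    rw [Algebra.TensorProduct.tmul_mul_tmul, distribBaseChange_tmul, distribBaseChange_tmul,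
      TensorProduct.map_tmul, LinearMap.mulLeft_apply, LinearMap.mulLeft_apply,
      Algebra.TensorProduct.tmul_mul_tmul, Algebra.TensorProduct.tmul_mul_tmul]
    have : ∀ u : E, (b * 1 : ℝ) ⊗ₜ[ℚ] u = b • ((1 : ℝ) ⊗ₜ[ℚ] u) := fun u => by
      rw [TensorProduct.smul_tmul', smul_eq_mul]
    rw [this, TensorProduct.tmul_smul, TensorProduct.smul_tmul', TensorProduct.smul_tmul',
      smul_eq_mul, mul_comm b]

/-- Both sides are additive in each of `c`, `d` and `x`, so the rational rule for `F` extends to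
real coefficients by checking pure tensors. -/
theorem distribBaseChange_of_mul (i : E →ₐ[ℚ] C) (rev : C →ₗ[ℚ] C) (F : C →ₗ[ℚ] E ⊗[ℚ] E)
    (hF : ∀ c d x, F (i c * x * rev (i d)) = (c ⊗ₜ d) * F x) (c d : ℝ ⊗[ℚ] E) (x : ℝ ⊗[ℚ] C) :
    distribBaseChange ℚ ℝ E E (F.baseChange ℝ
      (Algebra.TensorProduct.map (AlgHom.id ℝ ℝ) i c * x *
        rev.baseChange ℝ (Algebra.TensorProduct.map (AlgHom.id ℝ ℝ) i d))) =
    TensorProduct.map (LinearMap.mulLeft ℝ c) (LinearMap.mulLeft ℝ d)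
      (distribBaseChange ℚ ℝ E E (F.baseChange ℝ x)) := by
  induction c using TensorProduct.induction_on with
  | zero => simp
  | add c c' hc hc' =>
    have : LinearMap.mulLeft ℝ (c + c') = LinearMap.mulLeft ℝ c + LinearMap.mulLeft ℝ c' :=
      LinearMap.ext fun x => add_mul _ _ _
    rw [map_add, add_mul, add_mul, map_add, map_add, hc, hc', ← LinearMap.add_apply,
      ← TensorProduct.map_add_left, this]
  | tmul a c =>
  induction d using TensorProduct.induction_on with
  | zero => simp
  | add d d' hd hd' =>
    have : LinearMap.mulLeft ℝ (d + d') = LinearMap.mulLeft ℝ d + LinearMap.mulLeft ℝ d' :=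
      LinearMap.ext fun x => add_mul _ _ _
    rw [map_add, map_add, mul_add, map_add, map_add, hd, hd', ← LinearMap.add_apply,
      ← TensorProduct.map_add_right, this]
  | tmul b d =>
  induction x using TensorProduct.induction_on with
  | zero => simp
  | add x y hx hy => simp only [mul_add, add_mul, map_add, hx, hy]
  | tmul t x =>
    rw [Algebra.TensorProduct.map_tmul, Algebra.TensorProduct.map_tmul, LinearMap.baseChange_tmul,
      Algebra.TensorProduct.tmul_mul_tmul, Algebra.TensorProduct.tmul_mul_tmul,
      LinearMap.baseChange_tmul, LinearMap.baseChange_tmul, hF]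
    exact distribBaseChange_mul_tmul _ _ _ _ _ _

end BaseChangeMul

section Embedding

variable {V : Type*} [AddCommGroup V] [Module ℚ V] {Q : LinearMap.BilinForm ℚ V}

/-- The projection of `C(Q)` onto `C⁺(Q)`. -/
def evenPart (Q : LinearMap.BilinForm ℚ V) : Cliff Q →ₗ[ℚ] EvenCliff Q :=
  LinearMap.codRestrict (Subalgebra.toSubmodule (EvenCliff Q))
    ((2⁻¹ : ℚ) • (LinearMap.id + CliffordAlgebra.involute.toLinearMap)) (by
      intro x
      have key : x + CliffordAlgebra.involute x ∈ EvenCliff Q := by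
        have hx : x ∈ CliffordAlgebra.evenOdd (LinearMap.BilinMap.toQuadraticMap Q) 0 ⊔
            CliffordAlgebra.evenOdd (LinearMap.BilinMap.toQuadraticMap Q) 1 := by
          rw [(CliffordAlgebra.evenOdd_isCompl _).sup_eq_top]; trivial
        obtain ⟨a, ha, b, hb, rfl⟩ := Submodule.mem_sup.1 hx
        rw [map_add, CliffordAlgebra.involute_eq_of_mem_even ha,
          CliffordAlgebra.involute_eq_of_mem_odd hb]
        have : a + b + (a + -b) = a + a := by abel
        rw [this]
        exact add_mem (S := Submodule ℚ _) ha ha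
      exact Submodule.smul_mem _ _ key)

theorem evenPart_coe (x : Cliff Q) :
    (evenPart Q x : Cliff Q) = (2⁻¹ : ℚ) • (x + CliffordAlgebra.involute x) := rfl

theorem evenPart_mul (c : EvenCliff Q) (x : Cliff Q) : evenPart Q (c * x) = c * evenPart Q x := by
  apply Subtype.ext
  rw [Subalgebra.coe_mul, evenPart_coe, evenPart_coe, map_mul,
    CliffordAlgebra.involute_eq_of_mem_even c.2, ← mul_add, mul_smul_comm]

theorem evenPart_even (c : EvenCliff Q) : evenPart Q c = c := by
  apply Subtype.ext
  rw [evenPart_coe, CliffordAlgebra.involute_eq_of_mem_even c.2, ← two_smul ℚ, smul_smul]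
  norm_num

/-- The element `eᵢ ⊗ eᵢ⁻¹` of `C(Q) ⊗ C(Q)`. -/
def diagElt (Q : LinearMap.BilinForm ℚ V) {r : ℕ} (e : Module.Basis (Fin r) ℚ V) (i : Fin r) :
    Cliff Q ⊗[ℚ] Cliff Q :=
  (Q (e i) (e i))⁻¹ • (CliffordAlgebra.ι _ (e i) ⊗ₜ[ℚ]
    CliffordAlgebra.ι (LinearMap.BilinMap.toQuadraticMap Q) (e i))

/-- The Casimir element `∏ᵢ (1 + eᵢ ⊗ eᵢ⁻¹)`. -/
def casimir (Q : LinearMap.BilinForm ℚ V) {r : ℕ} (e : Module.Basis (Fin r) ℚ V)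
    (l : List (Fin r)) : Cliff Q ⊗[ℚ] Cliff Q :=
  (l.map fun i => 1 + diagElt Q e i).prod

/-- The map `x ⊗ y ↦ x * reverse y`. -/
def mulReverse (Q : LinearMap.BilinForm ℚ V) : Cliff Q ⊗[ℚ] Cliff Q →ₗ[ℚ] Cliff Q :=
  LinearMap.mul' ℚ (Cliff Q) ∘ₗ CliffordAlgebra.reverse.lTensor (Cliff Q)

theorem mulReverse_tmul (x y : Cliff Q) :
    mulReverse Q (x ⊗ₜ y) = x * CliffordAlgebra.reverse y := rfl

local notation "ιQ" => CliffordAlgebra.ι (LinearMap.BilinMap.toQuadraticMap Q)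

variable {r : ℕ} {e : Module.Basis (Fin r) ℚ V} (he : IsOrthBasis Q e)

theorem ι_sq (v : V) : ιQ v * ιQ v = algebraMap ℚ _ (Q v v) := by
  rw [CliffordAlgebra.ι_sq_scalar]; rfl

theorem mulReverse_diagElt_mul (i : Fin r) (z : Cliff Q ⊗[ℚ] Cliff Q) :
    mulReverse Q (diagElt Q e i * z) =
      (Q (e i) (e i))⁻¹ • (ιQ (e i) * mulReverse Q z * ιQ (e i)) := by
  induction z using TensorProduct.induction_on with
  | zero => simp
  | add x y hx hy => simp only [mul_add, map_add, hx, hy, smul_add, add_mul]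
  | tmul x y =>
    rw [diagElt, smul_mul_assoc, map_smul, Algebra.TensorProduct.tmul_mul_tmul, mulReverse_tmul,
      mulReverse_tmul, CliffordAlgebra.reverse.map_mul, CliffordAlgebra.reverse_ι]
    simp only [mul_assoc]

/-- The map `x ↦ (x ⊗ 1) Ω (w ⊗ 1)` to the even part of `C(Q) ⊗ C(Q)`. -/
def embedCliff (e : Module.Basis (Fin r) ℚ V) (w : V) :
    Cliff Q →ₗ[ℚ] EvenCliff Q ⊗[ℚ] EvenCliff Q :=
  TensorProduct.map (evenPart Q) (evenPart Q) ∘ₗ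
    LinearMap.mulRight ℚ (casimir Q e (List.finRange r) * (ιQ w ⊗ₜ[ℚ] 1)) ∘ₗ
    (Algebra.TensorProduct.includeLeft : Cliff Q →ₐ[ℚ] Cliff Q ⊗[ℚ] Cliff Q).toLinearMap

theorem embedCliff_apply (w : V) (x : Cliff Q) : embedCliff e w x =
    TensorProduct.map (evenPart Q) (evenPart Q)
      ((x ⊗ₜ 1) * (casimir Q e (List.finRange r) * (ιQ w ⊗ₜ[ℚ] 1))) := rfl

theorem map_evenPart_mul (c d : EvenCliff Q) (z : Cliff Q ⊗[ℚ] Cliff Q) :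
    TensorProduct.map (evenPart Q) (evenPart Q) (((c : Cliff Q) ⊗ₜ (d : Cliff Q)) * z) =
      (c ⊗ₜ d) * TensorProduct.map (evenPart Q) (evenPart Q) z := by
  induction z using TensorProduct.induction_on with
  | zero => simp
  | add x y hx hy => simp only [mul_add, map_add, hx, hy]
  | tmul x y =>
    simp only [Algebra.TensorProduct.tmul_mul_tmul, TensorProduct.map_tmul, evenPart_mul]

include he

theorem IsOrthBasis.ι_anti {i j : Fin r} (hij : i ≠ j) :
    ιQ (e i) * ιQ (e j) = -(ιQ (e j) * ιQ (e i)) := by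
  rw [eq_neg_iff_add_eq_zero, CliffordAlgebra.ι_mul_ι_add_swap,
    LinearMap.BilinMap.polar_toQuadraticMap, he.ortho i j hij, he.ortho j i hij.symm]
  simp

/-- The tensor product of algebras is the ordinary one, so the sign from the left factor cancels the
sign from the right factor. -/
theorem IsOrthBasis.diagElt_comm (i j : Fin r) :
    diagElt Q e i * diagElt Q e j = diagElt Q e j * diagElt Q e i := by
  by_cases hij : i = j
  · rw [hij]
  · simp only [diagElt, smul_mul_smul_comm, Algebra.TensorProduct.tmul_mul_tmul, he.ι_anti hij,
      TensorProduct.neg_tmul, TensorProduct.tmul_neg, neg_neg]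
    rw [mul_comm]

theorem IsOrthBasis.diagElt_sq (i : Fin r) : diagElt Q e i * diagElt Q e i = 1 := by
  have := he.ne_zero i
  simp only [diagElt, smul_mul_smul_comm, Algebra.TensorProduct.tmul_mul_tmul, ι_sq,
    Algebra.algebraMap_eq_smul_one, TensorProduct.smul_tmul_smul, smul_smul]
  rw [mul_mul_mul_comm, inv_mul_cancel₀ this, mul_one, one_smul]
  rfl

/-- If E² = 1, then E(1 + E) = 1 + E, and E commutes with the remaining factors of the product. -/
theorem IsOrthBasis.diagElt_mul_casimir (l : List (Fin r)) (i : Fin r) (hi : i ∈ l) :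
    diagElt Q e i * casimir Q e l = casimir Q e l := by
  induction l with
  | nil => simp at hi
  | cons j l ih =>
    rw [casimir, List.map_cons, List.prod_cons, ← casimir, ← mul_assoc]
    by_cases hij : i = j
    · rw [hij, mul_add, he.diagElt_sq, mul_one, add_comm]
    · rw [mul_add, he.diagElt_comm, mul_one, ← one_add_mul, mul_assoc,
        ih (by simpa [hij] using hi)]

theorem IsOrthBasis.casimir_comm (l : List (Fin r)) (i : Fin r) :
    diagElt Q e i * casimir Q e l = casimir Q e l * diagElt Q e i := by
  have : Commute (diagElt Q e i) (casimir Q e l) := by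
    apply Commute.list_prod_right
    intro x hx
    obtain ⟨j, -, rfl⟩ := List.mem_map.1 hx
    exact (Commute.one_right _).add_right (he.diagElt_comm i j)
  exact this

/-- For v = eᵢ, multiply the relation (eᵢ ⊗ eᵢ⁻¹)Ω = Ω on the left by 1 ⊗ eᵢ; the general case is
linear in v. -/
theorem IsOrthBasis.ι_mul_casimir (v : V) :
    (ιQ v ⊗ₜ[ℚ] 1) * casimir Q e (List.finRange r) =
      ((1 : Cliff Q) ⊗ₜ[ℚ] ιQ v) * casimir Q e (List.finRange r) := by
  have key : ∀ i, (ιQ (e i) ⊗ₜ[ℚ] 1) * casimir Q e (List.finRange r) =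
      ((1 : Cliff Q) ⊗ₜ[ℚ] ιQ (e i)) * casimir Q e (List.finRange r) := by
    intro i
    have h := he.diagElt_mul_casimir _ i (List.mem_finRange i)
    conv_rhs => rw [← h, ← mul_assoc]
    congr 1
    rw [diagElt, mul_smul_comm, Algebra.TensorProduct.tmul_mul_tmul, one_mul, ι_sq,
      Algebra.algebraMap_eq_smul_one, TensorProduct.tmul_smul, smul_smul,
      inv_mul_cancel₀ (he.ne_zero i), one_smul]
  rw [← e.sum_repr v]
  simp only [map_sum, map_smul, TensorProduct.sum_tmul, TensorProduct.tmul_sum, Finset.sum_mul,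
    ← TensorProduct.smul_tmul', TensorProduct.tmul_smul, smul_mul_assoc, key]

/-- The factors of a product are carried to the other side one at a time, beginning with the one
next to Ω; this reverses their order. -/
theorem IsOrthBasis.mul_casimir (c : Cliff Q) :
    (c ⊗ₜ[ℚ] 1) * casimir Q e (List.finRange r) =
      ((1 : Cliff Q) ⊗ₜ[ℚ] CliffordAlgebra.reverse c) * casimir Q e (List.finRange r) := by
  induction c using CliffordAlgebra.induction with
  | algebraMap a =>
    rw [CliffordAlgebra.reverse.commutes, Algebra.algebraMap_eq_smul_one,
      TensorProduct.smul_tmul]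
  | ι v => rw [CliffordAlgebra.reverse_ι, he.ι_mul_casimir]
  | mul x y hx hy =>
    have h1 : (x * y) ⊗ₜ[ℚ] (1 : Cliff Q) = (x ⊗ₜ 1) * (y ⊗ₜ 1) := by simp
    have h2 : (x ⊗ₜ[ℚ] (1 : Cliff Q)) * (1 ⊗ₜ CliffordAlgebra.reverse y) =
      (1 ⊗ₜ CliffordAlgebra.reverse y) * (x ⊗ₜ 1) := by simp
    rw [h1, mul_assoc, hy, ← mul_assoc, h2, mul_assoc, hx, ← mul_assoc,
      Algebra.TensorProduct.tmul_mul_tmul, one_mul, CliffordAlgebra.reverse.map_mul]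
  | add x y hx hy =>
    rw [TensorProduct.add_tmul, add_mul, hx, hy, map_add, TensorProduct.tmul_add, add_mul]

/-- Under x ⊗ y ↦ x reverse(y) every factor of the product contributes a factor 2. The purpose is to
see that Ω is not zero. -/
theorem IsOrthBasis.mulReverse_casimir (l : List (Fin r)) :
    mulReverse Q (casimir Q e l) = algebraMap ℚ _ (2 ^ l.length) := by
  induction l with
  | nil =>
    rw [casimir, List.map_nil, List.prod_nil, Algebra.TensorProduct.one_def, mulReverse_tmul,
      CliffordAlgebra.reverse.map_one]
    simp
  | cons i l ih =>
    rw [casimir, List.map_cons, List.prod_cons, ← casimir, add_mul, one_mul, map_add,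
      mulReverse_diagElt_mul, ih, ← Algebra.commutes, mul_assoc, ι_sq, ← map_mul,
      Algebra.smul_def, ← map_mul, ← map_add, List.length_cons]
    have := he.ne_zero i
    congr 1
    field_simp
    ring

theorem IsOrthBasis.casimir_ne_zero : casimir Q e (List.finRange r) ≠ 0 := by
  intro h
  have := he.mulReverse_casimir (List.finRange r)
  rw [h, map_zero, eq_comm, FaithfulSMul.algebraMap_eq_zero_iff] at this
  exact pow_ne_zero _ two_ne_zero this

/-- If (v ⊗ 1)Ω = 0, then (vw ⊗ 1)Ω = (1 ⊗ w)(v ⊗ 1)Ω = 0 and (wv ⊗ 1)Ω = 0. Adding gives 2Q(v, w)Ω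
= 0 for every w. -/
theorem IsOrthBasis.eq_zero_of_mul_casimir {v : V}
    (h : (ιQ v ⊗ₜ[ℚ] (1 : Cliff Q)) * casimir Q e (List.finRange r) = 0) : v = 0 := by
  have key : ∀ w, Q v w = 0 := by
    intro w
    have h1 : (ιQ v ⊗ₜ[ℚ] (1 : Cliff Q)) * ((ιQ w ⊗ₜ[ℚ] (1 : Cliff Q)) *
        casimir Q e (List.finRange r)) = 0 := by
      have hc : (ιQ v ⊗ₜ[ℚ] (1 : Cliff Q)) * (1 ⊗ₜ ιQ w) = (1 ⊗ₜ ιQ w) * (ιQ v ⊗ₜ 1) := by simp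
      rw [he.ι_mul_casimir, ← mul_assoc, hc, mul_assoc, h, mul_zero]
    have h2 : (ιQ w ⊗ₜ[ℚ] (1 : Cliff Q)) * ((ιQ v ⊗ₜ[ℚ] (1 : Cliff Q)) *
        casimir Q e (List.finRange r)) = 0 := by rw [h, mul_zero]
    have h3 := congrArg₂ (· + ·) h1 h2
    simp only [← mul_assoc, Algebra.TensorProduct.tmul_mul_tmul, mul_one, add_zero] at h3
    rw [← add_mul, ← TensorProduct.add_tmul, CliffordAlgebra.ι_mul_ι_add_swap,
      LinearMap.BilinMap.polar_toQuadraticMap, he.symm w v, ← two_mul,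
      Algebra.algebraMap_eq_smul_one, ← TensorProduct.smul_tmul',
      ← Algebra.TensorProduct.one_def, smul_mul_assoc, one_mul] at h3
    have := (smul_eq_zero.1 h3).resolve_right he.casimir_ne_zero
    linarith
  rw [← e.sum_repr v]
  refine Finset.sum_eq_zero fun i _ => ?_
  have := key (e i)
  rw [← e.sum_repr v, map_sum, LinearMap.sum_apply, Finset.sum_eq_single i] at this
  · rw [map_smul, LinearMap.smul_apply, smul_eq_mul] at this
    rw [(mul_eq_zero.1 this).resolve_right (he.ne_zero i), zero_smul]
  · intro j _ hj
    rw [map_smul, LinearMap.smul_apply, he.ortho j i hj, smul_zero]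
  · simp

/-- The right factor reverse(d) ⊗ 1 meets Ω and becomes 1 ⊗ d, which commutes with everything to its
left. -/
theorem IsOrthBasis.embedCliff_mul (w : V) (c d : EvenCliff Q) (x : Cliff Q) :
    embedCliff e w ((c : Cliff Q) * x * CliffordAlgebra.reverse (d : Cliff Q)) =
      (c ⊗ₜ d) * embedCliff e w x := by
  rw [embedCliff_apply, embedCliff_apply, ← map_evenPart_mul]
  congr 1
  have h1 : (((c : Cliff Q) * x * CliffordAlgebra.reverse (d : Cliff Q)) ⊗ₜ[ℚ] (1 : Cliff Q)) =
      ((c : Cliff Q) ⊗ₜ 1) * (x ⊗ₜ 1) * (CliffordAlgebra.reverse (d : Cliff Q) ⊗ₜ 1) := by simp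
  have h2 : ((c : Cliff Q) ⊗ₜ[ℚ] (d : Cliff Q)) * (x ⊗ₜ 1) =
      ((c : Cliff Q) ⊗ₜ 1) * (x ⊗ₜ 1) * (1 ⊗ₜ (d : Cliff Q)) := by simp
  rw [h1, mul_assoc, ← mul_assoc (CliffordAlgebra.reverse (d : Cliff Q) ⊗ₜ 1), he.mul_casimir,
    CliffordAlgebra.reverse_reverse]
  simp only [← mul_assoc, h2]

/-- Ω is a sum of multiples of e_I ⊗ e_I, and the factor w = e i₀ gives v e_I w the parity of e_I;
without it no term would be even on both sides. The projection to the even parts therefore keeps ½(v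
⊗ 1)(Ω + Ω')(w ⊗ 1), where Ω' is Ω with the signs (-1)^|I|. It remains to separate Ω from Ω'. -/
theorem IsOrthBasis.embedCliff_ι_injective {i₀ : Fin r} :
    Function.Injective (embedCliff e (e i₀) ∘ₗ ιQ) := by
  rw [← LinearMap.ker_eq_bot, LinearMap.ker_eq_bot']
  intro v hv
  apply he.eq_zero_of_mul_casimir
  set Ω := casimir Q e (List.finRange r) with hΩ
  set a₁ : Cliff Q ⊗[ℚ] Cliff Q →ₐ[ℚ] Cliff Q ⊗[ℚ] Cliff Q :=
    Algebra.TensorProduct.map CliffordAlgebra.involute (AlgHom.id ℚ _) with ha₁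
  set a₂ : Cliff Q ⊗[ℚ] Cliff Q →ₐ[ℚ] Cliff Q ⊗[ℚ] Cliff Q :=
    Algebra.TensorProduct.map (AlgHom.id ℚ _) CliffordAlgebra.involute with ha₂
  have hE₁ : ∀ i, a₁ (diagElt Q e i) = -diagElt Q e i := fun i => by
    simp [ha₁, diagElt, TensorProduct.neg_tmul]
  have hE₂ : ∀ i, a₂ (diagElt Q e i) = -diagElt Q e i := fun i => by
    simp [ha₂, diagElt, TensorProduct.tmul_neg]
  have h12 : a₁ Ω = a₂ Ω := by
    simp only [hΩ, casimir, map_list_prod, List.map_map]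
    congr 2
    ext i
    simp only [Function.comp_apply, map_add, map_one, hE₁, hE₂]
  have h22 : a₂ (a₂ Ω) = Ω := by
    simp only [hΩ, casimir, map_list_prod, List.map_map]
    congr 2
    ext i
    simp only [Function.comp_apply, map_add, map_one, map_neg, hE₂, neg_neg]
  set Z := (ιQ v ⊗ₜ[ℚ] (1 : Cliff Q)) * (Ω * (ιQ (e i₀) ⊗ₜ[ℚ] 1)) with hZ
  have hincl : ∀ z, TensorProduct.map (EvenCliff Q).val.toLinearMap (EvenCliff Q).val.toLinearMap
      (TensorProduct.map (evenPart Q) (evenPart Q) z) =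
        (4⁻¹ : ℚ) • (z + a₁ z + a₂ z + a₁ (a₂ z)) := by
    intro z
    induction z using TensorProduct.induction_on with
    | zero => simp
    | add x y hx hy => simp only [map_add, hx, hy]; module
    | tmul x y =>
      simp only [TensorProduct.map_tmul, AlgHom.toLinearMap_apply, Subalgebra.coe_val,
        evenPart_coe, ha₁, ha₂, Algebra.TensorProduct.map_tmul, AlgHom.id_apply,
        TensorProduct.smul_tmul_smul, TensorProduct.add_tmul, TensorProduct.tmul_add]
      module
  have h0 := hincl Z
  have hv' : TensorProduct.map (evenPart Q) (evenPart Q) Z = 0 := hv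
  have hv1 : a₁ (ιQ v ⊗ₜ[ℚ] (1 : Cliff Q)) = -(ιQ v ⊗ₜ[ℚ] (1 : Cliff Q)) := by
    simp [ha₁, TensorProduct.neg_tmul]
  have hv2 : a₂ (ιQ v ⊗ₜ[ℚ] (1 : Cliff Q)) = (ιQ v ⊗ₜ[ℚ] (1 : Cliff Q)) := by simp [ha₂]
  have hw1 : a₁ (ιQ (e i₀) ⊗ₜ[ℚ] (1 : Cliff Q)) = -(ιQ (e i₀) ⊗ₜ[ℚ] (1 : Cliff Q)) := by
    simp [ha₁, TensorProduct.neg_tmul]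
  have hw2 : a₂ (ιQ (e i₀) ⊗ₜ[ℚ] (1 : Cliff Q)) = (ιQ (e i₀) ⊗ₜ[ℚ] (1 : Cliff Q)) := by simp [ha₂]
  have h21 : a₁ (a₂ Ω) = Ω := by
    simp only [hΩ, casimir, map_list_prod, List.map_map]
    congr 2
    ext i
    simp only [Function.comp_apply, map_add, map_one, map_neg, hE₂, hE₁, neg_neg]
  set X := (ιQ v ⊗ₜ[ℚ] (1 : Cliff Q)) with hX
  set Y := (ιQ (e i₀) ⊗ₜ[ℚ] (1 : Cliff Q)) with hY
  rw [hv', map_zero, hZ] at h0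
  simp only [map_mul, hv1, hv2, hw1, hw2, h12, h21, mul_neg, neg_mul, neg_neg] at h0
  have hYY : Y * Y = Q (e i₀) (e i₀) • 1 := by
    rw [hY, Algebra.TensorProduct.tmul_mul_tmul, ι_sq, Algebra.algebraMap_eq_smul_one, mul_one,
      ← TensorProduct.smul_tmul', ← Algebra.TensorProduct.one_def]
  have h1 : X * (Ω + a₂ Ω) = 0 := by
    have : (Q (e i₀) (e i₀)) • (X * (Ω + a₂ Ω)) = 0 := by
      have h2 : X * (Ω * Y) + X * (a₂ Ω * Y) = 0 := by
        have h3 := congrArg (fun t => (2 : ℚ) • t) h0.symm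
        simp only [smul_zero] at h3
        rw [← h3]
        module
      have h3 := congrArg (· * Y) h2
      simp only [add_mul, mul_assoc, hYY, zero_mul, mul_smul_comm, mul_one] at h3
      rw [mul_add, smul_add, h3]
    exact (smul_eq_zero.1 this).resolve_left (he.ne_zero i₀)
  -- Right multiplication by eᵢ ⊗ eᵢ⁻¹ with i = `i₀` fixes Ω and negates `a₂ Ω`, so the vanishing of
  -- X(Ω + a₂Ω) also gives that of X(Ω - a₂Ω).
  have hΩE : Ω * diagElt Q e i₀ = Ω := by
    rw [← he.casimir_comm, he.diagElt_mul_casimir _ _ (List.mem_finRange _)]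
  have hΩE2 : a₂ Ω * diagElt Q e i₀ = -a₂ Ω := by
    have := congrArg a₂ hΩE
    rw [map_mul, hE₂, mul_neg] at this
    rw [← neg_eq_iff_eq_neg, this]
  have h4 : X * (Ω - a₂ Ω) = 0 := by
    have h5 := congrArg (· * diagElt Q e i₀) h1
    simp only [zero_mul, mul_assoc, add_mul, hΩE, hΩE2] at h5
    rwa [sub_eq_add_neg]
  have h6 : (2 : ℚ) • (X * Ω) = 0 := by
    have := congrArg₂ (· + ·) h1 h4
    simp only [add_zero] at this
    rw [← this, mul_add, mul_sub]
    module
  exact (smul_eq_zero.1 h6).resolve_left two_ne_zero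

theorem IsOrthBasis.embedCliff_baseChange_mul (w : V) (c d : ℝ ⊗[ℚ] EvenCliff Q)
    (x : ℝ ⊗[ℚ] Cliff Q) :
    TensorProduct.AlgebraTensorModule.distribBaseChange ℚ ℝ (EvenCliff Q) (EvenCliff Q)
      ((embedCliff e w).baseChange ℝ (evenIncl Q ℝ c * x * reverseA Q ℝ (evenIncl Q ℝ d))) =
    TensorProduct.map (LinearMap.mulLeft ℝ c) (LinearMap.mulLeft ℝ d)
      (TensorProduct.AlgebraTensorModule.distribBaseChange ℚ ℝ (EvenCliff Q) (EvenCliff Q)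
        ((embedCliff e w).baseChange ℝ x)) :=
  distribBaseChange_of_mul (EvenCliff Q).val CliffordAlgebra.reverse (embedCliff e w)
    (he.embedCliff_mul w) c d x

end Embedding

/-! ### The embedding as a morphism of Hodge structures -/

section HodgeEmbedding

variable {V : Type*} [AddCommGroup V] [Module ℚ V] [FiniteDimensional ℚ V] {H : HodgeStructure V 2}
  {Q : LinearMap.BilinForm ℚ V}

theorem IsK3Type.exists_embedding (hQ : IsK3Type H Q) :
    ∃ f : V →ₗ[ℚ] EvenCliff Q ⊗[ℚ] EvenCliff Q, Function.Injective f ∧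
      IsHodgeMorphism H ((kugaSatake hQ).tensor (kugaSatake hQ)) f := by
  obtain ⟨r, e, he⟩ := hQ.exists_orthBasis
  -- A basis vector is needed as the auxiliary vector w; V is not zero because Q(f₁, f₁) = -1.
  have hr : Nonempty (Fin r) := by
    by_contra hr
    rw [not_nonempty_iff] at hr
    have hV : Subsingleton V := e.repr.toEquiv.subsingleton
    obtain ⟨f₁, f₂, hf⟩ := exists_frame hQ
    have := hf.norm
    rw [Subsingleton.elim f₁ 0] at this
    simp at this
  obtain ⟨i₀⟩ := hr
  refine ⟨_, he.embedCliff_ι_injective (i₀ := i₀), fun z x => ?_⟩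
  rw [LinearMap.baseChange_comp, LinearMap.comp_apply, LinearMap.comp_apply]
  change (embedCliff e (e i₀)).baseChange ℝ (vecIncl Q ℝ _) =
    (tensorRep _ _ z).val ((embedCliff e (e i₀)).baseChange ℝ (vecIncl Q ℝ _))
  rw [← ksUnit_conj hQ]
  have h := he.embedCliff_baseChange_mul (e i₀) (ksUnit hQ z).val (ksUnit hQ z).val
    (vecIncl Q ℝ x)
  exact (LinearEquiv.eq_symm_apply _).2 h

end HodgeEmbedding

end

end KugaSatake


namespace KugaSatake

noncomputable section

/-! ### Change of scalars -/

section ChangeScalars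

variable {A B : Type*} [CommRing A] [Algebra ℚ A] [CommRing B] [Algebra ℚ B] (φ : A →ₐ[ℚ] B)
  (U : Type*) [AddCommGroup U] [Module ℚ U]

/-- The map `A ⊗ U → B ⊗ U` induced by `φ : A → B`. -/
def scalarMap : A ⊗[ℚ] U →ₗ[ℚ] B ⊗[ℚ] U := φ.toLinearMap.rTensor U

variable {U}

@[simp] theorem scalarMap_tmul (a : A) (u : U) : scalarMap φ U (a ⊗ₜ u) = φ a ⊗ₜ u := rfl

theorem scalarMap_smul (a : A) (x : A ⊗[ℚ] U) :
    scalarMap φ U (a • x) = φ a • scalarMap φ U x := by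
  induction x using TensorProduct.induction_on with
  | zero => simp
  | add x y hx hy => rw [smul_add, map_add, map_add, smul_add, hx, hy]
  | tmul b u => simp [TensorProduct.smul_tmul']

theorem scalarMap_baseChange {U' : Type*} [AddCommGroup U'] [Module ℚ U'] (f : U →ₗ[ℚ] U')
    (x : A ⊗[ℚ] U) :
    scalarMap φ U' (f.baseChange A x) = f.baseChange B (scalarMap φ U x) := by
  induction x using TensorProduct.induction_on with
  | zero => simp
  | add x y hx hy => simp only [map_add, hx, hy]
  | tmul b u => simp

theorem scalarMap_mul {E : Type*} [Ring E] [Algebra ℚ E] (x y : A ⊗[ℚ] E) :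
    scalarMap φ E (x * y) = scalarMap φ E x * scalarMap φ E y :=
  map_mul (Algebra.TensorProduct.map φ (AlgHom.id ℚ E)) x y

theorem repr_scalarMap {ι : Type*} [Finite ι] (b : Module.Basis ι ℚ U) (x : A ⊗[ℚ] U) (i : ι) :
    (b.baseChange B).repr (scalarMap φ U x) i = φ ((b.baseChange A).repr x i) := by
  induction x using TensorProduct.induction_on with
  | zero => simp
  | add x y hx hy => simp only [map_add, Finsupp.add_apply, hx, hy]
  | tmul a u => simp [Module.Basis.baseChange_repr_tmul]

/-- The map `A ⊗ U → A` induced by a linear functional. -/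
def functional (A : Type*) [CommRing A] [Algebra ℚ A] (l : U →ₗ[ℚ] ℚ) : A ⊗[ℚ] U →ₗ[A] A :=
  (TensorProduct.AlgebraTensorModule.rid ℚ A A).toLinearMap ∘ₗ LinearMap.baseChange A l

theorem functional_tmul (l : U →ₗ[ℚ] ℚ) (a : A) (u : U) :
    functional A l (a ⊗ₜ u) = l u • a := by simp [functional]

theorem functional_scalarMap (l : U →ₗ[ℚ] ℚ) (x : A ⊗[ℚ] U) :
    functional B l (scalarMap φ U x) = φ (functional A l x) := by
  induction x using TensorProduct.induction_on with
  | zero => simp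
  | add x y hx hy => simp only [map_add, hx, hy]
  | tmul a u => rw [scalarMap_tmul, functional_tmul, functional_tmul, map_smul]

theorem eq_zero_of_functional {x : A ⊗[ℚ] U} (h : ∀ l, functional A l x = 0) : x = 0 := by
  set b := Module.Free.chooseBasis ℚ U
  apply (b.baseChange A).repr.injective
  ext i
  rw [map_zero, Finsupp.zero_apply, ← h (b.coord i)]
  induction x using TensorProduct.induction_on with
  | zero => simp
  | add x y hx hy =>
    simp only [map_add, Finsupp.add_apply]
    have key : ∀ z, (b.baseChange A).repr z i = functional A (b.coord i) z := by
      intro z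
      induction z using TensorProduct.induction_on with
      | zero => simp
      | add x y hx hy => simp only [map_add, Finsupp.add_apply, hx, hy]
      | tmul a u => simp [functional_tmul, Module.Basis.baseChange_repr_tmul]
    rw [key, key]
  | tmul a u => simp [functional_tmul, Module.Basis.baseChange_repr_tmul]

/-- Tensoring with `A` keeps the sequence U' → U → U/im f → 0 exact, and elements of A ⊗ (U/im f)
are detected by rational functionals. Lying in the image thus becomes a system of rational linear
equations. -/
theorem exists_baseChange_iff {U' : Type*} [AddCommGroup U'] [Module ℚ U'] (f : U' →ₗ[ℚ] U)
    (x : A ⊗[ℚ] U) :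
    (∃ w, x = f.baseChange A w) ↔ ∀ l : U →ₗ[ℚ] ℚ, l ∘ₗ f = 0 → functional A l x = 0 := by
  constructor
  · rintro ⟨w, rfl⟩ l hl
    rw [functional, LinearMap.comp_apply, ← LinearMap.comp_apply (LinearMap.baseChange A l),
      ← LinearMap.baseChange_comp, hl]
    simp
  · intro h
    have hex : Function.Exact f (LinearMap.range f).mkQ := by
      rw [LinearMap.exact_iff, Submodule.ker_mkQ]
    have := (lTensor_exact A hex (Submodule.mkQ_surjective _) x).1 (by
      apply eq_zero_of_functional
      intro l
      rw [← h (l ∘ₗ (LinearMap.range f).mkQ)]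
      · simp only [functional, LinearMap.comp_apply, LinearMap.baseChange_comp]
        rfl
      · rw [LinearMap.comp_assoc, LinearMap.range_mkQ_comp, LinearMap.comp_zero])
    obtain ⟨w, hw⟩ := this
    exact ⟨w, hw.symm⟩

end ChangeScalars

/-! ### The coordinates on `GL(W)` -/

section Coordinates

variable (W : Type*) [AddCommGroup W] [Module ℚ W]

/-- The polynomial ring in the coordinates of `GL(W)`. -/
abbrev CoordRing (W : Type*) [AddCommGroup W] [Module ℚ W] :=
  MvPolynomial (Option (Module.Free.ChooseBasisIndex ℚ W × Module.Free.ChooseBasisIndex ℚ W)) ℚ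

section

variable {W} {A : Type} [CommRing A] [Algebra ℚ A]

/-- The evaluation of polynomials at a point of `GL(W)`. -/
def evalAt (g : LinearMap.GeneralLinearGroup A (A ⊗[ℚ] W)) : CoordRing W →ₐ[ℚ] A :=
  MvPolynomial.aeval (glCoord g)

theorem evalAt_none (g : LinearMap.GeneralLinearGroup A (A ⊗[ℚ] W)) :
    evalAt g (MvPolynomial.X none) = LinearMap.det (g⁻¹).val := by
  rw [evalAt, MvPolynomial.aeval_X]
  rfl

theorem det_inv_mul_det (g : LinearMap.GeneralLinearGroup A (A ⊗[ℚ] W)) :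
    LinearMap.det (g⁻¹).val * LinearMap.det g.val = 1 := by
  rw [← map_mul, ← Units.val_mul, inv_mul_cancel, Units.val_one, map_one]

end

section

variable {W} {A B : Type} [CommRing A] [Algebra ℚ A] [CommRing B] [Algebra ℚ B]

/-- `g'` is the extension of scalars of `g` along `φ`. -/
def IsExtension (φ : A →ₐ[ℚ] B) (g : LinearMap.GeneralLinearGroup A (A ⊗[ℚ] W))
    (g' : LinearMap.GeneralLinearGroup B (B ⊗[ℚ] W)) : Prop :=
  ∀ x, g'.val (scalarMap φ W x) = scalarMap φ W (g.val x)

theorem IsExtension.inv {φ : A →ₐ[ℚ] B} {g : LinearMap.GeneralLinearGroup A (A ⊗[ℚ] W)}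
    {g' : LinearMap.GeneralLinearGroup B (B ⊗[ℚ] W)} (h : IsExtension φ g g') :
    IsExtension φ g⁻¹ g'⁻¹ := by
  intro x
  have h1 := h ((g⁻¹).val x)
  rw [← Module.End.mul_apply, ← Units.val_mul, mul_inv_cancel, Units.val_one,
    Module.End.one_apply] at h1
  rw [← h1, ← Module.End.mul_apply, ← Units.val_mul, inv_mul_cancel, Units.val_one,
    Module.End.one_apply]

end

variable [FiniteDimensional ℚ W]

/-- The generic matrix. -/
def genMatrix : Matrix (Module.Free.ChooseBasisIndex ℚ W) (Module.Free.ChooseBasisIndex ℚ W)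
    (CoordRing W) :=
  Matrix.of fun i j => MvPolynomial.X (some (i, j))

/-- The inverse of the generic matrix. -/
def genMatrixInv : Matrix (Module.Free.ChooseBasisIndex ℚ W) (Module.Free.ChooseBasisIndex ℚ W)
    (CoordRing W) :=
  (MvPolynomial.X none : CoordRing W) • (genMatrix W).adjugate

/-- The generic endomorphism. -/
def genEnd : CoordRing W ⊗[ℚ] W →ₗ[CoordRing W] CoordRing W ⊗[ℚ] W :=
  Matrix.toLin ((Module.Free.chooseBasis ℚ W).baseChange _)
    ((Module.Free.chooseBasis ℚ W).baseChange _) (genMatrix W)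

/-- The inverse of the generic endomorphism. -/
def genInv : CoordRing W ⊗[ℚ] W →ₗ[CoordRing W] CoordRing W ⊗[ℚ] W :=
  Matrix.toLin ((Module.Free.chooseBasis ℚ W).baseChange _)
    ((Module.Free.chooseBasis ℚ W).baseChange _) (genMatrixInv W)

variable {W} {A B : Type} [CommRing A] [Algebra ℚ A] [CommRing B] [Algebra ℚ B]

/-- The matrix of an endomorphism of `A ⊗ W`. -/
def mat (f : Module.End A (A ⊗[ℚ] W)) :
    Matrix (Module.Free.ChooseBasisIndex ℚ W) (Module.Free.ChooseBasisIndex ℚ W) A :=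
  LinearMap.toMatrix ((Module.Free.chooseBasis ℚ W).baseChange A)
    ((Module.Free.chooseBasis ℚ W).baseChange A) f

theorem mat_mul (f f' : Module.End A (A ⊗[ℚ] W)) : mat (f * f') = mat f * mat f' :=
  LinearMap.toMatrix_mul _ _ _

theorem mat_one : mat (1 : Module.End A (A ⊗[ℚ] W)) = 1 := LinearMap.toMatrix_one _

theorem det_mat (f : Module.End A (A ⊗[ℚ] W)) : (mat f).det = LinearMap.det f :=
  LinearMap.det_toMatrix _ _

theorem genMatrix_map (g : LinearMap.GeneralLinearGroup A (A ⊗[ℚ] W)) :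
    (genMatrix W).map (evalAt g) = mat g.val := by
  ext i j
  rw [Matrix.map_apply, genMatrix, Matrix.of_apply, evalAt, MvPolynomial.aeval_X, mat,
    LinearMap.toMatrix_apply]
  rfl

theorem evalAt_det (g : LinearMap.GeneralLinearGroup A (A ⊗[ℚ] W)) :
    evalAt g (genMatrix W).det = LinearMap.det g.val := by
  rw [AlgHom.map_det, AlgHom.mapMatrix_apply, genMatrix_map, det_mat]

/-- In the polynomial ring the variable `none` is not inverse to the determinant; the two generic
matrices become inverse only at points of GL. -/
theorem genMatrixInv_map (g : LinearMap.GeneralLinearGroup A (A ⊗[ℚ] W)) :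
    (genMatrixInv W).map (evalAt g) = mat (g⁻¹).val := by
  have h1 : (genMatrixInv W).map (evalAt g) =
      LinearMap.det (g⁻¹).val • (mat g.val).adjugate := by
    rw [← genMatrix_map, ← AlgHom.mapMatrix_apply (evalAt g) (genMatrix W), ← AlgHom.map_adjugate,
      ← evalAt_none]
    ext i j
    simp [genMatrixInv]
  have h2 : (genMatrixInv W).map (evalAt g) * mat g.val = 1 := by
    rw [h1, smul_mul_assoc, Matrix.adjugate_mul, det_mat, smul_smul, det_inv_mul_det, one_smul]
  have h3 : mat g.val * mat (g⁻¹).val = 1 := by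
    rw [← mat_mul, ← Units.val_mul, mul_inv_cancel, Units.val_one, mat_one]
  exact left_inv_eq_right_inv h2 h3

theorem scalarMap_toLin {R : Type*} [CommRing R] [Algebra ℚ R] (φ : R →ₐ[ℚ] A)
    (M : Matrix (Module.Free.ChooseBasisIndex ℚ W) (Module.Free.ChooseBasisIndex ℚ W) R)
    (f : Module.End A (A ⊗[ℚ] W)) (hM : M.map φ = mat f) (x : R ⊗[ℚ] W) :
    scalarMap φ W (Matrix.toLin ((Module.Free.chooseBasis ℚ W).baseChange R)
      ((Module.Free.chooseBasis ℚ W).baseChange R) M x) = f (scalarMap φ W x) := by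
  set b := Module.Free.chooseBasis ℚ W
  apply (b.baseChange A).repr.injective
  ext i
  have hf : f = Matrix.toLin (b.baseChange A) (b.baseChange A) (M.map φ) := by
    rw [hM, mat, Matrix.toLin_toMatrix]
  rw [repr_scalarMap, hf, Matrix.repr_toLin, Matrix.repr_toLin]
  simp only [Matrix.mulVec, dotProduct, map_sum, map_mul, repr_scalarMap, Matrix.map_apply]

theorem scalarMap_genEnd (g : LinearMap.GeneralLinearGroup A (A ⊗[ℚ] W))
    (x : CoordRing W ⊗[ℚ] W) :
    scalarMap (evalAt g) W (genEnd W x) = g.val (scalarMap (evalAt g) W x) :=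
  scalarMap_toLin _ _ _ (genMatrix_map g) x

theorem scalarMap_genInv (g : LinearMap.GeneralLinearGroup A (A ⊗[ℚ] W))
    (x : CoordRing W ⊗[ℚ] W) :
    scalarMap (evalAt g) W (genInv W x) = (g⁻¹).val (scalarMap (evalAt g) W x) :=
  scalarMap_toLin _ _ _ (genMatrixInv_map g) x

namespace IsExtension

variable {φ : A →ₐ[ℚ] B} {g : LinearMap.GeneralLinearGroup A (A ⊗[ℚ] W)}
    {g' : LinearMap.GeneralLinearGroup B (B ⊗[ℚ] W)}

theorem mat_map (h : IsExtension φ g g') : mat g'.val = (mat g.val).map φ := by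
  ext i j
  rw [Matrix.map_apply, mat, mat, LinearMap.toMatrix_apply, LinearMap.toMatrix_apply,
    ← repr_scalarMap, ← h]
  simp

theorem glCoord_eq (h : IsExtension φ g g') (c) : glCoord g' c = φ (glCoord g c) := by
  match c with
  | none =>
    change LinearMap.det _ = φ (LinearMap.det _)
    rw [← det_mat, h.inv.mat_map, ← det_mat, AlgHom.map_det]
    rfl
  | some (i, j) =>
    have := congrFun (congrFun h.mat_map i) j
    rw [Matrix.map_apply, mat, mat, LinearMap.toMatrix_apply, LinearMap.toMatrix_apply] at this
    exact this

theorem evalAt_eq (h : IsExtension φ g g') (P : CoordRing W) :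
    evalAt g' P = φ (evalAt g P) := by
  rw [evalAt, evalAt, ← AlgHom.comp_apply, MvPolynomial.comp_aeval]
  congr 2
  funext c
  exact h.glCoord_eq c

theorem mem {G : GroupFamily W} (hG : G.IsAlgebraic) (h : IsExtension φ g g') (hg : g ∈ G A) :
    g' ∈ G B := by
  obtain ⟨S, hS⟩ := hG
  refine (hS B g').2 fun P hP => ?_
  have := (hS A g).1 hg P hP
  change evalAt g P = 0 at this
  change evalAt g' P = 0
  rw [h.evalAt_eq, this, map_zero]

end IsExtension

/-- The equations have rational coefficients, so their values commute with every `φ i`, and a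
jointly injective family detects their vanishing. Below, the maps go to localizations of `A` or of a
quadratic extension of `A`. -/
theorem mem_of_extensions {G : GroupFamily W} (hG : G.IsAlgebraic) {ι : Type*} {B : ι → Type}
    [∀ i, CommRing (B i)] [∀ i, Algebra ℚ (B i)] (φ : ∀ i, A →ₐ[ℚ] B i)
    (hφ : ∀ a, (∀ i, φ i a = 0) → a = 0) {g : LinearMap.GeneralLinearGroup A (A ⊗[ℚ] W)}
    (h : ∀ i, ∃ g' ∈ G (B i), IsExtension (φ i) g g') : g ∈ G A := by
  obtain ⟨S, hS⟩ := hG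
  refine (hS A g).2 fun P hP => hφ _ fun i => ?_
  obtain ⟨g', hg', he⟩ := h i
  exact (he.evalAt_eq P).symm.trans ((hS _ g').1 hg' P hP)

/-- Every polynomial in the coordinates of `GL(W)`, multiplied by a power of the determinant, is a
polynomial in the matrix entries. -/
theorem exists_clear_det (P : CoordRing W) : ∃ (k : ℕ) (F : MvPolynomial
    (Module.Free.ChooseBasisIndex ℚ W × Module.Free.ChooseBasisIndex ℚ W) ℚ),
    ∀ (A : Type) [CommRing A] [Algebra ℚ A] (g : LinearMap.GeneralLinearGroup A (A ⊗[ℚ] W)),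
      MvPolynomial.aeval (fun p => mat g.val p.1 p.2) F =
        LinearMap.det g.val ^ k * evalAt g P := by
  set D : MvPolynomial (Module.Free.ChooseBasisIndex ℚ W × Module.Free.ChooseBasisIndex ℚ W) ℚ :=
    (Matrix.of fun i j => MvPolynomial.X (i, j)).det with hD
  have hDe : ∀ (A : Type) [CommRing A] [Algebra ℚ A]
      (g : LinearMap.GeneralLinearGroup A (A ⊗[ℚ] W)),
      MvPolynomial.aeval (fun p => mat g.val p.1 p.2) D = LinearMap.det g.val := by
    intro A _ _ g
    rw [hD, AlgHom.map_det, ← det_mat]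
    congr 1
    ext i j
    simp
  induction P using MvPolynomial.induction_on with
  | C c => exact ⟨0, MvPolynomial.C c, fun A _ _ g => by simp [evalAt]⟩
  | add P P' hP hP' =>
    obtain ⟨k, F, hF⟩ := hP
    obtain ⟨k', F', hF'⟩ := hP'
    refine ⟨k + k', D ^ k' * F + D ^ k * F', fun A _ _ g => ?_⟩
    rw [map_add, map_mul, map_mul, map_pow, map_pow, hDe, hF, hF', map_add]
    ring
  | mul_X P c hP =>
    obtain ⟨k, F, hF⟩ := hP
    match c with
    | none =>
      refine ⟨k + 1, F, fun A _ _ g => ?_⟩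
      rw [hF, map_mul, evalAt_none]
      linear_combination (-(LinearMap.det g.val ^ k * evalAt g P)) * det_inv_mul_det g
    | some (i, j) =>
      refine ⟨k, F * MvPolynomial.X (i, j), fun A _ _ g => ?_⟩
      rw [map_mul, hF, map_mul, MvPolynomial.aeval_X, ← genMatrix_map]
      simp only [Matrix.map_apply, genMatrix, Matrix.of_apply]
      ring

end Coordinates

end

end KugaSatake


namespace KugaSatake

noncomputable section

/-! ### `CSpin(Q)` as an algebraic group -/

section CSpinAlgebraic

variable {V : Type*} [AddCommGroup V] [Module ℚ V] {Q : LinearMap.BilinForm ℚ V}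

/-- The inclusion `C⁺(Q)_R → C(Q)_R`. -/
def evenInclusion (Q : LinearMap.BilinForm ℚ V) (R : Type*) [CommRing R] [Algebra ℚ R] :
    R ⊗[ℚ] EvenCliff Q →ₐ[R] R ⊗[ℚ] Cliff Q :=
  Algebra.TensorProduct.map (AlgHom.id R R) (EvenCliff Q).val

theorem scalarMap_evenInclusion {R : Type*} [CommRing R] [Algebra ℚ R] {A : Type} [CommRing A]
    [Algebra ℚ A] (φ : R →ₐ[ℚ] A) (x : R ⊗[ℚ] EvenCliff Q) :
    scalarMap φ _ (evenInclusion Q R x) = evenIncl Q A (scalarMap φ _ x) := by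
  induction x using TensorProduct.induction_on with
  | zero => simp
  | add x y hx hy => simp only [map_add, hx, hy]
  | tmul a x => rfl

theorem scalarMap_evenIncl {A B : Type} [CommRing A] [Algebra ℚ A] [CommRing B] [Algebra ℚ B]
    (φ : A →ₐ[ℚ] B) (x : A ⊗[ℚ] EvenCliff Q) :
    scalarMap φ _ (evenIncl Q A x) = evenIncl Q B (scalarMap φ _ x) :=
  scalarMap_evenInclusion φ x

theorem scalarMap_vecIncl {A B : Type} [CommRing A] [Algebra ℚ A] [CommRing B] [Algebra ℚ B]
    (φ : A →ₐ[ℚ] B) (x : A ⊗[ℚ] V) :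
    scalarMap φ _ (vecIncl Q A x) = vecIncl Q B (scalarMap φ _ x) :=
  scalarMap_baseChange φ _ x

/-- An element that conjugates the rational vectors into `V_A` conjugates all of them there. -/
theorem exists_conj_of_rational {A : Type} [CommRing A] [Algebra ℚ A] {x y : A ⊗[ℚ] Cliff Q}
    (h : ∀ v : V, ∃ w, x * vecIncl Q A (1 ⊗ₜ v) * y = vecIncl Q A w) (v : A ⊗[ℚ] V) :
    ∃ w, x * vecIncl Q A v * y = vecIncl Q A w := by
  induction v using TensorProduct.induction_on with
  | zero => exact ⟨0, by simp⟩
  | add v v' hv hv' =>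
    obtain ⟨w, hw⟩ := hv
    obtain ⟨w', hw'⟩ := hv'
    exact ⟨w + w', by rw [map_add, mul_add, add_mul, hw, hw', map_add]⟩
  | tmul a v =>
    obtain ⟨w, hw⟩ := h v
    refine ⟨a • w, ?_⟩
    have : a ⊗ₜ[ℚ] v = a • ((1 : A) ⊗ₜ[ℚ] v) := by
      rw [TensorProduct.smul_tmul', smul_eq_mul, mul_one]
    rw [this, map_smul, map_smul, mul_smul_comm, smul_mul_assoc, hw]

/-- An endomorphism commuting with right multiplications is left multiplication by its value at 1.
All conditions involve only rational x, y, v, so that they can become polynomial equations in `g`.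
-/
theorem mem_groupCSpin_iff {A : Type} [CommRing A] [Algebra ℚ A]
    (g : LinearMap.GeneralLinearGroup A (A ⊗[ℚ] EvenCliff Q)) :
    g ∈ groupCSpin Q A ↔
      (∀ x y : EvenCliff Q, g.val (1 ⊗ₜ (x * y)) = g.val (1 ⊗ₜ x) * (1 ⊗ₜ y)) ∧
      (∀ v : V, ∃ w, evenIncl Q A (g.val 1) * vecIncl Q A (1 ⊗ₜ v) * evenIncl Q A ((g⁻¹).val 1) =
        vecIncl Q A w) ∧
      (∀ v : V, ∃ w, evenIncl Q A ((g⁻¹).val 1) * vecIncl Q A (1 ⊗ₜ v) * evenIncl Q A (g.val 1) =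
        vecIncl Q A w) := by
  constructor
  · rintro ⟨u, hu, rfl⟩
    rw [← map_inv]
    simp only [sigma_apply, mul_one]
    refine ⟨fun x y => ?_, fun v => hu.1 _, fun v => hu.2 _⟩
    rw [mul_assoc, Algebra.TensorProduct.tmul_mul_tmul, one_mul]
  · rintro ⟨h1, h2, h3⟩
    have hmul : ∀ x, g.val x = g.val 1 * x := by
      intro x
      induction x using TensorProduct.induction_on with
      | zero => simp
      | add x y hx hy => rw [map_add, hx, hy, mul_add]
      | tmul a x =>
        have : a ⊗ₜ[ℚ] x = a • ((1 : A) ⊗ₜ[ℚ] x) := by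
          rw [TensorProduct.smul_tmul', smul_eq_mul, mul_one]
        rw [this, map_smul, mul_smul_comm]
        congr 1
        have := h1 1 x
        rwa [one_mul] at this
    have hgi : ∀ x, g.val ((g⁻¹).val x) = x := fun x => by
      rw [← Module.End.mul_apply, ← Units.val_mul, mul_inv_cancel, Units.val_one,
        Module.End.one_apply]
    have hig : ∀ x, (g⁻¹).val (g.val x) = x := fun x => by
      rw [← Module.End.mul_apply, ← Units.val_mul, inv_mul_cancel, Units.val_one,
        Module.End.one_apply]
    have e1 : g.val 1 * (g⁻¹).val 1 = 1 := by rw [← hmul, hgi]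
    have e2 : (g⁻¹).val 1 * g.val 1 = 1 := by
      have : g.val ((g⁻¹).val 1 * g.val 1) = g.val 1 := by
        rw [hmul, ← mul_assoc, e1, one_mul]
      rw [← hig ((g⁻¹).val 1 * g.val 1), this, hig]
    refine ⟨⟨g.val 1, (g⁻¹).val 1, e1, e2⟩, ⟨fun v => exists_conj_of_rational h2 v,
      fun v => exists_conj_of_rational h3 v⟩, ?_⟩
    apply Units.ext
    apply LinearMap.ext
    intro x
    rw [sigma_apply, ← hmul]

/-- The conditions of `mem_groupCSpin_iff` are written for the generic endomorphism, and rational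
functionals extract polynomials from them; lying in V_A means being killed by the functionals that
vanish on V. -/
theorem groupCSpin_isAlgebraic [FiniteDimensional ℚ (EvenCliff Q)] :
    (groupCSpin Q).IsAlgebraic := by
  set R := CoordRing (EvenCliff Q) with hR
  set u : R ⊗[ℚ] EvenCliff Q := genEnd _ 1 with hu
  set u' : R ⊗[ℚ] EvenCliff Q := genInv _ 1 with hu'
  set t₁ : EvenCliff Q → EvenCliff Q → R ⊗[ℚ] EvenCliff Q := fun x y =>
    genEnd _ (1 ⊗ₜ (x * y)) - genEnd _ (1 ⊗ₜ x) * (1 ⊗ₜ y) with ht₁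
  set t₂ : V → R ⊗[ℚ] Cliff Q := fun v => evenInclusion Q R u *
    (1 ⊗ₜ CliffordAlgebra.ι _ v) * evenInclusion Q R u' with ht₂
  set t₃ : V → R ⊗[ℚ] Cliff Q := fun v => evenInclusion Q R u' *
    (1 ⊗ₜ CliffordAlgebra.ι _ v) * evenInclusion Q R u with ht₃
  refine ⟨{P | ∃ x y l, P = functional R l (t₁ x y)} ∪
    ({P | ∃ v l, l ∘ₗ CliffordAlgebra.ι _ = 0 ∧ P = functional R l (t₂ v)} ∪
      {P | ∃ v l, l ∘ₗ CliffordAlgebra.ι _ = 0 ∧ P = functional R l (t₃ v)}), ?_⟩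
  intro A _ _ g
  have s1 : ∀ x y, scalarMap (evalAt g) _ (t₁ x y) =
      g.val (1 ⊗ₜ (x * y)) - g.val (1 ⊗ₜ x) * (1 ⊗ₜ y) := by
    intro x y
    simp only [ht₁, map_sub, scalarMap_mul, scalarMap_genEnd, scalarMap_tmul, map_one]
  have su : scalarMap (evalAt g) _ u = g.val 1 := by
    rw [hu, scalarMap_genEnd, Algebra.TensorProduct.one_def, scalarMap_tmul, map_one]; rfl
  have su' : scalarMap (evalAt g) _ u' = (g⁻¹).val 1 := by
    rw [hu', scalarMap_genInv, Algebra.TensorProduct.one_def, scalarMap_tmul, map_one]; rfl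
  have iu : scalarMap (evalAt g) _ (evenInclusion Q R u) = evenIncl Q A (g.val 1) := by
    rw [← su]; exact scalarMap_evenInclusion _ _
  have iu' : scalarMap (evalAt g) _ (evenInclusion Q R u') = evenIncl Q A ((g⁻¹).val 1) := by
    rw [← su']; exact scalarMap_evenInclusion _ _
  have s2 : ∀ v, scalarMap (evalAt g) _ (t₂ v) =
      evenIncl Q A (g.val 1) * vecIncl Q A (1 ⊗ₜ v) * evenIncl Q A ((g⁻¹).val 1) := by
    intro v
    simp only [ht₂, scalarMap_mul, iu, iu', scalarMap_tmul, map_one, vecIncl_tmul]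
  have s3 : ∀ v, scalarMap (evalAt g) _ (t₃ v) =
      evenIncl Q A ((g⁻¹).val 1) * vecIncl Q A (1 ⊗ₜ v) * evenIncl Q A (g.val 1) := by
    intro v
    simp only [ht₃, scalarMap_mul, iu, iu', scalarMap_tmul, map_one, vecIncl_tmul]
  rw [mem_groupCSpin_iff]
  change _ ↔ ∀ P ∈ _, evalAt g P = 0
  constructor
  · rintro ⟨h1, h2, h3⟩ P (⟨x, y, l, rfl⟩ | ⟨v, l, hl, rfl⟩ | ⟨v, l, hl, rfl⟩)
    · rw [← functional_scalarMap, s1, h1, sub_self, map_zero]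
    · rw [← functional_scalarMap, s2]
      exact (exists_baseChange_iff _ _).1 (h2 v) l hl
    · rw [← functional_scalarMap, s3]
      exact (exists_baseChange_iff _ _).1 (h3 v) l hl
  · intro h
    refine ⟨fun x y => ?_, fun v => ?_, fun v => ?_⟩
    · rw [← sub_eq_zero, ← s1]
      apply eq_zero_of_functional
      intro l
      rw [functional_scalarMap]
      exact h _ (Or.inl ⟨x, y, l, rfl⟩)
    · refine (exists_baseChange_iff _ _).2 fun l hl => ?_
      rw [← s2, functional_scalarMap]
      exact h _ (Or.inr (Or.inl ⟨v, l, hl, rfl⟩))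
    · refine (exists_baseChange_iff _ _).2 fun l hl => ?_
      rw [← s3, functional_scalarMap]
      exact h _ (Or.inr (Or.inr ⟨v, l, hl, rfl⟩))

variable {A B : Type} [CommRing A] [Algebra ℚ A] [CommRing B] [Algebra ℚ B] (φ : A →ₐ[ℚ] B)

/-- Extension of scalars of units of `C⁺(Q)_A`. -/
def unitsMap (Q : LinearMap.BilinForm ℚ V) :
    (A ⊗[ℚ] EvenCliff Q)ˣ →* (B ⊗[ℚ] EvenCliff Q)ˣ :=
  Units.map (Algebra.TensorProduct.map φ (AlgHom.id ℚ (EvenCliff Q)) : _ →* _)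

theorem unitsMap_val (u : (A ⊗[ℚ] EvenCliff Q)ˣ) :
    (unitsMap φ Q u).val = scalarMap φ _ u.val := rfl

theorem sigma_unitsMap [FiniteDimensional ℚ (EvenCliff Q)] (u : (A ⊗[ℚ] EvenCliff Q)ˣ) :
    IsExtension φ (sigma Q A u) (sigma Q B (unitsMap φ Q u)) := by
  intro x
  rw [sigma_apply, sigma_apply, unitsMap_val, scalarMap_mul]

theorem unitsMap_mem_cspinUnits {u : (A ⊗[ℚ] EvenCliff Q)ˣ} (hu : u ∈ cspinUnits Q A) :
    unitsMap φ Q u ∈ cspinUnits Q B := by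
  constructor
  · refine exists_conj_of_rational fun v => ?_
    obtain ⟨w, hw⟩ := hu.1 (1 ⊗ₜ v)
    refine ⟨scalarMap φ _ w, ?_⟩
    rw [← map_inv, unitsMap_val, unitsMap_val, ← scalarMap_vecIncl, ← hw, scalarMap_mul,
      scalarMap_mul, scalarMap_evenIncl, scalarMap_evenIncl, scalarMap_vecIncl, scalarMap_tmul,
      map_one]
  · refine exists_conj_of_rational fun v => ?_
    obtain ⟨w, hw⟩ := hu.2 (1 ⊗ₜ v)
    refine ⟨scalarMap φ _ w, ?_⟩
    rw [← map_inv, unitsMap_val, unitsMap_val, ← scalarMap_vecIncl, ← hw, scalarMap_mul,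
      scalarMap_mul, scalarMap_evenIncl, scalarMap_evenIncl, scalarMap_vecIncl, scalarMap_tmul,
      map_one]

theorem rho_unitsMap (u : cspinUnits Q A) (x : A ⊗[ℚ] V) :
    (rho Q B ⟨_, unitsMap_mem_cspinUnits φ u.2⟩).val (scalarMap φ V x) =
      scalarMap φ V ((rho Q A u).val x) := by
  apply vecIncl_injective Q B
  rw [rho_apply, ← scalarMap_vecIncl, ← scalarMap_vecIncl, rho_apply, scalarMap_mul, scalarMap_mul,
    scalarMap_evenIncl, scalarMap_evenIncl]
  rfl

end CSpinAlgebraic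

end

end KugaSatake


namespace KugaSatake

noncomputable section

/-! ### Zariski closures of families of subgroups -/

section Separation

variable {U U' : Type*} [AddCommGroup U] [Module ℚ U] [AddCommGroup U'] [Module ℚ U']

theorem eq_zero_of_rTensor {ι : Sort*} {M : ι → Type*} [∀ i, AddCommGroup (M i)]
    [∀ i, Module ℚ (M i)] (f : ∀ i, U →ₗ[ℚ] M i) (hf : ∀ u, (∀ i, f i u = 0) → u = 0)
    {t : U ⊗[ℚ] U'} (h : ∀ i, (f i).rTensor U' t = 0) : t = 0 := by
  set b := Module.Free.chooseBasis ℚ U'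
  have key : ∀ (i : ι) (x : U ⊗[ℚ] U') (k), TensorProduct.equivFinsuppOfBasisRight b
      ((f i).rTensor U' x) k = f i (TensorProduct.equivFinsuppOfBasisRight b x k) := by
    intro i x k
    induction x using TensorProduct.induction_on with
    | zero => simp
    | add x y hx hy => simp only [map_add, Finsupp.add_apply, hx, hy]
    | tmul u u' => simp
  apply (TensorProduct.equivFinsuppOfBasisRight b).injective
  ext k
  rw [map_zero, Finsupp.zero_apply]
  refine hf _ fun i => ?_
  rw [← key, h, map_zero, Finsupp.zero_apply]

/-- Over a field, a family that separates the elements of U separates tensors one factor at a time,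
by expanding in a basis of the other factor. -/
theorem eq_zero_of_map {ι : Sort*} {M : ι → Type*} [∀ i, AddCommGroup (M i)]
    [∀ i, Module ℚ (M i)] (f : ∀ i, U →ₗ[ℚ] M i) (hf : ∀ u, (∀ i, f i u = 0) → u = 0)
    {t : U ⊗[ℚ] U} (h : ∀ i j, TensorProduct.map (f i) (f j) t = 0) : t = 0 := by
  refine eq_zero_of_rTensor f hf fun i => ?_
  apply (TensorProduct.comm ℚ (M i) U).injective
  rw [map_zero]
  refine eq_zero_of_rTensor f hf fun j => ?_
  apply (TensorProduct.comm ℚ (M j) (M i)).injective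
  rw [map_zero, ← h i j]
  clear h
  induction t using TensorProduct.induction_on with
  | zero => simp
  | add x y hx hy => simp only [map_add, hx, hy]
  | tmul u u' => simp

end Separation

/-! ### The Zariski closure is a group: comultiplication and antipode -/

section Closure

theorem evalAt_X {W : Type*} [AddCommGroup W] [Module ℚ W] {A : Type} [CommRing A] [Algebra ℚ A]
    (g : LinearMap.GeneralLinearGroup A (A ⊗[ℚ] W)) (c) :
    evalAt g (MvPolynomial.X c) = glCoord g c := MvPolynomial.aeval_X _ _

variable {W : Type*} [AddCommGroup W] [Module ℚ W] [FiniteDimensional ℚ W]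

/-- The comultiplication. -/
def comult (W : Type*) [AddCommGroup W] [Module ℚ W] [FiniteDimensional ℚ W] :
    CoordRing W →ₐ[ℚ] CoordRing W ⊗[ℚ] CoordRing W :=
  MvPolynomial.aeval fun c => match c with
    | none => (MvPolynomial.X none) ⊗ₜ (MvPolynomial.X none)
    | some (i, j) => ∑ k, (MvPolynomial.X (some (i, k))) ⊗ₜ (MvPolynomial.X (some (k, j)))

/-- The antipode. -/
def antipode (W : Type*) [AddCommGroup W] [Module ℚ W] [FiniteDimensional ℚ W] :
    CoordRing W →ₐ[ℚ] CoordRing W :=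
  MvPolynomial.aeval fun c => match c with
    | none => (genMatrix W).det
    | some (i, j) => genMatrixInv W i j

variable {A : Type} [CommRing A] [Algebra ℚ A]

theorem glCoord_some (g : LinearMap.GeneralLinearGroup A (A ⊗[ℚ] W)) (i j) :
    glCoord g (some (i, j)) = mat g.val i j := by
  rw [mat, LinearMap.toMatrix_apply]
  rfl

theorem evalAt_mul (g g' : LinearMap.GeneralLinearGroup A (A ⊗[ℚ] W)) (P : CoordRing W) :
    evalAt (g * g') P =
      Algebra.TensorProduct.productMap (evalAt g) (evalAt g') (comult W P) := by
  rw [← AlgHom.comp_apply]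
  congr 1
  apply MvPolynomial.algHom_ext
  intro c
  rw [evalAt_X, AlgHom.comp_apply, comult, MvPolynomial.aeval_X]
  match c with
  | none =>
    rw [Algebra.TensorProduct.productMap_apply_tmul, evalAt_none, evalAt_none]
    change LinearMap.det _ = _
    rw [mul_inv_rev, Units.val_mul, map_mul, mul_comm]
  | some (i, j) =>
    simp only [map_sum, Algebra.TensorProduct.productMap_apply_tmul, evalAt_X, glCoord_some,
      Units.val_mul, mat_mul, Matrix.mul_apply]

theorem evalAt_inv (g : LinearMap.GeneralLinearGroup A (A ⊗[ℚ] W)) (P : CoordRing W) :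
    evalAt g⁻¹ P = evalAt g (antipode W P) := by
  rw [← AlgHom.comp_apply]
  congr 1
  apply MvPolynomial.algHom_ext
  intro c
  rw [evalAt_X, AlgHom.comp_apply, antipode, MvPolynomial.aeval_X]
  match c with
  | none =>
    change LinearMap.det _ = _
    rw [evalAt_det, inv_inv]
  | some (i, j) =>
    change _ = evalAt g (genMatrixInv W i j)
    rw [glCoord_some, ← genMatrixInv_map, Matrix.map_apply]

/-- The family `G` of groups is functorial. -/
def GroupFamily.IsFunctorial (G : GroupFamily W) : Prop :=
  ∀ (A B : Type) [CommRing A] [Algebra ℚ A] [CommRing B] [Algebra ℚ B] (φ : A →ₐ[ℚ] B),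
    ∀ g ∈ G A, ∃ g' ∈ G B, IsExtension φ g g'

/-- The ideal of the polynomials that vanish on a family of groups. -/
def GroupFamily.vanishingIdeal (G : GroupFamily W) : Ideal (CoordRing W) where
  carrier := {P | ∀ (A : Type) [CommRing A] [Algebra ℚ A], ∀ g ∈ G A, evalAt g P = 0}
  add_mem' hP hP' A _ _ g hg := by rw [map_add, hP A g hg, hP' A g hg, add_zero]
  zero_mem' A _ _ g hg := map_zero _
  smul_mem' c P hP A _ _ g hg := by rw [smul_eq_mul, map_mul, hP A g hg, mul_zero]

/-- A point of a family of groups, with values in some algebra. -/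
structure GroupFamily.Point (G : GroupFamily W) where
  /-- the algebra -/
  alg : Type
  [ring : CommRing alg]
  [algebra : Algebra ℚ alg]
  /-- the point -/
  pt : LinearMap.GeneralLinearGroup alg (alg ⊗[ℚ] W)
  mem : pt ∈ G alg

attribute [instance] GroupFamily.Point.ring GroupFamily.Point.algebra

/-- The points of `G` separate the quotient of the coordinate ring by the vanishing ideal I, so
pairs of points separate its tensor square. Functoriality moves both points of a pair to the tensor
product of their algebras, where their product lies in `G` and is a zero of `P`. -/
theorem GroupFamily.IsFunctorial.map_comult {G : GroupFamily W} (hG : G.IsFunctorial)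
    {P : CoordRing W} (hP : P ∈ G.vanishingIdeal) :
    Algebra.TensorProduct.map (Ideal.Quotient.mkₐ ℚ G.vanishingIdeal)
      (Ideal.Quotient.mkₐ ℚ G.vanishingIdeal) (comult W P) = 0 := by
  set f : ∀ p : G.Point, (CoordRing W ⧸ G.vanishingIdeal) →ₐ[ℚ] p.alg := fun p =>
    Ideal.Quotient.liftₐ G.vanishingIdeal (evalAt p.pt) (fun P hP => hP p.alg p.pt p.mem) with hf
  have hfm : ∀ p, (f p).comp (Ideal.Quotient.mkₐ ℚ G.vanishingIdeal) = evalAt p.pt := fun p =>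
    AlgHom.ext fun P => rfl
  refine eq_zero_of_map (fun p => (f p).toLinearMap) ?_ ?_
  · intro u hu
    obtain ⟨P, rfl⟩ := Ideal.Quotient.mk_surjective u
    rw [Ideal.Quotient.eq_zero_iff_mem]
    intro A _ _ g hg
    exact hu ⟨A, g, hg⟩
  · intro p p'
    change Algebra.TensorProduct.map (f p) (f p') _ = 0
    rw [← AlgHom.comp_apply, ← Algebra.TensorProduct.map_comp, hfm, hfm]
    obtain ⟨x, hx, hpx⟩ := hG _ _
      (Algebra.TensorProduct.includeLeft : p.alg →ₐ[ℚ] p.alg ⊗[ℚ] p'.alg) _ p.mem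
    obtain ⟨y, hy, hpy⟩ := hG _ _
      (Algebra.TensorProduct.includeRight : p'.alg →ₐ[ℚ] p.alg ⊗[ℚ] p'.alg) _ p'.mem
    have h0 := hP _ (x * y) (mul_mem hx hy)
    rw [evalAt_mul] at h0
    rw [← h0]
    congr 1
    apply Algebra.TensorProduct.ext
    · ext c
      simp [hpx.evalAt_eq]
    · ext c
      simp [hpy.evalAt_eq]

/-- The Zariski closure of a functorial family of groups. -/
def GroupFamily.zariskiClosure (G : GroupFamily W) (hG : G.IsFunctorial) : GroupFamily W :=
  fun A _ _ =>
  { carrier := {g | ∀ P ∈ G.vanishingIdeal, evalAt g P = 0}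
    mul_mem' := by
      intro x y hx hy P hP
      -- Both `x` and `y` kill the vanishing ideal, so evaluation at xy factors through the tensor
      -- square of the quotient, where the comultiplication of `P` is zero.
      have e : Algebra.TensorProduct.productMap (evalAt x) (evalAt y) =
          (Algebra.TensorProduct.productMap
            (Ideal.Quotient.liftₐ G.vanishingIdeal (evalAt x) hx)
            (Ideal.Quotient.liftₐ G.vanishingIdeal (evalAt y) hy)).comp
            (Algebra.TensorProduct.map (Ideal.Quotient.mkₐ ℚ G.vanishingIdeal)
              (Ideal.Quotient.mkₐ ℚ G.vanishingIdeal)) := by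
        apply Algebra.TensorProduct.ext
        · ext c; simp; rfl
        · ext c; simp; rfl
      rw [evalAt_mul, e, AlgHom.comp_apply, hG.map_comult hP, map_zero]
    one_mem' := fun P hP => hP A 1 (one_mem _)
    inv_mem' := by
      intro x hx P hP
      rw [evalAt_inv]
      refine hx _ fun B _ _ g hg => ?_
      rw [← evalAt_inv]
      exact hP B _ (inv_mem hg) }

theorem GroupFamily.zariskiClosure_isAlgebraic {G : GroupFamily W} (hG : G.IsFunctorial) :
    (G.zariskiClosure hG).IsAlgebraic :=
  ⟨G.vanishingIdeal, fun _ _ _ _ => Iff.rfl⟩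

theorem GroupFamily.le_zariskiClosure {G : GroupFamily W} (hG : G.IsFunctorial) :
    G A ≤ G.zariskiClosure hG A := fun g hg _ hP => hP A g hg

end Closure

end

end KugaSatake


namespace KugaSatake

noncomputable section

/-! ### Polynomial functions on the even Clifford algebra -/

section PolyFun

variable {E : Type*} [Ring E] [Algebra ℚ E] [FiniteDimensional ℚ E]

/-- The index set of the matrix entries of endomorphisms of `E`. -/
abbrev EntryIndex (E : Type*) [Ring E] [Algebra ℚ E] :=
  Module.Free.ChooseBasisIndex ℚ E × Module.Free.ChooseBasisIndex ℚ E

/-- The entries of the matrix of the left multiplication by `y`. -/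
def leftEntry {R : Type*} [CommRing R] [Algebra ℚ R] (p : EntryIndex E) :
    R ⊗[ℚ] E →ₗ[R] R :=
  ((Module.Free.chooseBasis ℚ E).baseChange R).coord p.1 ∘ₗ
    LinearMap.mulRight R (1 ⊗ₜ Module.Free.chooseBasis ℚ E p.2)

/-- The value of a polynomial in the entries of the matrix of the left multiplication by `y`. -/
def polyAt {R : Type*} [CommRing R] [Algebra ℚ R] (F : MvPolynomial (EntryIndex E) ℚ)
    (y : R ⊗[ℚ] E) : R :=
  MvPolynomial.aeval (fun p => leftEntry p y) F

variable {R R' : Type*} [CommRing R] [Algebra ℚ R] [CommRing R'] [Algebra ℚ R']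

theorem leftEntry_scalarMap (φ : R →ₐ[ℚ] R') (p : EntryIndex E) (y : R ⊗[ℚ] E) :
    leftEntry p (scalarMap φ E y) = φ (leftEntry p y) := by
  have : (1 : R') ⊗ₜ[ℚ] Module.Free.chooseBasis ℚ E p.2 =
      scalarMap φ E (1 ⊗ₜ Module.Free.chooseBasis ℚ E p.2) := by simp
  simp only [leftEntry, LinearMap.comp_apply, LinearMap.mulRight_apply, Module.Basis.coord_apply]
  rw [this, ← scalarMap_mul, repr_scalarMap]

theorem polyAt_scalarMap (φ : R →ₐ[ℚ] R') (F : MvPolynomial (EntryIndex E) ℚ) (y : R ⊗[ℚ] E) :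
    polyAt F (scalarMap φ E y) = φ (polyAt F y) := by
  rw [polyAt, polyAt, ← AlgHom.comp_apply, MvPolynomial.comp_aeval]
  congr 2
  funext p
  exact leftEntry_scalarMap φ p y

/-- A polynomial over a `ℚ`-algebra is zero if it vanishes at all nonzero rational numbers. -/
theorem polynomial_eq_zero_of_rat {q : Polynomial R}
    (h : ∀ t : ℚ, t ≠ 0 → q.eval (algebraMap ℚ R t) = 0) : q = 0 := by
  ext i
  rw [Polynomial.coeff_zero, ← Module.forall_dual_apply_eq_zero_iff ℚ]
  intro l
  -- `R` need not be a domain, so roots cannot be counted there. A ℚ-linear functional applied to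
  -- the coefficients gives a rational polynomial with infinitely many roots.
  set ql : Polynomial ℚ := ∑ j ∈ q.support, Polynomial.monomial j (l (q.coeff j)) with hql
  have hev : ∀ t : ℚ, ql.eval t = l (q.eval (algebraMap ℚ R t)) := by
    intro t
    rw [Polynomial.eval_eq_sum (p := q), Polynomial.sum, map_sum, hql,
      Polynomial.eval_finsetSum]
    refine Finset.sum_congr rfl fun j _ => ?_
    rw [Polynomial.eval_monomial, ← map_pow, mul_comm (q.coeff j), ← Algebra.smul_def, map_smul,
      smul_eq_mul, mul_comm]
  have h0 : ql = 0 := by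
    apply Polynomial.eq_zero_of_infinite_isRoot
    refine Set.Infinite.mono (s := {0}ᶜ) (fun t ht => ?_) (Set.finite_singleton 0).infinite_compl
    change ql.eval t = 0
    rw [hev, h t ht, map_zero]
  have hc : ql.coeff i = l (q.coeff i) := by
    rw [hql, Polynomial.finsetSum_coeff]
    simp only [Polynomial.coeff_monomial]
    rw [Finset.sum_ite_eq' q.support i]
    split_ifs with hi
    · rfl
    · rw [Polynomial.notMem_support_iff.1 hi, map_zero]
  rw [← hc, h0, Polynomial.coeff_zero]

/-- F(ty) is a polynomial in t; it vanishes at all nonzero rationals, so it is zero. Hence t may be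
replaced by any scalar of any extension, also by one that is not a unit. -/
theorem polyAt_smul_eq_zero (φ : R →ₐ[ℚ] R') (F : MvPolynomial (EntryIndex E) ℚ) (y : R ⊗[ℚ] E)
    (h : ∀ t : ℚ, t ≠ 0 → polyAt F (algebraMap ℚ R t • y) = 0) (c : R') :
    polyAt F (c • scalarMap φ E y) = 0 := by
  set q : Polynomial R :=
    MvPolynomial.aeval (fun p => Polynomial.C (leftEntry p y) * Polynomial.X) F with hq
  have hev : ∀ (c : R'), polyAt F (c • scalarMap φ E y) = q.eval₂ φ.toRingHom c := by
    intro c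
    have h2 : q.eval₂ φ.toRingHom c = Polynomial.eval₂AlgHom φ c (fun _ => Commute.all _ _) q := rfl
    rw [h2, hq, ← AlgHom.comp_apply, MvPolynomial.comp_aeval, polyAt]
    congr 2
    funext p
    rw [map_smul, leftEntry_scalarMap, smul_eq_mul, mul_comm]
    simp
  have hev' : ∀ (c : R), polyAt F (c • y) = q.eval c := by
    intro c
    have h2 : q.eval c = ((Polynomial.aeval c).restrictScalars ℚ : Polynomial R →ₐ[ℚ] R) q := by
      simp [Polynomial.coe_aeval_eq_eval]
    rw [h2, hq, ← AlgHom.comp_apply, MvPolynomial.comp_aeval, polyAt]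
    congr 2
    funext p
    rw [map_smul, smul_eq_mul, mul_comm]
    simp
  rw [hev, polynomial_eq_zero_of_rat fun t ht => (hev' _).symm.trans (h t ht),
    Polynomial.eval₂_zero]

end PolyFun

/-! ### Algebraic groups of left multiplications as equations on C⁺(Q) -/

section Equations

variable {V : Type*} [AddCommGroup V] [Module ℚ V] {Q : LinearMap.BilinForm ℚ V}

/-- A scalar as an element of `C⁺(Q)_A`. -/
def scalarUnit (Q : LinearMap.BilinForm ℚ V) {A : Type} [CommRing A] [Algebra ℚ A] :
    Aˣ →* (A ⊗[ℚ] EvenCliff Q)ˣ :=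
  Units.map (algebraMap A (A ⊗[ℚ] EvenCliff Q) : _ →* _)

theorem scalarUnit_mul_val {A : Type} [CommRing A] [Algebra ℚ A] (c : Aˣ)
    (u : (A ⊗[ℚ] EvenCliff Q)ˣ) : (scalarUnit Q c * u).val = c.val • u.val := by
  exact (Algebra.smul_def c.val u.val).symm

variable [FiniteDimensional ℚ (EvenCliff Q)]

/-- Clearing the powers of the determinant gives equations that make sense at every element of
C⁺(Q)_A. This is needed because they will be evaluated at `twistedEven`, whose values need not be
units. -/
theorem GroupFamily.IsAlgebraic.exists_equations {G : GroupFamily (EvenCliff Q)}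
    (hG : G.IsAlgebraic) : ∃ T : Set (MvPolynomial (EntryIndex (EvenCliff Q)) ℚ),
      ∀ (A : Type) [CommRing A] [Algebra ℚ A] (u : (A ⊗[ℚ] EvenCliff Q)ˣ),
        sigma Q A u ∈ G A ↔ ∀ F ∈ T, polyAt F u.val = 0 := by
  obtain ⟨S, hS⟩ := hG
  choose k F hF using fun P => exists_clear_det (W := EvenCliff Q) P
  refine ⟨F '' S, fun A _ _ u => ?_⟩
  have key : ∀ P, polyAt (F P) u.val =
      LinearMap.det (sigma Q A u).val ^ k P * evalAt (sigma Q A u) P := by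
    intro P
    rw [← hF, polyAt]
    congr 2
    funext p
    rw [mat, LinearMap.toMatrix_apply]
    simp [leftEntry, sigma_apply]
  have hu : ∀ P, IsUnit (LinearMap.det (sigma Q A u).val ^ k P) := fun P =>
    ((sigma Q A u).isUnit.map LinearMap.det).pow _
  rw [hS, Set.forall_mem_image]
  refine forall₂_congr fun P _ => ?_
  rw [key, (hu P).mul_right_eq_zero]
  rfl

end Equations

/-! ### Scalars lie in every admissible group -/

section Scalars

variable {V : Type*} [AddCommGroup V] [Module ℚ V] {H : HodgeStructure V 2}
  {Q : LinearMap.BilinForm ℚ V} [FiniteDimensional ℚ (EvenCliff Q)]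

/-- Since h_s(t) = t for real t, the equations of `G` hold at all nonzero rational scalars, hence at
all scalars. -/
theorem scalarUnit_mem (hQ : IsK3Type H Q) {G : GroupFamily (EvenCliff Q)} (hG : G.IsAlgebraic)
    (hh : ∀ z : ℂˣ, (kugaSatake hQ).h z ∈ G ℝ) {A : Type} [CommRing A] [Algebra ℚ A] (c : Aˣ) :
    sigma Q A (scalarUnit Q c) ∈ G A := by
  obtain ⟨T, hT⟩ := hG.exists_equations
  refine (hT _ _).2 fun F hF => ?_
  have h1 : ∀ t : ℚ, t ≠ 0 → polyAt F (algebraMap ℚ ℚ t • (1 : ℚ ⊗[ℚ] EvenCliff Q)) = 0 := by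
    intro t ht
    set z : ℂˣ := Units.mk0 ((t : ℝ) : ℂ) (by exact_mod_cast ht) with hz
    have h2 := (hT ℝ (ksUnit hQ z)).1 (hh z) F hF
    rw [ksUnit_apply, hz, Units.val_mk0, Complex.ofReal_re, Complex.ofReal_im, zero_smul,
      sub_zero] at h2
    have h3 : algebraMap ℝ (ℝ ⊗[ℚ] EvenCliff Q) (t : ℝ) = scalarMap (Algebra.ofId ℚ ℝ) _
        (algebraMap ℚ ℚ t • (1 : ℚ ⊗[ℚ] EvenCliff Q)) := by
      rw [Algebra.TensorProduct.one_def, TensorProduct.smul_tmul', scalarMap_tmul,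
        Algebra.TensorProduct.algebraMap_apply]
      simp
    rw [h3, polyAt_scalarMap] at h2
    exact (algebraMap ℚ ℝ).injective (h2.trans (map_zero _).symm)
  have h2 := polyAt_smul_eq_zero (Algebra.ofId ℚ A) F 1 h1 c.val
  rw [Algebra.TensorProduct.one_def, scalarMap_tmul, map_one, ← Algebra.TensorProduct.one_def,
    ← Algebra.algebraMap_eq_smul_one] at h2
  exact h2

end Scalars

end

end KugaSatake


namespace KugaSatake

noncomputable section

/-! ### The similitudes `λ ρ(g)` with `g` in an algebraic subgroup -/

section SimGroup

variable {V : Type*} [AddCommGroup V] [Module ℚ V] {Q : LinearMap.BilinForm ℚ V}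

/-- A scalar as an element of `GL(V)`. -/
def homothety (V : Type*) [AddCommGroup V] [Module ℚ V] {A : Type} [CommRing A] [Algebra ℚ A] :
    Aˣ →* LinearMap.GeneralLinearGroup A (A ⊗[ℚ] V) :=
  Units.map (algebraMap A (Module.End A (A ⊗[ℚ] V)) : _ →* _)

theorem homothety_apply {A : Type} [CommRing A] [Algebra ℚ A] (c : Aˣ) (v : A ⊗[ℚ] V) :
    (homothety V c).val v = c.val • v := rfl

theorem homothety_comm {A : Type} [CommRing A] [Algebra ℚ A] (c : Aˣ)
    (g : LinearMap.GeneralLinearGroup A (A ⊗[ℚ] V)) :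
    homothety V c * g = g * homothety V c := by
  apply Units.ext
  apply LinearMap.ext
  intro v
  simp only [Units.val_mul, Module.End.mul_apply, homothety_apply, map_smul]

/-- The group of all `λ ρ(g)`, where `λ` is a scalar and `g ∈ CSpin(Q)` lies in `G`. -/
def simGroup (G : GroupFamily (EvenCliff Q)) : GroupFamily V := fun A _ _ =>
  { carrier := {n | ∃ (c : Aˣ) (g : cspinUnits Q A), sigma Q A g ∈ G A ∧
      n = homothety V c * rho Q A g}
    mul_mem' := by
      rintro _ _ ⟨c, g, hg, rfl⟩ ⟨c', g', hg', rfl⟩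
      refine ⟨c * c', g * g', by rw [Subgroup.coe_mul, map_mul]; exact mul_mem hg hg', ?_⟩
      rw [map_mul, map_mul, mul_assoc, ← mul_assoc (rho Q A g), ← homothety_comm]
      simp only [mul_assoc]
    one_mem' := ⟨1, 1, by rw [Subgroup.coe_one, map_one]; exact one_mem _, by simp⟩
    inv_mem' := by
      rintro _ ⟨c, g, hg, rfl⟩
      refine ⟨c⁻¹, g⁻¹, by rw [Subgroup.coe_inv, map_inv]; exact inv_mem hg, ?_⟩
      rw [mul_inv_rev, map_inv (rho Q A), ← map_inv (homothety V), homothety_comm] }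

theorem simGroup_isFunctorial [FiniteDimensional ℚ V] [FiniteDimensional ℚ (EvenCliff Q)]
    {G : GroupFamily (EvenCliff Q)} (hG : G.IsAlgebraic) : (simGroup G).IsFunctorial := by
  rintro A B _ _ _ _ φ _ ⟨c, g, hg, rfl⟩
  refine ⟨_, ⟨Units.map (φ : A →* B) c, ⟨_, unitsMap_mem_cspinUnits φ g.2⟩,
    (sigma_unitsMap φ g.1).mem hG hg, rfl⟩, fun x => ?_⟩
  simp only [Units.val_mul, Module.End.mul_apply, homothety_apply, rho_unitsMap, scalarMap_smul]
  rfl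

theorem h_mem_simGroup {H : HodgeStructure V 2} (hQ : IsK3Type H Q)
    {G : GroupFamily (EvenCliff Q)} (hh : ∀ z : ℂˣ, (kugaSatake hQ).h z ∈ G ℝ) (z : ℂˣ) :
    H.h z ∈ simGroup G ℝ := by
  refine ⟨Units.mk0 _ (normSq_unit_ne_zero z), ⟨_, ksUnit_mem_cspinUnits hQ z⟩, hh z, ?_⟩
  apply Units.ext
  apply LinearMap.ext
  intro v
  rw [Units.val_mul, Module.End.mul_apply, homothety_apply, rho_ksUnit, Units.val_mk0, smul_smul,
    mul_inv_cancel₀ (normSq_unit_ne_zero z), one_smul]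

end SimGroup

/-! ### Recovering `g²` from `λ ρ(g)` -/

section Twisted

variable {V : Type*} [AddCommGroup V] [Module ℚ V] (Q : LinearMap.BilinForm ℚ V)
  {r : ℕ} (e : Module.Basis (Fin r) ℚ V)

/-- The inclusion `V_R → C(Q)_R`. -/
def vecInclusion (R : Type*) [CommRing R] [Algebra ℚ R] : R ⊗[ℚ] V →ₗ[R] R ⊗[ℚ] Cliff Q :=
  (CliffordAlgebra.ι (LinearMap.BilinMap.toQuadraticMap Q)).baseChange R

/-- The averaging operator twisted by the square of an endomorphism of `V`, without denominators. -/
def twistedAverage {R : Type*} [CommRing R] [Algebra ℚ R] (n : R ⊗[ℚ] V →ₗ[R] R ⊗[ℚ] V)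
    (l : List (Fin r)) (x : R ⊗[ℚ] Cliff Q) : R ⊗[ℚ] Cliff Q :=
  l.foldr (fun i x => vecInclusion Q R (n (1 ⊗ₜ e i)) * (vecInclusion Q R (n (1 ⊗ₜ e i)) * x) +
    vecInclusion Q R (n (n (1 ⊗ₜ e i))) * (x * vecInclusion Q R (1 ⊗ₜ e i))) x

variable {A : Type} [CommRing A] [Algebra ℚ A]

theorem scalarMap_twistedAverage {R : Type*} [CommRing R] [Algebra ℚ R] (φ : R →ₐ[ℚ] A)
    {n : R ⊗[ℚ] V →ₗ[R] R ⊗[ℚ] V} {n' : A ⊗[ℚ] V →ₗ[A] A ⊗[ℚ] V}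
    (hn : ∀ x, scalarMap φ V (n x) = n' (scalarMap φ V x)) (l : List (Fin r))
    (x : R ⊗[ℚ] Cliff Q) :
    scalarMap φ _ (twistedAverage Q e n l x) = twistedAverage Q e n' l (scalarMap φ _ x) := by
  have hv : ∀ v, scalarMap φ _ (vecInclusion Q R v) = vecInclusion Q A (scalarMap φ _ v) :=
    fun v => scalarMap_baseChange φ _ v
  induction l with
  | nil => rfl
  | cons i l ih =>
    change scalarMap φ _ (_ * (_ * twistedAverage Q e n l x) +
      _ * (twistedAverage Q e n l x * _)) = _ * (_ * twistedAverage Q e n' l (scalarMap φ _ x)) +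
      _ * (twistedAverage Q e n' l (scalarMap φ _ x) * _)
    simp only [map_add, scalarMap_mul, hv, hn, ih, scalarMap_tmul, map_one]

variable {Q} {e}

/-- For n = cρ(g) one has n(eᵢ)² = c²qᵢ and n²(eᵢ) = c²g²eᵢg⁻². On g²y a step is thus c²qᵢg² times
the plain averaging step on y. The second iterate of n makes both terms of degree two in c, so c
comes out as a common factor; the price is g² in place of g. -/
theorem twistedAverage_of_sim (he : IsOrthBasis Q e) (c : Aˣ) (g : cspinUnits Q A)
    (l : List (Fin r)) (y : A ⊗[ℚ] Cliff Q) :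
    twistedAverage Q e (homothety V c * rho Q A g).val l
      (evenIncl Q A g.1.val * (evenIncl Q A g.1.val * y)) =
    (l.map fun i => c.val ^ 2 * algebraMap ℚ A (Q (e i) (e i))).prod •
      (evenIncl Q A g.1.val * (evenIncl Q A g.1.val *
        AnticommGen.average (fun i => vecIncl Q A (1 ⊗ₜ e i))
          (fun i => algebraMap ℚ A (Q (e i) (e i))) l y)) := by
  induction l with
  | nil => simp [twistedAverage, AnticommGen.average]
  | cons i l ih =>
    have hgen := he.anticommGen A
    change vecIncl Q A _ * (vecIncl Q A _ * twistedAverage Q e _ l _) +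
      vecIncl Q A _ * (twistedAverage Q e _ l _ * vecIncl Q A _) = _
    rw [ih, AnticommGen.average_cons, AnticommGen.averageStep_apply, List.map_cons, List.prod_cons]
    generalize AnticommGen.average (fun i => vecIncl Q A (1 ⊗ₜ e i))
      (fun i => algebraMap ℚ A (Q (e i) (e i))) l y = z
    generalize (l.map fun i => c.val ^ 2 * algebraMap ℚ A (Q (e i) (e i))).prod = κ
    have hu := hgen.unit i
    have hsq := hgen.sq i
    simp only [Units.val_mul, Module.End.mul_apply, homothety_apply, map_smul, rho_apply]
    have h1 : evenIncl Q A (g.1⁻¹).val * evenIncl Q A g.1.val = 1 := by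
      rw [← map_mul, Units.inv_mul, map_one]
    generalize evenIncl Q A (g.1⁻¹).val = x' at *
    generalize evenIncl Q A g.1.val = x at *
    generalize vecIncl Q A (1 ⊗ₜ e i) = ε at *
    generalize algebraMap ℚ A (Q (e i) (e i)) = q at *
    have h1' : ∀ w, x' * (x * w) = w := fun w => by rw [← mul_assoc, h1, one_mul]
    have h2 : ∀ w, ε * (ε * w) = q • w := fun w => by rw [← mul_assoc, hsq, Algebra.smul_def]
    simp only [smul_mul_assoc, mul_smul_comm, mul_assoc, h1', h2, smul_smul, mul_add, smul_add]
    congr 1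
    · congr 1; ring
    · congr 1
      have := Ring.mul_inverse_cancel _ hu
      linear_combination (-(c.val ^ 2 * κ)) * this

/-- The universal even element that becomes a multiple of `g²` at `λ ρ(g)`. -/
def twistedEven [FiniteDimensional ℚ V] (e : Module.Basis (Fin r) ℚ V) (x : EvenCliff Q) :
    CoordRing V ⊗[ℚ] EvenCliff Q :=
  (evenPart Q).baseChange _ (twistedAverage Q e (genEnd V) (List.finRange r)
    (evenInclusion Q (CoordRing V) (1 ⊗ₜ x)))

theorem evenPart_evenIncl (y : A ⊗[ℚ] EvenCliff Q) :
    (evenPart Q).baseChange A (evenIncl Q A y) = y := by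
  induction y using TensorProduct.induction_on with
  | zero => simp
  | add x y hx hy => simp only [map_add, hx, hy]
  | tmul a y => rw [evenIncl_tmul, LinearMap.baseChange_tmul, evenPart_even]

/-- Write x = g²(g⁻²x): the average of g⁻²x is the scalar d, so the value is a scalar times g². Here
d may fail to be a unit. -/
theorem scalarMap_twistedEven [FiniteDimensional ℚ V] (he : IsOrthBasis Q e) (c : Aˣ)
    (g : cspinUnits Q A) (x : EvenCliff Q) {d : A}
    (hd : AnticommGen.average (fun i => vecIncl Q A (1 ⊗ₜ e i))
      (fun i => algebraMap ℚ A (Q (e i) (e i)))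
      (List.finRange r) (evenIncl Q A ((g.1⁻¹).val * ((g.1⁻¹).val * (1 ⊗ₜ x)))) =
        algebraMap A _ d) :
    scalarMap (evalAt (homothety V c * rho Q A g)) _ (twistedEven e x) =
      (((List.finRange r).map fun i => c.val ^ 2 * algebraMap ℚ A (Q (e i) (e i))).prod * d) •
        (g.1 * g.1).val := by
  have h1 : evenIncl Q A (1 ⊗ₜ x) = evenIncl Q A g.1.val * (evenIncl Q A g.1.val *
      (evenIncl Q A ((g.1⁻¹).val * ((g.1⁻¹).val * (1 ⊗ₜ x))))) := by
    rw [← map_mul, ← map_mul]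
    simp only [← mul_assoc, Units.mul_inv, one_mul]
  rw [twistedEven, scalarMap_baseChange, scalarMap_twistedAverage Q e _ (scalarMap_genEnd _),
    scalarMap_evenInclusion, scalarMap_tmul, map_one, h1, twistedAverage_of_sim he, hd,
    ← Algebra.commutes, ← Algebra.smul_def, mul_smul_comm, smul_smul, ← map_mul, map_smul,
    evenPart_evenIncl, Units.val_mul]

end Twisted

/-! ### Squares of elements of `CSpin(Q)` -/

section Squares

variable {V : Type*} [AddCommGroup V] [Module ℚ V]
  {H : HodgeStructure V 2} {Q : LinearMap.BilinForm ℚ V} {r : ℕ} {e : Module.Basis (Fin r) ℚ V}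

theorem IsOrthBasis.exists_average (he : IsOrthBasis Q e) {A : Type} [CommRing A] [Algebra ℚ A]
    (y : A ⊗[ℚ] EvenCliff Q) : ∃ d : A, AnticommGen.average (fun i => vecIncl Q A (1 ⊗ₜ e i))
      (fun i => algebraMap ℚ A (Q (e i) (e i))) (List.finRange r) (evenIncl Q A y) =
        algebraMap A _ d := by
  obtain ⟨d, hd⟩ := Algebra.mem_bot.1
    ((he.anticommGen A).average_mem_bot (involuteA_evenIncl Q y))
  exact ⟨d, hd.symm⟩

/-- Otherwise, by linearity, the average of `u * y` would lie in the maximal ideal for every y; but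
for y = u⁻¹ it is a power of 2. -/
theorem IsOrthBasis.exists_isUnit_average (he : IsOrthBasis Q e) {A : Type} [CommRing A]
    [Algebra ℚ A] [IsLocalRing A] (u : (A ⊗[ℚ] EvenCliff Q)ˣ) : ∃ (x : EvenCliff Q) (d : A),
      IsUnit d ∧ AnticommGen.average (fun i => vecIncl Q A (1 ⊗ₜ e i))
        (fun i => algebraMap ℚ A (Q (e i) (e i))) (List.finRange r)
        (evenIncl Q A (u.val * (1 ⊗ₜ x))) = algebraMap A _ d := by
  by_contra! hcon
  have key : ∀ y, ∃ d ∈ IsLocalRing.maximalIdeal A,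
      AnticommGen.average (fun i => vecIncl Q A (1 ⊗ₜ e i))
      (fun i => algebraMap ℚ A (Q (e i) (e i))) (List.finRange r)
      (evenIncl Q A (u.val * y)) = algebraMap A _ d := by
    intro y
    induction y using TensorProduct.induction_on with
    | zero => exact ⟨0, zero_mem _, by simp⟩
    | add x y hx hy =>
      obtain ⟨d, hd, h⟩ := hx
      obtain ⟨d', hd', h'⟩ := hy
      exact ⟨d + d', add_mem hd hd', by rw [mul_add, map_add, map_add, h, h', map_add]⟩
    | tmul a x =>
      obtain ⟨d, hd⟩ := he.exists_average (u.val * ((1 : A) ⊗ₜ x))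
      have hm : d ∈ IsLocalRing.maximalIdeal A := by
        rw [IsLocalRing.mem_maximalIdeal, mem_nonunits_iff]
        exact fun hu => hcon x d hu hd
      have hax : a ⊗ₜ[ℚ] x = a • ((1 : A) ⊗ₜ[ℚ] x) := by
        rw [TensorProduct.smul_tmul', smul_eq_mul, mul_one]
      refine ⟨a * d, Ideal.mul_mem_left _ a hm, ?_⟩
      rw [hax, mul_smul_comm, map_smul, map_smul, hd, map_mul, Algebra.smul_def]
  obtain ⟨d, hd, h⟩ := key (u⁻¹).val
  rw [Units.mul_inv, map_one, (he.anticommGen A).average_one] at h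
  have h2 := algebraMap_cliff_injective Q h
  rw [← h2, IsLocalRing.mem_maximalIdeal, mem_nonunits_iff] at hd
  exact hd (isUnit_two.pow _)

/-- If `SO(Q)` is contained in the Mumford-Tate group of `V`, then an algebraic group that contains
the image of `h_s` contains the squares of the elements of `CSpin(Q)` over `SO(Q)`. -/
theorem sq_mem_of_local [FiniteDimensional ℚ V] (hQ : IsK3Type H Q) (he : IsOrthBasis Q e)
    [FiniteDimensional ℚ (EvenCliff Q)] {G : GroupFamily (EvenCliff Q)} (hG : G.IsAlgebraic)
    (hh : ∀ z : ℂˣ, (kugaSatake hQ).h z ∈ G ℝ)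
    (hSO : ∀ (A : Type) [CommRing A] [Algebra ℚ A], groupSO Q A ≤ mumfordTate H A)
    {A : Type} [CommRing A] [Algebra ℚ A] [IsLocalRing A] (g : cspinUnits Q A)
    (hg : rho Q A g ∈ groupSO Q A) : sigma Q A (g.1 * g.1) ∈ G A := by
  have hfun := simGroup_isFunctorial (V := V) hG
  have hcl : rho Q A g ∈ (simGroup G).zariskiClosure hfun A := by
    have h1 := hSO A hg
    simp only [mumfordTate, Subgroup.mem_iInf] at h1
    exact h1 _ (GroupFamily.zariskiClosure_isAlgebraic hfun)
      (fun z => GroupFamily.le_zariskiClosure hfun (h_mem_simGroup hQ hh z))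
  obtain ⟨T, hT⟩ := hG.exists_equations
  obtain ⟨x, d, hd, hx⟩ := he.exists_isUnit_average (g.1⁻¹ * g.1⁻¹)
  rw [Units.val_mul, mul_assoc] at hx
  have hval := scalarMap_twistedEven he 1 g x hx
  rw [map_one, one_mul] at hval
  set κ := ((List.finRange r).map fun i =>
    (1 : Aˣ).val ^ 2 * algebraMap ℚ A (Q (e i) (e i))).prod with hκ
  have hκu : IsUnit κ := by
    rw [hκ]
    refine List.prod_induction _ (fun _ _ => IsUnit.mul) isUnit_one fun a ha => ?_
    obtain ⟨i, -, rfl⟩ := List.mem_map.1 ha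
    rw [Units.val_one, one_pow, one_mul]
    exact (IsUnit.mk0 _ (he.ne_zero i)).map _
  obtain ⟨c, hc⟩ := hκu.mul hd
  rw [← hc, ← scalarUnit_mul_val] at hval
  have hmem : sigma Q A (scalarUnit Q c * (g.1 * g.1)) ∈ G A := by
    refine (hT _ _).2 fun F hF => ?_
    rw [← hval, polyAt_scalarMap]
    -- Being in the closure, ρ(g) satisfies every polynomial identity that holds on `simGroup G`. So
    -- only points c'ρ(g') with g' in `G` need to be checked, and there the value is a scalar times
    -- g'².
    refine hcl _ ?_
    rintro B _ _ _ ⟨c', g', hg', rfl⟩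
    obtain ⟨d', hd'⟩ := he.exists_average ((g'.1⁻¹).val * ((g'.1⁻¹).val * ((1 : B) ⊗ₜ x)))
    rw [← polyAt_scalarMap, scalarMap_twistedEven he c' g' x hd']
    have hid : scalarMap (AlgHom.id ℚ B) _ (g'.1 * g'.1).val = (g'.1 * g'.1).val :=
      LinearMap.rTensor_id_apply _ _ _
    rw [← hid]
    -- The scalar need not be invertible, so its product with g'² need not be a point of `G`; it is
    -- replaced by nonzero rational scalars.
    refine polyAt_smul_eq_zero _ _ _ (fun t ht => ?_) _
    have ht' : IsUnit (algebraMap ℚ B t) := (IsUnit.mk0 t ht).map _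
    obtain ⟨s, hs⟩ := ht'
    rw [← hs, ← scalarUnit_mul_val]
    refine (hT _ _).1 ?_ F hF
    rw [map_mul, map_mul]
    exact mul_mem (scalarUnit_mem hQ hG hh s) (mul_mem hg' hg')
  rw [map_mul] at hmem
  exact (Subgroup.mul_mem_cancel_left _ (scalarUnit_mem hQ hG hh c)).1 hmem

end Squares

end

end KugaSatake


namespace KugaSatake

noncomputable section

/-! ### Products of two anisotropic vectors -/

section Pairs

variable {V : Type*} [AddCommGroup V] [Module ℚ V] {Q : LinearMap.BilinForm ℚ V}
  {A B : Type} [CommRing A] [Algebra ℚ A] [CommRing B] [Algebra ℚ B]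

theorem scalarMap_vecMul (φ : A →ₐ[ℚ] B) (v w : A ⊗[ℚ] V) :
    scalarMap φ _ (vecMul Q A v w) = vecMul Q B (scalarMap φ V v) (scalarMap φ V w) := by
  apply evenIncl_injective Q B
  rw [← scalarMap_evenIncl, evenIncl_vecMul, evenIncl_vecMul, scalarMap_mul, scalarMap_vecIncl,
    scalarMap_vecIncl]

theorem baseChange_scalarMap (φ : A →ₐ[ℚ] B) (v w : A ⊗[ℚ] V) :
    Q.baseChange B (scalarMap φ V v) (scalarMap φ V w) = φ (Q.baseChange A v w) := by
  induction v using TensorProduct.induction_on with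
  | zero => simp
  | add v₁ v₂ h₁ h₂ => simp only [map_add, LinearMap.add_apply, h₁, h₂]
  | tmul a v =>
    induction w using TensorProduct.induction_on with
    | zero => simp
    | add v₁ v₂ h₁ h₂ => simp only [map_add, h₁, h₂]
    | tmul b w =>
      rw [scalarMap_tmul, scalarMap_tmul, LinearMap.BilinForm.baseChange_tmul,
        LinearMap.BilinForm.baseChange_tmul, map_smul, map_mul]

theorem vecIncl_mul_cancel (v : A ⊗[ℚ] V) (x : A ⊗[ℚ] Cliff Q) :
    vecIncl Q A v * (vecIncl Q A v * x) = Q.baseChange A v v • x := by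
  rw [← mul_assoc, vecIncl_sq, Algebra.smul_def]

theorem vecMul_mul_vecMul_swap (v w : A ⊗[ℚ] V) :
    vecMul Q A v w * vecMul Q A w v =
      algebraMap A _ (Q.baseChange A v v * Q.baseChange A w w) := by
  apply evenIncl_injective Q A
  rw [map_mul, evenIncl_vecMul, evenIncl_vecMul, AlgHom.commutes, mul_assoc, vecIncl_mul_cancel,
    mul_smul_comm, vecIncl_sq, Algebra.smul_def, ← map_mul, mul_comm]

variable (hs : ∀ v w, Q v w = Q w v)
include hs

theorem vecIncl_mul_mul_mul {v w : A ⊗[ℚ] V} (hv : IsUnit (Q.baseChange A v v))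
    (hw : IsUnit (Q.baseChange A w w)) (x : A ⊗[ℚ] V) :
    vecIncl Q A v * vecIncl Q A w * vecIncl Q A x * (vecIncl Q A w * vecIncl Q A v) =
      (Q.baseChange A v v * Q.baseChange A w w) • vecIncl Q A (reflect Q v (reflect Q w x)) := by
  have h1 := vecIncl_reflect Q hs hw x
  have h2 := vecIncl_reflect Q hs hv (reflect Q w x)
  calc _ = vecIncl Q A v * (vecIncl Q A w * vecIncl Q A x) * vecIncl Q A w * vecIncl Q A v := by
        simp only [mul_assoc]
    _ = -(vecIncl Q A v * vecIncl Q A (reflect Q w x)) *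
          (vecIncl Q A w * (vecIncl Q A w * vecIncl Q A v)) := by
        rw [← neg_eq_iff_eq_neg.2 h1]; simp only [mul_neg, neg_mul, mul_assoc]
    _ = vecIncl Q A (reflect Q v (reflect Q w x)) *
          (vecIncl Q A v * (vecIncl Q A w * (vecIncl Q A w * vecIncl Q A v))) := by
        rw [← h2]; simp only [mul_assoc]
    _ = _ := by
        rw [vecIncl_mul_cancel, mul_smul_comm, vecIncl_sq, mul_smul_comm, ← Algebra.commutes,
          ← Algebra.smul_def, smul_smul, mul_comm]

/-- The inverse of vw is wv divided by Q(v, v)Q(w, w). Conjugation by vw is a product of two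
reflections, because the two signs cancel. -/
theorem exists_pairUnit {v w : A ⊗[ℚ] V} (hv : IsUnit (Q.baseChange A v v))
    (hw : IsUnit (Q.baseChange A w w)) : ∃ g : cspinUnits Q A, g.1.val = vecMul Q A v w ∧
      ∀ x, (rho Q A g).val x = reflect Q v (reflect Q w x) := by
  obtain ⟨c, hc⟩ := hv.mul hw
  have key : ∀ (v w : A ⊗[ℚ] V), IsUnit (Q.baseChange A v v) → IsUnit (Q.baseChange A w w) →
      Q.baseChange A v v * Q.baseChange A w w = c.val → ∀ x,
      evenIncl Q A (vecMul Q A v w) * vecIncl Q A x *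
        evenIncl Q A ((c⁻¹).val • vecMul Q A w v) =
          vecIncl Q A (reflect Q v (reflect Q w x)) := by
    intro v w hv hw h x
    rw [map_smul, evenIncl_vecMul, evenIncl_vecMul, mul_smul_comm, vecIncl_mul_mul_mul hs hv hw, h,
      smul_smul, Units.inv_mul, one_smul]
  have e1 : vecMul Q A v w * ((c⁻¹).val • vecMul Q A w v) = 1 := by
    rw [mul_smul_comm, vecMul_mul_vecMul_swap, ← hc, Algebra.algebraMap_eq_smul_one, smul_smul,
      Units.inv_mul, one_smul]
  have e2 : ((c⁻¹).val • vecMul Q A w v) * vecMul Q A v w = 1 := by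
    rw [smul_mul_assoc, vecMul_mul_vecMul_swap, mul_comm, ← hc,
      Algebra.algebraMap_eq_smul_one, smul_smul, Units.inv_mul, one_smul]
  refine ⟨⟨⟨vecMul Q A v w, (c⁻¹).val • vecMul Q A w v, e1, e2⟩,
    fun x => ⟨_, key v w hv hw hc.symm x⟩,
    fun x => ⟨_, Eq.trans ?_ (key w v hw hv ((mul_comm _ _).trans hc.symm) x)⟩⟩, rfl, fun x => ?_⟩
  · simp only [Units.inv_mk, map_smul, smul_mul_assoc, mul_smul_comm]
  · apply vecIncl_injective Q A
    rw [rho_apply]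
    exact key v w hv hw hc.symm x

theorem exists_pairUnit_mem_SO [FiniteDimensional ℚ V] {v w : A ⊗[ℚ] V}
    (hv : IsUnit (Q.baseChange A v v)) (hw : IsUnit (Q.baseChange A w w)) :
    ∃ g : cspinUnits Q A, g.1.val = vecMul Q A v w ∧ rho Q A g ∈ groupSO Q A := by
  obtain ⟨g, hg, hr⟩ := exists_pairUnit hs hv hw
  refine ⟨g, hg, fun x y => ?_, ?_⟩
  · rw [hr, hr, reflect_isometry Q hs hv, reflect_isometry Q hs hw]
  · have : (rho Q A g).val = reflect Q v * reflect Q w := LinearMap.ext hr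
    rw [this, map_mul, det_reflect Q hv, det_reflect Q hw]
    norm_num

/-- For vectors of equal length, the square of `v₁ (v₁ ± v₂)` is a multiple of `v₁ v₂`. -/
theorem vecMul_sq_of_norm_eq {v₁ v₂ : A ⊗[ℚ] V} {ε : A}
    (hε : ε * ε = 1) (hq : Q.baseChange A v₂ v₂ = Q.baseChange A v₁ v₁) :
    vecMul Q A v₁ (v₁ + ε • v₂) * vecMul Q A v₁ (v₁ + ε • v₂) =
      (ε * Q.baseChange A (v₁ + ε • v₂) (v₁ + ε • v₂)) • vecMul Q A v₁ v₂ := by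
  set s := v₁ + ε • v₂ with hs'
  have h1 : 2 * Q.baseChange A s v₁ = Q.baseChange A s s := by
    simp only [hs', map_add, map_smul, LinearMap.add_apply, LinearMap.smul_apply, smul_eq_mul, hq,
      baseChange_symm Q hs v₂ v₁]
    linear_combination (-(Q.baseChange A v₁ v₁)) * hε
  apply evenIncl_injective Q A
  have h2 : vecIncl Q A s * (vecIncl Q A v₁ * vecIncl Q A s) =
      Q.baseChange A s s • (vecIncl Q A s - vecIncl Q A v₁) := by
    rw [← mul_assoc, vecIncl_mul_swap Q hs s v₁, h1, sub_mul, mul_assoc, vecIncl_sq,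
      ← Algebra.smul_def, ← Algebra.commutes, ← Algebra.smul_def, smul_sub]
  have h3 : vecIncl Q A s - vecIncl Q A v₁ = ε • vecIncl Q A v₂ := by
    rw [← map_sub, hs', add_sub_cancel_left, map_smul]
  rw [map_mul, map_smul, evenIncl_vecMul, evenIncl_vecMul, mul_assoc, h2, h3, mul_smul_comm,
    mul_smul_comm, smul_smul, mul_comm ε]

end Pairs

/-! ### Products of two anisotropic vectors lie in every admissible group -/

section PairsMem

variable {V : Type*} [AddCommGroup V] [Module ℚ V] [FiniteDimensional ℚ V]
  {H : HodgeStructure V 2} {Q : LinearMap.BilinForm ℚ V} {r : ℕ} {e : Module.Basis (Fin r) ℚ V}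
  [FiniteDimensional ℚ (EvenCliff Q)]

/-- The lengths of v₁ + v₂ and v₁ - v₂ add up to 4Q(v₁, v₁), a unit, so over a local ring one of
them, s, is anisotropic. Then v₁s lies over SO(Q) and its square is a unit multiple of v₁v₂. -/
theorem pair_mem_of_local (hQ : IsK3Type H Q) (he : IsOrthBasis Q e)
    {G : GroupFamily (EvenCliff Q)} (hG : G.IsAlgebraic)
    (hh : ∀ z : ℂˣ, (kugaSatake hQ).h z ∈ G ℝ)
    (hSO : ∀ (A : Type) [CommRing A] [Algebra ℚ A], groupSO Q A ≤ mumfordTate H A)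
    {A : Type} [CommRing A] [Algebra ℚ A] [IsLocalRing A] {v₁ v₂ : A ⊗[ℚ] V}
    (hv : IsUnit (Q.baseChange A v₁ v₁)) (hq : Q.baseChange A v₂ v₂ = Q.baseChange A v₁ v₁)
    {u : (A ⊗[ℚ] EvenCliff Q)ˣ} (hu : u.val = vecMul Q A v₁ v₂) : sigma Q A u ∈ G A := by
  have main : ∀ ε : A, ε * ε = 1 →
      IsUnit (Q.baseChange A (v₁ + ε • v₂) (v₁ + ε • v₂)) → sigma Q A u ∈ G A := by
    intro ε hε hs
    obtain ⟨g, hg, hr⟩ := exists_pairUnit_mem_SO he.symm hv hs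
    obtain ⟨c, hc⟩ := (IsUnit.of_mul_eq_one ε hε).mul hs
    have h1 : g.1 * g.1 = scalarUnit Q c * u := by
      apply Units.ext
      rw [scalarUnit_mul_val, Units.val_mul, hg, hu, hc, vecMul_sq_of_norm_eq he.symm hε hq]
    have h2 := sq_mem_of_local hQ he hG hh hSO g hr
    rw [h1, map_mul] at h2
    exact (Subgroup.mul_mem_cancel_left _ (scalarUnit_mem hQ hG hh c)).1 h2
  have hsum : IsUnit (Q.baseChange A (v₁ + (1 : A) • v₂) (v₁ + (1 : A) • v₂) +
      Q.baseChange A (v₁ + (-1 : A) • v₂) (v₁ + (-1 : A) • v₂)) := by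
    have : Q.baseChange A (v₁ + (1 : A) • v₂) (v₁ + (1 : A) • v₂) +
      Q.baseChange A (v₁ + (-1 : A) • v₂) (v₁ + (-1 : A) • v₂) =
        2 * 2 * Q.baseChange A v₁ v₁ := by
      simp only [map_add, map_smul, LinearMap.add_apply, LinearMap.smul_apply, smul_eq_mul, hq]
      ring
    rw [this]
    exact (isUnit_two.mul isUnit_two).mul hv
  rcases IsLocalRing.isUnit_or_isUnit_of_isUnit_add hsum with h | h
  · exact main 1 (by ring) h
  · exact main (-1) (by ring) h

/-- Adjoin t with t² = Q(v, v)/Q(w, w), so that tw has the length of v. The ring A embeds into A[t],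
hence into the product of the localizations of A[t] at maximal ideals, and membership in `G`
descends from these. -/
theorem pair_mem (hQ : IsK3Type H Q) (he : IsOrthBasis Q e)
    {G : GroupFamily (EvenCliff Q)} (hG : G.IsAlgebraic)
    (hh : ∀ z : ℂˣ, (kugaSatake hQ).h z ∈ G ℝ)
    (hSO : ∀ (A : Type) [CommRing A] [Algebra ℚ A], groupSO Q A ≤ mumfordTate H A)
    {A : Type} [CommRing A] [Algebra ℚ A] {v w : A ⊗[ℚ] V}
    (hv : IsUnit (Q.baseChange A v v)) (hw : IsUnit (Q.baseChange A w w))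
    {u : (A ⊗[ℚ] EvenCliff Q)ˣ} (hu : u.val = vecMul Q A v w) : sigma Q A u ∈ G A := by
  set c : A := Q.baseChange A v v * Ring.inverse (Q.baseChange A w w) with hc
  have hcw : c * Q.baseChange A w w = Q.baseChange A v v := by
    rw [hc, mul_assoc, Ring.inverse_mul_cancel _ hw, mul_one]
  let B := QuadraticAlgebra A c 0
  let φ : ∀ m : MaximalSpectrum B, A →ₐ[ℚ] Localization.AtPrime m.asIdeal := fun m =>
    (IsScalarTower.toAlgHom ℚ B (Localization.AtPrime m.asIdeal)).comp
      (IsScalarTower.toAlgHom ℚ A B)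
  refine mem_of_extensions hG φ (fun a ha => ?_) fun m => ?_
  · apply QuadraticAlgebra.algebraMap_injective (a := c) (b := 0)
    rw [map_zero]
    exact eq_zero_of_localization _ fun J hJ => ha ⟨J, hJ⟩
  · refine ⟨_, ?_, sigma_unitsMap (φ m) u⟩
    set t : Localization.AtPrime m.asIdeal := algebraMap B _ QuadraticAlgebra.omega with ht
    have ht2 : t * t = φ m c := by
      rw [ht, ← map_mul, QuadraticAlgebra.omega_mul_omega_eq_mk]
      rfl
    have hv' : IsUnit (φ m (Q.baseChange A v v)) := hv.map _
    have htq : Q.baseChange _ (t • scalarMap (φ m) V w) (t • scalarMap (φ m) V w) =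
        Q.baseChange _ (scalarMap (φ m) V v) (scalarMap (φ m) V v) := by
      simp only [map_smul, LinearMap.smul_apply, smul_eq_mul]
      rw [← mul_assoc, ht2, baseChange_scalarMap, baseChange_scalarMap, ← map_mul, hcw]
    have htu : IsUnit t := by
      have : IsUnit (t * t * φ m (Q.baseChange A w w)) := by rwa [ht2, ← map_mul, hcw]
      exact isUnit_of_mul_isUnit_left (isUnit_of_mul_isUnit_left this)
    obtain ⟨t', ht'⟩ := htu
    have hmem : sigma Q _ (scalarUnit Q t' * unitsMap (φ m) Q u) ∈ G _ := by
      refine pair_mem_of_local hQ he hG hh hSO (v₁ := scalarMap (φ m) V v)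
        (v₂ := t • scalarMap (φ m) V w) (by rwa [baseChange_scalarMap]) htq ?_
      rw [scalarUnit_mul_val, unitsMap_val, hu, scalarMap_vecMul, map_smul, ht']
    rw [map_mul] at hmem
    exact (Subgroup.mul_mem_cancel_left _ (scalarUnit_mem hQ hG hh t')).1 hmem

end PairsMem

/-! ### Generation of `CSpin(Q)` over a local ring -/

section LocalGeneration

variable {V : Type*} [AddCommGroup V] [Module ℚ V] {Q : LinearMap.BilinForm ℚ V}
  {r : ℕ} {e : Module.Basis (Fin r) ℚ V} {A : Type} [CommRing A] [Algebra ℚ A]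

/-- A ℚ-linear retraction of ℚ → C(Q), extended to `A`, turns an inverse in the Clifford algebra
into an inverse in `A`. -/
theorem isUnit_of_isUnit_algebraMap {d : A} (h : IsUnit (algebraMap A (A ⊗[ℚ] Cliff Q) d)) :
    IsUnit d := by
  obtain ⟨l, hl⟩ := LinearMap.exists_leftInverse_of_injective (Algebra.linearMap ℚ (Cliff Q))
    (LinearMap.ker_eq_bot.2 (FaithfulSMul.algebraMap_injective ℚ (Cliff Q)))
  obtain ⟨y, hy⟩ := h.exists_right_inv
  have h1 := congrArg (functional A l) hy
  rw [← Algebra.smul_def, map_smul, Algebra.TensorProduct.one_def, functional_tmul] at h1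
  have h2 : l 1 = 1 := by simpa using LinearMap.congr_fun hl 1
  rw [h2, one_smul, smul_eq_mul] at h1
  exact IsUnit.of_mul_eq_one _ h1

theorem isUnit_vecIncl {v : A ⊗[ℚ] V} (hv : IsUnit (Q.baseChange A v v)) :
    IsUnit (vecIncl Q A v) := by
  have h : IsUnit (vecIncl Q A v * vecIncl Q A v) := by
    rw [vecIncl_sq]; exact hv.map _
  exact ((Commute.refl (vecIncl Q A v)).isUnit_mul_iff.1 h).1

/-- The element `z` of `C(Q)_A` comes from an element of the group `S` of even units. -/
def LiesIn (S : Subgroup (A ⊗[ℚ] EvenCliff Q)ˣ) (z : A ⊗[ℚ] Cliff Q) : Prop :=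
  ∃ γ ∈ S, evenIncl Q A γ.val = z

theorem LiesIn.mul {S : Subgroup (A ⊗[ℚ] EvenCliff Q)ˣ} {y z : A ⊗[ℚ] Cliff Q}
    (hy : LiesIn S y) (hz : LiesIn S z) : LiesIn S (y * z) := by
  obtain ⟨γ, hγ, rfl⟩ := hy
  obtain ⟨δ, hδ, rfl⟩ := hz
  exact ⟨γ * δ, mul_mem hγ hδ, by rw [Units.val_mul, map_mul]⟩

/-- Either `y` is even and lies in `S`, or `y` is odd and its products with anisotropic vectors lie
in `S`. -/
def LiesInGraded (S : Subgroup (A ⊗[ℚ] EvenCliff Q)ˣ) (y : A ⊗[ℚ] Cliff Q) : Prop :=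
  (involuteA Q A y = y ∧ LiesIn S y) ∨
    (involuteA Q A y = -y ∧ ∀ v, IsUnit (Q.baseChange A v v) → LiesIn S (vecIncl Q A v * y))

variable {S : Subgroup (A ⊗[ℚ] EvenCliff Q)ˣ} (hscal : ∀ c : Aˣ, scalarUnit Q c ∈ S)
include hscal

theorem liesIn_smul_iff {d : A} (hd : IsUnit d) {y : A ⊗[ℚ] Cliff Q} :
    LiesIn S (d • y) ↔ LiesIn S y := by
  have key : ∀ (c : Aˣ) {y : A ⊗[ℚ] Cliff Q}, LiesIn S y → LiesIn S (c.val • y) := by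
    rintro c _ ⟨γ, hγ, rfl⟩
    exact ⟨scalarUnit Q c * γ, mul_mem (hscal c) hγ, by rw [scalarUnit_mul_val, map_smul]⟩
  obtain ⟨c, rfl⟩ := hd
  refine ⟨fun h => ?_, key c⟩
  have := key c⁻¹ h
  rwa [smul_smul, Units.inv_mul, one_smul] at this

variable (hpair : ∀ v w, IsUnit (Q.baseChange A v v) → IsUnit (Q.baseChange A w w) →
  LiesIn S (vecIncl Q A v * vecIncl Q A w))
include hpair

theorem LiesInGraded.of_vecIncl_mul {w : A ⊗[ℚ] V} (hw : IsUnit (Q.baseChange A w w))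
    {y : A ⊗[ℚ] Cliff Q} (h : LiesInGraded S (vecIncl Q A w * y)) : LiesInGraded S y := by
  have hwu := isUnit_vecIncl hw
  rw [LiesInGraded, map_mul, involuteA_vecIncl, neg_mul] at h
  rcases h with ⟨h1, h2⟩ | ⟨h1, h2⟩
  · refine Or.inr ⟨?_, fun v hv => ?_⟩
    · rw [← mul_neg] at h1
      exact neg_eq_iff_eq_neg.1 (hwu.mul_left_cancel h1)
    · have h3 := (hpair v w hv hw).mul h2
      rwa [mul_assoc, vecIncl_mul_cancel, mul_smul_comm, liesIn_smul_iff hscal hw] at h3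
  · refine Or.inl ⟨hwu.mul_left_cancel (neg_injective h1), ?_⟩
    have h3 := h2 w hw
    rwa [vecIncl_mul_cancel, liesIn_smul_iff hscal hw] at h3

/-- The argument of Cartan and Dieudonné, with k basis vectors still to be fixed by σ. Put u = σ(b)
for the next basis vector b. The lengths of u - b and u + b add up to the unit 4Q(b, b), so one of
these vectors is anisotropic. The reflection in u - b sends u to b; the one in u + b sends u to -b,
and the reflection in b corrects the sign. The vectors already fixed are orthogonal to u and b and
stay fixed. Each reflection corresponds to a multiplication of y by a vector, which `LiesInGraded`
tolerates. -/
theorem liesInGraded_of_conj [IsLocalRing A] (he : IsOrthBasis Q e) (k : ℕ) : ∀ m, m + k = r →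
    ∀ (y : A ⊗[ℚ] Cliff Q) (σ : A ⊗[ℚ] V →ₗ[A] A ⊗[ℚ] V), IsUnit y →
      (∀ v, y * vecIncl Q A v = vecIncl Q A (σ v) * involuteA Q A y) →
      (∀ v w, Q.baseChange A (σ v) (σ w) = Q.baseChange A v w) →
      (∀ i : Fin r, i.val < m → σ (1 ⊗ₜ e i) = 1 ⊗ₜ e i) → LiesInGraded S y := by
  have hgen := he.anticommGen A
  have hsymm := baseChange_symm (A := A) Q he.symm
  induction k with
  | zero =>
    intro m hm y σ hy hrel _ hfix
    -- Once σ fixes the whole basis, the involute of `y` lies in the graded centre, so `y` is a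
    -- scalar.
    obtain ⟨d, hd⟩ := Algebra.mem_bot.1 (hgen.mem_bot_of_comm (y := involuteA Q A y) fun i => by
      rw [hgen.map_map, hrel, hfix i (by omega)])
    have hyd : algebraMap A _ d = y := by
      rw [← hgen.map_map y, ← hd, AlgHom.commutes]
    obtain ⟨c, rfl⟩ := isUnit_of_isUnit_algebraMap (hyd ▸ hy)
    refine Or.inl ⟨hd.symm.trans hyd, scalarUnit Q c, hscal c, ?_⟩
    rw [← hyd]
    exact AlgHom.commutes _ _
  | succ k ih =>
    intro m hm y σ hy hrel hiso hfix
    set b : Fin r → A ⊗[ℚ] V := fun i => 1 ⊗ₜ e i with hb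
    have hunit : ∀ i, IsUnit (Q.baseChange A (b i) (b i)) := fun i => by
      rw [hb, LinearMap.BilinForm.baseChange_tmul, mul_one, ← Algebra.algebraMap_eq_smul_one]
      exact hgen.unit i
    have horth : ∀ i j, i ≠ j → Q.baseChange A (b i) (b j) = 0 := fun i j hij => by
      rw [hb, LinearMap.BilinForm.baseChange_tmul, he.ortho i j hij, zero_smul]
    have hrefl : ∀ (w : A ⊗[ℚ] V), IsUnit (Q.baseChange A w w) → ∀ (y : A ⊗[ℚ] Cliff Q)
        (σ : A ⊗[ℚ] V →ₗ[A] A ⊗[ℚ] V),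
        (∀ v, y * vecIncl Q A v = vecIncl Q A (σ v) * involuteA Q A y) →
        ∀ v, vecIncl Q A w * y * vecIncl Q A v =
          vecIncl Q A ((reflect Q w ∘ₗ σ) v) * involuteA Q A (vecIncl Q A w * y) := by
      intro w hw y σ h v
      rw [mul_assoc, h, map_mul, involuteA_vecIncl, LinearMap.comp_apply, neg_mul, mul_neg,
        ← mul_assoc, ← mul_assoc, vecIncl_reflect Q he.symm hw, neg_mul, neg_neg]
    have hrefl_fix : ∀ w x : A ⊗[ℚ] V, Q.baseChange A w x = 0 → reflect Q w x = x := by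
      intro w x h
      rw [reflect_apply, h, mul_zero, zero_smul, sub_zero]
    have hrefl_half : ∀ w x : A ⊗[ℚ] V, IsUnit (Q.baseChange A w w) →
        2 * Q.baseChange A w x = Q.baseChange A w w → reflect Q w x = x - w := by
      intro w x hw h
      rw [reflect_apply, mul_right_comm, h, Ring.mul_inverse_cancel _ hw, one_smul]
    have hmr : m < r := by omega
    set j : Fin r := ⟨m, hmr⟩ with hj
    set u := σ (b j) with hu
    have huu : Q.baseChange A u u = Q.baseChange A (b j) (b j) := hiso _ _
    have hu0 : ∀ i : Fin r, i.val < m → Q.baseChange A u (b i) = 0 := by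
      intro i hi
      have h1 := hiso (b j) (b i)
      rw [hb, hfix i hi] at h1
      exact h1.trans (horth j i (fun h => by rw [← h, hj] at hi; exact lt_irrefl _ hi))
    have hj0 : ∀ i : Fin r, i.val < m → Q.baseChange A (b j) (b i) = 0 := fun i hi =>
      horth j i (fun h => by rw [← h, hj] at hi; exact lt_irrefl _ hi)
    have hcases : IsUnit (Q.baseChange A (u - b j) (u - b j)) ∨
        IsUnit (Q.baseChange A (u + b j) (u + b j)) := by
      apply IsLocalRing.isUnit_or_isUnit_of_isUnit_add
      have : Q.baseChange A (u - b j) (u - b j) + Q.baseChange A (u + b j) (u + b j) =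
          2 * 2 * Q.baseChange A (b j) (b j) := by
        simp only [map_add, map_sub, LinearMap.add_apply, LinearMap.sub_apply, huu]
        ring
      rw [this]
      exact (isUnit_two.mul isUnit_two).mul (hunit j)
    rcases hcases with hw | hw
    · refine LiesInGraded.of_vecIncl_mul hscal hpair hw
        (ih (m + 1) (by omega) _ (reflect Q (u - b j) ∘ₗ σ) ((isUnit_vecIncl hw).mul hy)
          (hrefl _ hw y σ hrel) (fun v w => ?_) fun i hi => ?_)
      · rw [LinearMap.comp_apply, LinearMap.comp_apply, reflect_isometry Q he.symm hw, hiso]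
      · rw [LinearMap.comp_apply]
        rcases Nat.lt_succ_iff_lt_or_eq.1 hi with hi | hi
        · rw [hfix i hi]
          apply hrefl_fix
          rw [map_sub, LinearMap.sub_apply]
          exact (congrArg₂ _ (hu0 i hi) (hj0 i hi)).trans (sub_zero 0)
        · obtain rfl : i = j := Fin.ext hi
          change reflect Q (u - b j) u = b j
          rw [hrefl_half _ _ hw, sub_sub_cancel]
          simp only [map_sub, LinearMap.sub_apply, huu, hsymm u (b j)]
          ring
    · refine LiesInGraded.of_vecIncl_mul hscal hpair hw
        (LiesInGraded.of_vecIncl_mul hscal hpair (hunit j)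
          (ih (m + 1) (by omega) _ (reflect Q (b j) ∘ₗ reflect Q (u + b j) ∘ₗ σ)
          ((isUnit_vecIncl (hunit j)).mul ((isUnit_vecIncl hw).mul hy))
          (hrefl _ (hunit j) _ _ (hrefl _ hw y σ hrel)) (fun v w => ?_) fun i hi => ?_))
      · simp only [LinearMap.comp_apply]
        rw [reflect_isometry Q he.symm (hunit j), reflect_isometry Q he.symm hw, hiso]
      · simp only [LinearMap.comp_apply]
        rcases Nat.lt_succ_iff_lt_or_eq.1 hi with hi | hi
        · rw [hfix i hi, hrefl_fix (u + b j) (1 ⊗ₜ e i)]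
          · exact hrefl_fix _ _ (hj0 i hi)
          · rw [map_add, LinearMap.add_apply]
            exact (congrArg₂ _ (hu0 i hi) (hj0 i hi)).trans (add_zero 0)
        · obtain rfl : i = j := Fin.ext hi
          change reflect Q (b j) (reflect Q (u + b j) u) = b j
          rw [hrefl_half (u + b j) u hw, sub_add_cancel_left, map_neg, reflect_apply, mul_assoc,
            Ring.inverse_mul_cancel _ (hunit j), mul_one, two_smul]
          · abel
          · simp only [map_add, LinearMap.add_apply, huu, hsymm u (b j)]
            ring

theorem cspinUnits_le_of_local [IsLocalRing A] (he : IsOrthBasis Q e) : cspinUnits Q A ≤ S := by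
  intro g hg
  have hrel : ∀ v, evenIncl Q A g.val * vecIncl Q A v =
      vecIncl Q A ((rho Q A ⟨g, hg⟩).val v) * involuteA Q A (evenIncl Q A g.val) := by
    intro v
    rw [rho_apply, involuteA_evenIncl, mul_assoc _ (evenIncl Q A _) (evenIncl Q A _), ← map_mul,
      Units.inv_mul, map_one, mul_one]
  have hxy : evenIncl Q A g.val * evenIncl Q A (g⁻¹).val = 1 := by
    rw [← map_mul, Units.mul_inv, map_one]
  have hyx : evenIncl Q A (g⁻¹).val * evenIncl Q A g.val = 1 := by
    rw [← map_mul, Units.inv_mul, map_one]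
  have hu : IsUnit (evenIncl Q A g.val) := g.isUnit.map _
  rcases liesInGraded_of_conj hscal hpair he r 0 (zero_add r) _ _ hu hrel
    (isometry_of_conj Q he.symm hxy hyx (rho_apply ⟨g, hg⟩))
    (fun i hi => absurd hi (Nat.not_lt_zero _))
    with ⟨-, γ, hγ, h⟩ | ⟨h, -⟩
  · rwa [← Units.ext (evenIncl_injective Q A h)]
  -- An even unit cannot be odd as well: that would give 2 = 0 in a local ring over ℚ.
  · rw [involuteA_evenIncl, eq_neg_iff_add_eq_zero, ← two_mul] at h
    have h2 : (2 : A ⊗[ℚ] Cliff Q) = algebraMap A _ 2 := (map_ofNat _ 2).symm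
    rw [hu.mul_left_eq_zero, h2] at h
    exact absurd (algebraMap_cliff_injective Q (h.trans (map_zero _).symm)) isUnit_two.ne_zero

end LocalGeneration

/-! ### The lower bound for the Mumford-Tate group -/

section LowerBound

theorem groupSO_le_groupGO {V : Type*} [AddCommGroup V] [Module ℚ V] (Q : LinearMap.BilinForm ℚ V)
    (A : Type) [CommRing A] [Algebra ℚ A] :
    groupSO Q A ≤ groupGO Q A := fun _ hg => ⟨1, fun v w => by rw [hg.1, Units.val_one, one_mul]⟩

variable {V : Type*} [AddCommGroup V] [Module ℚ V] [FiniteDimensional ℚ V]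
  {H : HodgeStructure V 2} {Q : LinearMap.BilinForm ℚ V}

/-- At each localization at a maximal ideal, CSpin(Q) is generated by scalars and pairs of
anisotropic vectors, all of which lie in `G`; these localizations jointly detect membership over
`A`. -/
theorem groupCSpin_le_of_groupSO_le (hQ : IsK3Type H Q)
    {G : GroupFamily (EvenCliff Q)} (hG : G.IsAlgebraic)
    (hh : ∀ z : ℂˣ, (kugaSatake hQ).h z ∈ G ℝ)
    (hSO : ∀ (A : Type) [CommRing A] [Algebra ℚ A], groupSO Q A ≤ mumfordTate H A)
    (A : Type) [CommRing A] [Algebra ℚ A] : groupCSpin Q A ≤ G A := by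
  obtain ⟨r, e, he⟩ := hQ.exists_orthBasis
  have := he.finite_evenCliff
  rintro _ ⟨g, hg, rfl⟩
  refine mem_of_extensions hG
    (fun m : MaximalSpectrum A => IsScalarTower.toAlgHom ℚ A (Localization.AtPrime m.asIdeal))
    (fun a ha => eq_zero_of_localization a fun J hJ => ha ⟨J, hJ⟩)
    fun m => ⟨_, ?_, sigma_unitsMap _ g⟩
  refine cspinUnits_le_of_local (S := (G (Localization.AtPrime m.asIdeal)).comap (sigma Q _))
    (fun c => scalarUnit_mem hQ hG hh c) (fun v w hv hw => ?_) he (unitsMap_mem_cspinUnits _ hg)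
  obtain ⟨γ, hγ, -⟩ := exists_pairUnit he.symm hv hw
  exact ⟨γ.1, pair_mem hQ he hG hh hSO hv hw hγ, by rw [hγ, evenIncl_vecMul]⟩

theorem mumfordTate_kugaSatake_le (hQ : IsK3Type H Q) (A : Type) [CommRing A] [Algebra ℚ A] :
    mumfordTate (kugaSatake hQ) A ≤ groupCSpin Q A := by
  obtain ⟨r, e, he⟩ := hQ.exists_orthBasis
  have := he.finite_evenCliff
  exact iInf_le_of_le (groupCSpin Q) (iInf_le_of_le groupCSpin_isAlgebraic
    (iInf_le _ fun z => ⟨_, ksUnit_mem_cspinUnits hQ z, rfl⟩))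

theorem mumfordTate_kugaSatake_eq (hQ : IsK3Type H Q)
    (hSO : ∀ (A : Type) [CommRing A] [Algebra ℚ A], groupSO Q A ≤ mumfordTate H A)
    (A : Type) [CommRing A] [Algebra ℚ A] :
    mumfordTate (kugaSatake hQ) A = groupCSpin Q A :=
  le_antisymm (mumfordTate_kugaSatake_le hQ A)
    (le_iInf fun _ => le_iInf fun hG => le_iInf fun hh =>
      groupCSpin_le_of_groupSO_le hQ hG hh hSO A)

end LowerBound

end

end KugaSatake

open KugaSatake in
theorem proposition6p3 {V : Type*} [AddCommGroup V] [Module ℚ V] [FiniteDimensional ℚ V]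
    (H : HodgeStructure V 2) (Q : LinearMap.BilinForm ℚ V) (hQ : IsK3Type H Q) :
    -- the image of `h_s` lies in `CSpin(Q)(ℝ)`
    (∀ z : ℂˣ, (kugaSatake hQ).h z ∈ groupCSpin Q ℝ) ∧
    -- `MT(C⁺(Q)) ⊆ CSpin(Q)`
    (∀ (A : Type) [CommRing A] [Algebra ℚ A],
      mumfordTate (kugaSatake hQ) A ≤ groupCSpin Q A) ∧
    -- equality if `MT(V) = GO(Q)`, and more generally if `SO(Q) ⊆ MT(V)`
    ((∀ (A : Type) [CommRing A] [Algebra ℚ A], mumfordTate H A = groupGO Q A) →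
      ∀ (A : Type) [CommRing A] [Algebra ℚ A],
        mumfordTate (kugaSatake hQ) A = groupCSpin Q A) ∧
    ((∀ (A : Type) [CommRing A] [Algebra ℚ A], groupSO Q A ≤ mumfordTate H A) →
      ∀ (A : Type) [CommRing A] [Algebra ℚ A],
        mumfordTate (kugaSatake hQ) A = groupCSpin Q A) ∧
    -- `h(t e^{iφ}) = t² ρ(h_s(e^{iφ}))`, where `h_s(e^{iφ})` is the image `σ(g)` of `g ∈ CSpin(Q)(ℝ)`
    (∀ (t φ : ℝ) (z u : ℂˣ), (z : ℂ) = t * Complex.exp (φ * Complex.I) →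
      (u : ℂ) = Complex.exp (φ * Complex.I) →
      ∀ g : cspinUnits Q ℝ, sigma Q ℝ g = (kugaSatake hQ).h u →
        (H.h z).val = t ^ 2 • (rho Q ℝ g).val) ∧
    -- `(V, h)` is a sub-Hodge structure of `(C⁺(Q) ⊗ C⁺(Q), h_s ⊗ h_s)`
    (∃ f : V →ₗ[ℚ] EvenCliff Q ⊗[ℚ] EvenCliff Q, Function.Injective f ∧
      IsHodgeMorphism H ((kugaSatake hQ).tensor (kugaSatake hQ)) f) :=
  ⟨fun z => ⟨_, ksUnit_mem_cspinUnits hQ z, rfl⟩,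
    mumfordTate_kugaSatake_le hQ,
    fun hGO => mumfordTate_kugaSatake_eq hQ fun A _ _ => hGO A ▸ groupSO_le_groupGO Q A,
    mumfordTate_kugaSatake_eq hQ,
    h_eq_smul_rho hQ,
    hQ.exists_embedding⟩
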